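/- A \emph{constraint graph} is a finite undirected graph $G=(V,E)$, possibly with loops and multiple edges, in which every edge is red (weight one) or blue (weight two). An \emph{orientation} of $G$ is a multiset of arcs obtained by replacing each edge by a single arc (of the same weight) with the same end vertices; it is \emph{feasible} if at every vertex the total weight of the entering arcs is at least two. An instance of C2C consists of a constraint graph $G$ and two feasible orientations $A_{\mathrm{ini}}, A_{\mathrm{tar}}$ of $G$; it is a yes-instance if there is a finite sequence of feasible orientations of $G$ from $A_{\mathrm{ini}}$ to $A_{\mathrm{tar}}$ in which each orientation equals the preceding one or arises from it by reversing a single arc. Two instances are equivalent if both are yes-instances or neither is. Theorem 2. There is an algorithm, running in time polynomial in the numbers of vertices and edges, that, given an instance of C2C on a constraint graph with $k$ red edges, outputs an equivalent instance of C2C of size $O(k)$; more precisely, the output has at most $8\max(k,1)$ vertices and at most $11\max(k,1)$ edges. -/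

import Mathlib

namespace NCL

/-! ### Constraint graphs, orientations and reconfiguration -/

/-- The two kinds of edges of a constraint graph: red edges have weight one, blue edges have
weight two. -/
inductive Color
  | red
  | blue
  deriving DecidableEq

/-- A constraint graph: an undirected graph with vertex set `V` and edge set `E`, in which loops
and multiple edges are allowed, and whose edges are coloured red (weight one) or blue
(weight two). -/
structure ConstraintGraph (V E : Type) where
  /-- the unordered pair of end vertices of an edge -/
  ends : E → Sym2 V
  /-- the colour (that is, the weight) of an edge -/
  color : E → Color

/-- An arc `((x, y), c)` leaves its tail `x` and enters its head `y`; it carries the colour `c`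
of the edge that it replaces. -/
abbrev Arc (V : Type) : Type := (V × V) × Color

section

variable {V E : Type} [Fintype E]

/-- The multiset of arcs obtained by replacing every edge `e` with the arc `f e`. -/
def ConstraintGraph.arcs (G : ConstraintGraph V E) (f : E → V × V) : Multiset (Arc V) :=
  (Finset.univ : Finset E).val.map fun e => (f e, G.color e)

/-- `A` is an orientation of `G`: a multiset of arcs obtained by replacing each edge with a single
arc having the same end vertices (and the same colour). -/
def ConstraintGraph.IsOrientation (G : ConstraintGraph V E) (A : Multiset (Arc V)) : Prop :=
  ∃ f : E → V × V, (∀ e, s((f e).1, (f e).2) = G.ends e) ∧ A = G.arcs f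

/-- The number of arcs of colour `c` in `A` that enter the vertex `v`. -/
def inDegree [DecidableEq V] (A : Multiset (Arc V)) (c : Color) (v : V) : ℕ :=
  A.countP fun a => a.1.2 = v ∧ a.2 = c

/-- An orientation is feasible if the in-weight of every vertex is at least two. -/
def ConstraintGraph.IsFeasible [DecidableEq V] (G : ConstraintGraph V E)
    (A : Multiset (Arc V)) : Prop :=
  G.IsOrientation A ∧ ∀ v : V, 2 ≤ inDegree A Color.red v + 2 * inDegree A Color.blue v

/-- `A ↔ B`: the two multisets of arcs are equal, or `B = A - (x, y) + (y, x)` for an arc `(x, y)`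
of `A`. -/
def Adjacent (A B : Multiset (Arc V)) : Prop :=
  A = B ∨ ∃ (x y : V) (c : Color) (R : Multiset (Arc V)),
    A = ((x, y), c) ::ₘ R ∧ B = ((y, x), c) ::ₘ R

/-- There is a finite sequence of feasible orientations of `G` that starts with `A`, ends with `B`
and in which consecutive members are adjacent (`A` and `B` themselves being feasible). -/
def ConstraintGraph.Reconfigurable [DecidableEq V] (G : ConstraintGraph V E)
    (A B : Multiset (Arc V)) : Prop :=
  ∃ (l : ℕ) (S : ℕ → Multiset (Arc V)), S 0 = A ∧ S l = B ∧
    (∀ i ≤ l, G.IsFeasible (S i)) ∧ ∀ i < l, Adjacent (S i) (S (i + 1))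

/-- The number of red edges. -/
def ConstraintGraph.numRed (G : ConstraintGraph V E) : ℕ :=
  (Finset.univ.filter fun e => G.color e = Color.red).card

end

/-! ### The problem C2C -/

/-- An instance `(G, A_ini, A_tar)` of C2C, with vertices `0, …, n - 1` and edges `0, …, m - 1`.
The two feasible orientations are given edge by edge; as orientations they are the multisets of
arcs `I.iniArcs` and `I.tarArcs` below. -/
structure C2CInstance where
  /-- number of vertices -/
  n : ℕ
  /-- number of edges -/
  m : ℕ
  /-- the constraint graph -/
  G : ConstraintGraph (Fin n) (Fin m)
  /-- the arc (tail, head) that replaces an edge in the initial orientation -/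
  ini : Fin m → Fin n × Fin n
  /-- the arc (tail, head) that replaces an edge in the target orientation -/
  tar : Fin m → Fin n × Fin n
  ini_ends : ∀ e, s((ini e).1, (ini e).2) = G.ends e
  tar_ends : ∀ e, s((tar e).1, (tar e).2) = G.ends e
  ini_feasible : G.IsFeasible (G.arcs ini)
  tar_feasible : G.IsFeasible (G.arcs tar)

/-- The initial orientation. -/
def C2CInstance.iniArcs (I : C2CInstance) : Multiset (Arc (Fin I.n)) := I.G.arcs I.ini

/-- The target orientation. -/
def C2CInstance.tarArcs (I : C2CInstance) : Multiset (Arc (Fin I.n)) := I.G.arcs I.tar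

/-- The question of C2C: is the target orientation reachable from the initial one? -/
def C2CInstance.IsYes (I : C2CInstance) : Prop := I.G.Reconfigurable I.iniArcs I.tarArcs

/-! ### Random access machines

Structured programs for a random access machine with finitely many arrays of natural numbers
(only the arrays named in the program matter), whose only arithmetic is addition and truncated
subtraction. Every evaluation of a node of an expression and every executed instruction or test
costs one time unit. As there is no multiplication, numbers have at most linearly many bits in
the elapsed time and the size of the input, so that polynomial time on this machine is
polynomial time on a Turing machine. -/

/-- `M a i` is the content of cell `i` of array `a`. -/
abbrev Memory : Type := ℕ → ℕ → ℕ

/-- Expressions: constants, the content of a cell of an array, sum, and truncated difference. -/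
inductive Expr
  | const (c : ℕ)
  | read (a : ℕ) (i : Expr)
  | add (e f : Expr)
  | sub (e f : Expr)

/-- The value of an expression. -/
def Expr.eval (M : Memory) : Expr → ℕ
  | .const c => c
  | .read a i => M a (i.eval M)
  | .add e f => e.eval M + f.eval M
  | .sub e f => e.eval M - f.eval M

/-- The time needed to evaluate an expression. -/
def Expr.cost : Expr → ℕ
  | .const _ => 1
  | .read _ i => i.cost + 1
  | .add e f => e.cost + f.cost + 1
  | .sub e f => e.cost + f.cost + 1

/-- Programs; a test `e` succeeds if the value of `e` is not zero. -/
inductive Program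
  /-- do nothing -/
  | skip
  /-- write the value of `e` into cell `i` of array `a` -/
  | write (a : ℕ) (i e : Expr)
  /-- execute `P`, then `Q` -/
  | seq (P Q : Program)
  /-- if `e ≠ 0` then execute `P`, else execute `Q` -/
  | ite (e : Expr) (P Q : Program)
  /-- while `e ≠ 0`, execute `P` -/
  | loop (e : Expr) (P : Program)

/-- The memory after the value `x` has been written into cell `i` of array `a`. -/
def Memory.update (M : Memory) (a i x : ℕ) : Memory :=
  fun b j => if b = a ∧ j = i then x else M b j

/-- `P.Run M M' t`: started on the memory `M`, the program `P` halts after exactly `t` time units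
with the memory `M'`. -/
inductive Program.Run : Program → Memory → Memory → ℕ → Prop
  | skip (M : Memory) : Run .skip M M 1
  | write (M : Memory) (a : ℕ) (i e : Expr) :
      Run (.write a i e) M (M.update a (i.eval M) (e.eval M)) (i.cost + e.cost + 1)
  | seq {P Q : Program} {M M' M'' : Memory} {t t' : ℕ} :
      Run P M M' t → Run Q M' M'' t' → Run (.seq P Q) M M'' (t + t')
  | ite_true {e : Expr} {P Q : Program} {M M' : Memory} {t : ℕ} :
      e.eval M ≠ 0 → Run P M M' t → Run (.ite e P Q) M M' (e.cost + 1 + t)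
  | ite_false {e : Expr} {P Q : Program} {M M' : Memory} {t : ℕ} :
      e.eval M = 0 → Run Q M M' t → Run (.ite e P Q) M M' (e.cost + 1 + t)
  | loop_true {e : Expr} {P : Program} {M M' M'' : Memory} {t t' : ℕ} :
      e.eval M ≠ 0 → Run P M M' t → Run (.loop e P) M' M'' t' →
      Run (.loop e P) M M'' (e.cost + 1 + t + t')
  | loop_false {e : Expr} {P : Program} {M : Memory} :
      e.eval M = 0 → Run (.loop e P) M M (e.cost + 1)

/-! ### Polynomial-time algorithms on instances of C2C -/

/-- The weight of a colour. -/
def Color.weight : Color → ℕ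
  | .red => 1
  | .blue => 2

/-- The first `m` cells of an array hold the list `g 0, …, g (m - 1)`; the others are zero. -/
def arrayOf {m : ℕ} (g : Fin m → ℕ) (i : ℕ) : ℕ :=
  if h : i < m then g ⟨i, h⟩ else 0

/-- The input memory for an instance: array 0 holds the numbers of vertices and edges, arrays 1
and 2 hold the tails and heads of the arcs of the initial orientation, arrays 3 and 4 those of the
target orientation, and array 5 the weights, edge by edge. All other cells are zero. -/
def C2CInstance.input (I : C2CInstance) : Memory
  | 0 => fun i => if i = 0 then I.n else if i = 1 then I.m else 0
  | 1 => arrayOf fun e => ((I.ini e).1 : ℕ)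
  | 2 => arrayOf fun e => ((I.ini e).2 : ℕ)
  | 3 => arrayOf fun e => ((I.tar e).1 : ℕ)
  | 4 => arrayOf fun e => ((I.tar e).2 : ℕ)
  | 5 => arrayOf fun e => (I.G.color e).weight
  | _ => fun _ => 0

/-- The memory `M` holds the instance `J`, in the format of the input; what the remaining cells
contain does not matter. -/
def C2CInstance.IsStoredIn (J : C2CInstance) (M : Memory) : Prop :=
  M 0 0 = J.n ∧ M 0 1 = J.m ∧ ∀ e : Fin J.m,
    M 1 e = (J.ini e).1 ∧ M 2 e = (J.ini e).2 ∧
    M 3 e = (J.tar e).1 ∧ M 4 e = (J.tar e).2 ∧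
    M 5 e = (J.G.color e).weight

/-- The program `P` computes the transformation `F` of instances of C2C in time polynomial in the
number of vertices and edges. -/
def Program.ComputesInPolyTime (P : Program) (F : C2CInstance → C2CInstance) : Prop :=
  ∃ p : Polynomial ℕ, ∀ I : C2CInstance, ∃ (M : Memory) (t : ℕ),
    P.Run I.input M t ∧ t ≤ p.eval (I.n + I.m) ∧ (F I).IsStoredIn M

end NCL

set_option linter.unusedSectionVars false

namespace NCL

open Finset Relation

namespace ConstraintGraph

/-! ### Orientations as functions on edges -/

section Orientations

variable {V E : Type} [Fintype E] [DecidableEq V] [DecidableEq E]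

/-! The red arcs decide everything. A vertex is satisfied if a blue arc or two red arcs enter it.
Consider the connected components of the graph of blue edges, and call a component hit if two red
arcs enter one of its vertices. Three kinds of components arise from comparing the numbers of edges
and vertices.

With fewer edges than vertices (a tree), some vertex is entered by no blue arc, so the component
must be hit at all times. The reversal of a red arc does not touch the blue arcs, so one and the
same vertex has two entering red arcs before and after it (`IsBlueComp.exists_headDeg_eq_zero`).
With as many edges as vertices, exactly one blue arc enters each vertex as long as there is no hit,
and the blue arcs are frozen (`IsBlueComp.existsUnique_head`). If the two given orientations differ
there, the component must be hit at some time. With more edges than vertices there is no constraint.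

Conversely, the blue arcs of a component can be rearranged at will while it is hit, or if it has
surplus edges (`IsBlueComp.reach_of_agree`): a spanning tree is directed away from a vertex that is
satisfied anyway, and the remaining arcs can then be reversed in any order. Together this gives
`reconfigurable_iff_walk`: reconfigurability means that there is a walk of the red arcs alone that
always supports the trees and at some time hits each component that has to change.

This criterion sees only the red edges, the components of their at most `2k` end vertices, and the
kinds of these components. The kernel realizes the same data (`Slots.reconfigurable_graph_iff`). It
has `2k` slots with four vertices and four blue edges each, besides the `k` red edges. A port stands
for an end vertex of red edges and is joined to the hub of its component. A hub without further
edges gives a tree; a triangle at the hub, traversed in opposite directions by the two orientations,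
gives a component that has to be hit; a loop at the hub gives a component without constraint. Unused
vertices carry loops. The size is `8k` vertices and `9k` edges. If a component that has to be hit
contains no end of a red edge, the answer is no, and a fixed no-instance is output; if `k = 0` and
there is no such component, the empty instance is output.

The components are computed by merging labels, one blue edge after the other; the rest is a bounded
number of linear sweeps over arrays. `exec_mainProgram` combines the correctness and the running
time. -/

/-- The number of edges of colour `c` that `f` directs into `v`. -/
def headDeg (G : ConstraintGraph V E) (f : E → V × V) (c : Color) (v : V) : ℕ :=
  (univ.filter fun e => (f e).2 = v ∧ G.color e = c).card

/-- `f` replaces every edge by an arc with the same ends. -/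
def Orients (G : ConstraintGraph V E) (f : E → V × V) : Prop :=
  ∀ e, s((f e).1, (f e).2) = G.ends e

/-- The in-weight of `v` is at least two. -/
def Sat (G : ConstraintGraph V E) (f : E → V × V) (v : V) : Prop :=
  2 ≤ G.headDeg f Color.red v + 2 * G.headDeg f Color.blue v

/-- Feasibility of an orientation given as a function on the edges. -/
def Feasible (G : ConstraintGraph V E) (f : E → V × V) : Prop :=
  G.Orients f ∧ ∀ v, G.Sat f v

/-- Reversal of one arc, between feasible orientations. -/
def Step (G : ConstraintGraph V E) (f g : E → V × V) : Prop :=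
  G.Feasible f ∧ G.Feasible g ∧ ∃ e, g = Function.update f e (f e).swap

/-- Reachability by reversals of single arcs through feasible orientations. -/
def Reach (G : ConstraintGraph V E) : (E → V × V) → (E → V × V) → Prop :=
  ReflTransGen G.Step

variable {G : ConstraintGraph V E} {f g h : E → V × V}

lemma Step.symm (hs : G.Step f g) : G.Step g f := by
  obtain ⟨h1, h2, e, rfl⟩ := hs
  exact ⟨h2, h1, e, by simp⟩

lemma Reach.symm (hs : G.Reach f g) : G.Reach g f := by
  induction hs with
  | refl => exact .refl
  | tail _ hs ih => exact ReflTransGen.head hs.symm ih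

lemma Reach.trans (h₁ : G.Reach f g) (h₂ : G.Reach g h) : G.Reach f h :=
  ReflTransGen.trans h₁ h₂

lemma headDeg_mono {c : Color} {v : V}
    (H : ∀ e, G.color e = c → (f e).2 = v → (g e).2 = v) :
    G.headDeg f c v ≤ G.headDeg g c v := by
  apply card_le_card
  intro e
  simp only [mem_filter, mem_univ, true_and]
  exact fun he => ⟨H e he.2 he.1, he.2⟩

lemma Sat.mono {v : V} (hf : G.Sat f v) (H : ∀ e, (f e).2 = v → (g e).2 = v) : G.Sat g v := by
  have h1 := headDeg_mono (G := G) (f := f) (g := g) (c := Color.red) (v := v) fun e _ => H e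
  have h2 := headDeg_mono (G := G) (f := f) (g := g) (c := Color.blue) (v := v) fun e _ => H e
  unfold Sat at *
  omega

lemma headDeg_pos {c : Color} {v : V} :
    0 < G.headDeg f c v ↔ ∃ e, G.color e = c ∧ (f e).2 = v := by
  simp only [headDeg, card_pos, Finset.Nonempty, mem_filter, mem_univ, true_and]
  exact exists_congr fun e => and_comm

lemma sat_of_blue {v : V} {e : E} (he : G.color e = Color.blue) (hv : (f e).2 = v) :
    G.Sat f v := by
  have := (headDeg_pos (G := G) (f := f)).2 ⟨e, he, hv⟩
  unfold Sat
  omega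

lemma sat_iff {v : V} :
    G.Sat f v ↔ (∃ e, G.color e = Color.blue ∧ (f e).2 = v) ∨ 2 ≤ G.headDeg f Color.red v := by
  rw [← headDeg_pos]
  unfold Sat
  omega

lemma Orients.eq_or_swap (hf : G.Orients f) (hg : G.Orients g) (e : E) :
    g e = f e ∨ g e = (f e).swap := by
  have := (hf e).trans (hg e).symm
  rw [Sym2.eq_iff] at this
  rcases this with ⟨h1, h2⟩ | ⟨h1, h2⟩
  · exact Or.inl (Prod.ext h1.symm h2.symm)
  · exact Or.inr (Prod.ext h2.symm h1.symm)

lemma Orients.update_swap (hf : G.Orients f) (e : E) :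
    G.Orients (Function.update f e (f e).swap) := by
  intro e'
  by_cases he : e' = e
  · subst he
    simp only [Function.update_self, Prod.fst_swap, Prod.snd_swap]
    rw [Sym2.eq_swap]
    exact hf e'
  · simpa [Function.update_of_ne he] using hf e'

/-- If every mixture of two orientations is feasible, then each is reachable from the other. -/
lemma reach_of_mix (hf : G.Orients f) (hg : G.Orients g)
    (H : ∀ h : E → V × V, (∀ e, h e = f e ∨ h e = g e) → ∀ v, G.Sat h v) : G.Reach f g := by
  induction hn : (univ.filter fun e => f e ≠ g e).card using Nat.strong_induction_on
    generalizing f with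
  | _ n ih =>
    by_cases hfg : f = g
    · subst hfg; exact .refl
    · obtain ⟨e, he⟩ := Function.ne_iff.1 hfg
      have hswap : g e = (f e).swap := (hf.eq_or_swap hg e).resolve_left (Ne.symm he)
      have ho := hf.update_swap e
      have hmix : ∀ e', Function.update f e (f e).swap e' = f e' ∨
          Function.update f e (f e).swap e' = g e' := by
        intro e'
        by_cases hee : e' = e
        · subst hee; right; simp [hswap]
        · left; simp [hee]
      refine ReflTransGen.head (b := Function.update f e (f e).swap)
        ⟨⟨hf, H f fun _ => Or.inl rfl⟩, ⟨ho, H _ hmix⟩, e, rfl⟩ ?_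
      refine ih _ ?_ ho ?_ rfl
      · rw [← hn]
        apply card_lt_card
        refine ⟨?_, ?_⟩
        · intro e'
          simp only [mem_filter, mem_univ, true_and]
          by_cases hee : e' = e
          · subst hee; intro h; exact (h (by simp [hswap])).elim
          · simp [hee]
        · intro hsub
          have := hsub (show e ∈ _ by simpa using he)
          simp [hswap] at this
      · intro h hh
        refine H h fun e' => ?_
        rcases hh e' with h1 | h1
        · rcases hmix e' with h2 | h2
          · exact Or.inl (h1.trans h2)
          · exact Or.inr (h1.trans h2)
        · exact Or.inr h1

/-! ### Rooted trees of edges -/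

/-- `x` and `y` are joined by an edge of `T`. -/
def AdjIn (G : ConstraintGraph V E) (T : Set E) (x y : V) : Prop :=
  ∃ e ∈ T, G.ends e = s(x, y)

lemma AdjIn.symm {T : Set E} {x y : V} (h : G.AdjIn T x y) : G.AdjIn T y x := by
  obtain ⟨e, he, h⟩ := h
  exact ⟨e, he, h.trans Sym2.eq_swap⟩

lemma AdjIn.reflTransGen_symm {T : Set E} {x y : V} (h : ReflTransGen (G.AdjIn T) x y) :
    ReflTransGen (G.AdjIn T) y x := by
  induction h with
  | refl => exact .refl
  | tail _ h ih => exact .head h.symm ih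

/-- On the vertex set `D`, the edges `p v` form a tree with root `x`, where `p v` joins `v` to its
parent. -/
structure IsTree (G : ConstraintGraph V E) (T : Set E) (D : Set V) (x : V)
    (p : V → E) (par : V → V) (lvl : V → ℕ) : Prop where
  mem : ∀ v ∈ D, v ≠ x → p v ∈ T
  ends : ∀ v ∈ D, v ≠ x → G.ends (p v) = s(par v, v)
  par_mem : ∀ v ∈ D, v ≠ x → par v ∈ D
  lvl_lt : ∀ v ∈ D, v ≠ x → lvl (par v) < lvl v

/-- Breadth-first search: the level of a vertex is its distance from `x` along `T`, and its parent
is a neighbour of smaller level. The hypothesis `hDT` keeps parents in `D`. -/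
lemma exists_isTree (G : ConstraintGraph V E) [Nonempty E] (T : Set E) (D : Set V) (x : V)
    (hD : ∀ v ∈ D, ReflTransGen (G.AdjIn T) x v)
    (hDT : ∀ e ∈ T, ∀ u v, G.ends e = s(u, v) → v ∈ D → u ∈ D) :
    ∃ p par lvl, G.IsTree T D x p par lvl := by
  classical
  let R : ℕ → V → Prop := fun n => n.rec (fun v => v = x) fun _ P v => ∃ u, P u ∧ G.AdjIn T u v
  have hR : ∀ v, ReflTransGen (G.AdjIn T) x v → ∃ n, R n v := by
    intro v hv
    induction hv with
    | refl => exact ⟨0, rfl⟩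
    | tail _ h ih => obtain ⟨n, hn⟩ := ih; exact ⟨n + 1, _, hn, h⟩
  let lvl : V → ℕ := fun v => sInf {n | R n v}
  have key : ∀ v, v ∈ D → v ≠ x →
      ∃ q : E × V, q.1 ∈ T ∧ G.ends q.1 = s(q.2, v) ∧ lvl q.2 < lvl v := by
    intro v hv hvx
    have hmem : R (lvl v) v := Nat.sInf_mem (s := {n | R n v}) (hR v (hD v hv))
    obtain ⟨n, hn⟩ : ∃ n, lvl v = n + 1 := by
      refine Nat.exists_eq_succ_of_ne_zero fun h0 => hvx ?_
      rw [h0] at hmem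
      exact hmem
    rw [hn] at hmem
    obtain ⟨u, hu, e, heT, he⟩ := hmem
    exact ⟨(e, u), heT, he, by rw [hn]; exact Nat.lt_succ_of_le (Nat.sInf_le hu)⟩
  have : ∀ v, ∃ q : E × V, v ∈ D → v ≠ x → q.1 ∈ T ∧ G.ends q.1 = s(q.2, v) ∧ lvl q.2 < lvl v := by
    intro v
    by_cases h : v ∈ D ∧ v ≠ x
    · obtain ⟨q, hq⟩ := key v h.1 h.2
      exact ⟨q, fun _ _ => hq⟩
    · exact ⟨(Classical.arbitrary E, v), fun h1 h2 => (h ⟨h1, h2⟩).elim⟩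
  choose q hq using this
  exact ⟨fun v => (q v).1, fun v => (q v).2, lvl, fun v h1 h2 => (hq v h1 h2).1,
    fun v h1 h2 => (hq v h1 h2).2.1,
    fun v h1 h2 => hDT _ (hq v h1 h2).1 _ _ (hq v h1 h2).2.1 h1, fun v h1 h2 => (hq v h1 h2).2.2⟩

section

variable {T : Set E} {D : Set V} {x : V} {p : V → E} {par : V → V} {lvl : V → ℕ}

/-- Two different vertices with a common parent edge would be parents of each other, against the
levels. -/
lemma IsTree.inj (ht : G.IsTree T D x p par lvl) {v w : V} (hv : v ∈ D) (hvx : v ≠ x)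
    (hw : w ∈ D) (hwx : w ≠ x) (h : p v = p w) : v = w := by
  have h1 := ht.ends v hv hvx
  rw [h, ht.ends w hw hwx, Sym2.eq_iff] at h1
  rcases h1 with h1 | h1
  · exact h1.2.symm
  · have a := ht.lvl_lt v hv hvx
    have b := ht.lvl_lt w hw hwx
    rw [← h1.2] at a
    rw [h1.1] at b
    omega

/-- The tree can be oriented away from its root, edge by edge, if the root does not depend on the
edges of the tree. -/
lemma reach_outward (ht : G.IsTree T D x p par lvl) (hT : ∀ e ∈ T, G.color e = Color.blue)
    (hf : G.Feasible f)
    (hx : ∀ h, G.Orients h → (∀ e ∉ T, h e = f e) → G.Sat h x) :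
    ∃ f', G.Reach f f' ∧ G.Feasible f' ∧ (∀ v ∈ D, v ≠ x → (f' (p v)).2 = v) ∧
      ∀ e ∉ T, f' e = f e := by
  classical
  induction hn : (univ.filter fun e => ∃ v ∈ D, v ≠ x ∧ p v = e ∧ (f e).2 ≠ v).card
    using Nat.strong_induction_on generalizing f with
  | _ n ih =>
    by_cases hall : ∀ v ∈ D, v ≠ x → (f (p v)).2 = v
    · exact ⟨f, .refl, hf, hall, fun _ _ => rfl⟩
    push Not at hall
    -- Reverse a wrongly directed tree edge at lowest level. Only the parent loses an arc, and it is
    -- the root or, by minimality, still entered by its own tree edge.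
    obtain ⟨v, ⟨hv, hvx, hvw⟩, hmin⟩ : ∃ v, (v ∈ D ∧ v ≠ x ∧ (f (p v)).2 ≠ v) ∧
        ∀ w, (w ∈ D ∧ w ≠ x ∧ (f (p w)).2 ≠ w) → lvl v ≤ lvl w := by
      obtain ⟨v₀, hv₀⟩ := hall
      have hne : {n | ∃ v, (v ∈ D ∧ v ≠ x ∧ (f (p v)).2 ≠ v) ∧ lvl v = n}.Nonempty :=
        ⟨_, v₀, hv₀, rfl⟩
      obtain ⟨v, hv, hl⟩ := Nat.sInf_mem hne
      exact ⟨v, hv, fun w hw => hl ▸ Nat.sInf_le ⟨w, hw, rfl⟩⟩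
    have hfe : f (p v) = (v, par v) := by
      have := hf.1 (p v)
      rw [ht.ends v hv hvx, Sym2.eq_iff] at this
      rcases this with h | h
      · exact (hvw h.2).elim
      · exact Prod.ext h.1 h.2
    set f₁ := Function.update f (p v) (f (p v)).swap with hf₁
    have ho : G.Orients f₁ := hf.1.update_swap _
    have hoff : ∀ e, e ≠ p v → f₁ e = f e := fun e he => by simp [hf₁, he]
    have hat : f₁ (p v) = (par v, v) := by simp [hf₁, hfe]
    have hf₁' : G.Feasible f₁ := by
      refine ⟨ho, fun u => ?_⟩
      by_cases hu : u = par v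
      · by_cases hpx : par v = x
        · rw [hu, hpx]
          exact hx _ ho fun e he => hoff e fun h => he (h ▸ ht.mem v hv hvx)
        · have hpD := ht.par_mem v hv hvx
          have hin : (f (p (par v))).2 = par v := by
            by_contra hc
            have := hmin _ ⟨hpD, hpx, hc⟩
            have := ht.lvl_lt v hv hvx
            omega
          refine sat_of_blue (e := p (par v)) (hT _ (ht.mem _ hpD hpx)) ?_
          rw [hoff, hin, hu]
          intro h
          have := ht.inj hpD hpx hv hvx h
          have := ht.lvl_lt v hv hvx
          simp_all
      · refine (hf.2 u).mono fun e he => ?_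
        by_cases hee : e = p v
        · subst hee
          rw [hfe] at he
          exact (hu he.symm).elim
        · rwa [hoff e hee]
    obtain ⟨f', h1, h2, h3, h4⟩ := ih _ (by
      rw [← hn]
      apply card_lt_card
      refine ⟨?_, fun hsub => ?_⟩
      · intro e
        simp only [mem_filter, mem_univ, true_and]
        rintro ⟨w, hw, hwx, hpw, hne⟩
        refine ⟨w, hw, hwx, hpw, ?_⟩
        by_cases hee : e = p v
        · have : w = v := ht.inj hw hwx hv hvx (hpw.trans hee)
          subst this
          rw [hee, hat] at hne
          exact (hne rfl).elim
        · rwa [hoff e hee] at hne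
      · have := hsub (show p v ∈ _ by simpa using ⟨v, hv, hvx, rfl, hvw⟩)
        simp only [mem_filter, mem_univ, true_and] at this
        obtain ⟨w, hw, hwx, hpw, hne⟩ := this
        have : w = v := ht.inj hw hwx hv hvx hpw
        subst this
        rw [hat] at hne
        exact hne rfl) hf₁' (fun h hh hhe => hx h hh fun e he => by
          rw [hhe e he, hoff e]
          exact fun h => he (h ▸ ht.mem v hv hvx)) rfl
    refine ⟨f', ReflTransGen.head ⟨hf, hf₁', _, rfl⟩ h1, h2, h3, fun e he => ?_⟩
    rw [h4 e he, hoff e]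
    exact fun h => he (h ▸ ht.mem v hv hvx)

/-- Two feasible orientations that agree outside a set `K` of edges on the vertex set of a tree in
`K` are reachable from each other, if the root of the tree does not depend on `K`. -/
lemma reach_of_isTree {K : Set E} (ht : G.IsTree T D x p par lvl)
    (hT : ∀ e ∈ T, G.color e = Color.blue) (hTK : T ⊆ K)
    (hK : ∀ e ∈ K, ∀ v ∈ G.ends e, v ∈ D) (hf : G.Feasible f) (hg : G.Feasible g)
    (hfg : ∀ e ∉ K, g e = f e)
    (hx : ∀ h, G.Orients h → (∀ e ∉ K, h e = f e) → G.Sat h x) : G.Reach f g := by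
  -- Direct the tree outward in both orientations. Each vertex of `D` other than the root is then
  -- entered by the same tree edge in both, so all mixtures of the two are feasible; vertices
  -- outside `D` meet no edge of `K`.
  obtain ⟨f', hf1, hf2, hf3, hf4⟩ := reach_outward ht hT hf
    fun h hh hhe => hx h hh fun e he => hhe e fun h => he (hTK h)
  obtain ⟨g', hg1, hg2, hg3, hg4⟩ := reach_outward ht hT hg
    fun h hh hhe => hx h hh fun e he => (hhe e fun h => he (hTK h)).trans (hfg e he)
  refine hf1.trans (Reach.trans ?_ hg1.symm)
  have hf5 : ∀ e ∉ K, f' e = f e := fun e he => hf4 e fun h => he (hTK h)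
  have hg5 : ∀ e ∉ K, g' e = f e := fun e he => (hg4 e fun h => he (hTK h)).trans (hfg e he)
  refine reach_of_mix hf2.1 hg2.1 fun h hmix v => ?_
  have hho : G.Orients h := fun e => by
    rcases hmix e with h1 | h1 <;> rw [h1]
    exacts [hf2.1 e, hg2.1 e]
  have hoff : ∀ e ∉ K, h e = f e := fun e he => by
    rcases hmix e with h1 | h1 <;> rw [h1]
    exacts [hf5 e he, hg5 e he]
  by_cases hv : v ∈ D
  · by_cases hvx : v = x
    · subst hvx; exact hx h hho hoff
    · refine sat_of_blue (e := p v) (hT _ (ht.mem v hv hvx)) ?_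
      rcases hmix (p v) with h1 | h1 <;> rw [h1]
      exacts [hf3 v hv hvx, hg3 v hv hvx]
  · refine (hf.2 v).mono fun e he => ?_
    rwa [hoff e]
    refine fun heK => hv (hK e heK v ?_)
    rw [← hf.1 e, ← he]
    exact Sym2.mem_mk_right _ _

end

end Orientations

end ConstraintGraph

namespace ConstraintGraph

/-! ### Blue components -/

section Components

variable {V E κ : Type} [Fintype V] [Fintype E] [DecidableEq V] [DecidableEq E] [DecidableEq κ]

/-- The vertex labels `comp` distinguish the connected components of the graph of blue edges, and
`lab` is the corresponding labelling of the blue edges. -/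
structure IsBlueComp (G : ConstraintGraph V E) (comp : V → κ) (lab : E → κ) : Prop where
  mem : ∀ e, G.color e = Color.blue → ∀ v ∈ G.ends e, comp v = lab e
  conn : ∀ u v, comp u = comp v → ReflTransGen (G.AdjIn {e | G.color e = Color.blue}) u v

/-- The number of vertices of a component. -/
def vCount (comp : V → κ) (c : κ) : ℕ := (univ.filter fun v => comp v = c).card

/-- The number of blue edges of a component. -/
def eCount (G : ConstraintGraph V E) (lab : E → κ) (c : κ) : ℕ :=
  (univ.filter fun e => G.color e = Color.blue ∧ lab e = c).card

/-- The set of blue edges of a component. -/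
def blueIn (G : ConstraintGraph V E) (lab : E → κ) (c : κ) : Set E :=
  {e | G.color e = Color.blue ∧ lab e = c}

variable {G : ConstraintGraph V E} {comp : V → κ} {lab : E → κ} {f g h : E → V × V} {c : κ}

lemma IsBlueComp.head (hB : G.IsBlueComp comp lab) (hf : G.Orients f) {e : E}
    (he : G.color e = Color.blue) : comp (f e).2 = lab e :=
  hB.mem e he _ (hf e ▸ Sym2.mem_mk_right _ _)

/-- Every blue arc of the component has exactly one head, and this head lies in the component. -/
lemma IsBlueComp.sum_headDeg (hB : G.IsBlueComp comp lab) (hf : G.Orients f) (c : κ) :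
    ∑ v ∈ univ.filter (fun v => comp v = c), G.headDeg f Color.blue v = G.eCount lab c := by
  rw [eCount, card_eq_sum_card_fiberwise (f := fun e => (f e).2)
    (t := univ.filter fun v => comp v = c)]
  · refine sum_congr rfl fun v hv => ?_
    rw [headDeg]
    congr 1
    ext e
    simp only [mem_filter, mem_univ, true_and] at hv ⊢
    refine ⟨fun h => ⟨⟨h.2, ?_⟩, h.1⟩, fun h => ⟨h.2, h.1.1⟩⟩
    rw [← hB.head hf h.2, h.1, hv]
  · intro e he
    simp only [coe_filter, mem_univ, true_and, Set.mem_ofPred_eq] at he ⊢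
    rw [hB.head hf he.1, he.2]

/-- A component with fewer edges than vertices has a vertex without entering blue arc. -/
lemma IsBlueComp.exists_headDeg_eq_zero (hB : G.IsBlueComp comp lab) (hf : G.Orients f)
    (hc : G.eCount lab c < vCount comp c) : ∃ v, comp v = c ∧ G.headDeg f Color.blue v = 0 := by
  by_contra! hcon
  have := hB.sum_headDeg hf c
  have h2 : (univ.filter fun v => comp v = c).card • 1 ≤
      ∑ v ∈ univ.filter (fun v => comp v = c), G.headDeg f Color.blue v :=
    card_nsmul_le_sum _ _ _ fun v hv => Nat.one_le_iff_ne_zero.2 (hcon v (by simpa using hv))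
  rw [this, smul_eq_mul, mul_one] at h2
  exact absurd hc (not_lt.2 h2)

/-- In a component with as many edges as vertices, every vertex is entered by exactly one blue arc
if it is entered by at least one. -/
lemma IsBlueComp.headDeg_eq_one (hB : G.IsBlueComp comp lab) (hf : G.Orients f)
    (hc : G.eCount lab c = vCount comp c)
    (hpos : ∀ v, comp v = c → 0 < G.headDeg f Color.blue v) {v : V} (hv : comp v = c) :
    G.headDeg f Color.blue v = 1 := by
  have h1 := hB.sum_headDeg hf c
  have h2 : ∑ v ∈ univ.filter (fun v => comp v = c), 1 = vCount comp c := by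
    simp [vCount]
  have h3 := (sum_eq_sum_iff_of_le (s := univ.filter fun v => comp v = c) (f := fun _ => 1)
    (g := G.headDeg f Color.blue) fun v hv => hpos v (by simpa using hv)).1
    (by rw [h1, h2, hc])
  exact (h3 v (by simpa using hv)).symm

/-- A path of blue edges cannot leave its component, so all its edges carry the same label. -/
lemma IsBlueComp.conn_blueIn (hB : G.IsBlueComp comp lab) {u v : V} (h : comp u = comp v) :
    ReflTransGen (G.AdjIn (G.blueIn lab (comp u))) u v := by
  have key : ∀ w, ReflTransGen (G.AdjIn {e | G.color e = Color.blue}) u w →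
      comp w = comp u ∧ ReflTransGen (G.AdjIn (G.blueIn lab (comp u))) u w := by
    intro w hw
    induction hw with
    | refl => exact ⟨rfl, .refl⟩
    | @tail x y _ hxy ih =>
      obtain ⟨e, he, hends⟩ := hxy
      have h1 := hB.mem e he x (hends ▸ Sym2.mem_mk_left _ _)
      have h2 := hB.mem e he y (hends ▸ Sym2.mem_mk_right _ _)
      exact ⟨h2.trans (h1.symm.trans ih.1), ih.2.tail ⟨e, ⟨he, h1.symm.trans ih.1⟩, hends⟩⟩
  exact (key v (hB.conn u v h)).2

lemma IsBlueComp.exists_isTree [Nonempty E] (hB : G.IsBlueComp comp lab) {T : Set E}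
    (hT : T ⊆ G.blueIn lab c) (x : V)
    (hconn : ∀ v, comp v = c → ReflTransGen (G.AdjIn T) x v) :
    ∃ p par lvl, G.IsTree T {v | comp v = c} x p par lvl := by
  refine ConstraintGraph.exists_isTree G T _ x (fun v hv => hconn v hv) ?_
  intro e he u v hends hv
  have h1 := hB.mem e (hT he).1 u (hends ▸ Sym2.mem_mk_left _ _)
  rw [(hT he).2] at h1
  exact h1

/-- The parent edges of a rooted tree connect the component. The strict inequality comes from the
root, which has no parent edge. -/
lemma IsBlueComp.exists_spanning [Nonempty E] (hB : G.IsBlueComp comp lab) (r : V)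
    (hr : comp r = c) : ∃ T : Finset E, (T : Set E) ⊆ G.blueIn lab c ∧ T.card < vCount comp c ∧
      ∀ x v, comp x = c → comp v = c → ReflTransGen (G.AdjIn (T : Set E)) x v := by
  obtain ⟨p, par, lvl, ht⟩ := hB.exists_isTree (T := G.blueIn lab c) subset_rfl r
    (fun v hv => hr ▸ hB.conn_blueIn (hr.trans hv.symm))
  let T : Finset E := (univ.filter fun v => comp v = c ∧ v ≠ r).image p
  have hroot : ∀ n v, lvl v = n → comp v = c → ReflTransGen (G.AdjIn (T : Set E)) r v := by
    intro n
    induction n using Nat.strong_induction_on with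
    | _ n ih =>
      intro v hn hv
      by_cases hvr : v = r
      · subst hvr; exact .refl
      · refine (ih _ (hn ▸ ht.lvl_lt v hv hvr) _ rfl (ht.par_mem v hv hvr)).tail
          ⟨p v, ?_, ht.ends v hv hvr⟩
        simp only [T, coe_image, Set.mem_image, coe_filter, mem_univ, true_and, Set.mem_ofPred_eq]
        exact ⟨v, ⟨hv, hvr⟩, rfl⟩
  refine ⟨T, ?_, ?_, fun x v hx hv => (AdjIn.reflTransGen_symm (hroot _ x rfl hx)).trans (hroot _ v rfl hv)⟩
  · intro e he
    simp only [T, coe_image, Set.mem_image, coe_filter, mem_univ, true_and,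
      Set.mem_ofPred_eq] at he
    obtain ⟨v, hv, rfl⟩ := he
    exact ht.mem v hv.1 hv.2
  · refine card_image_le.trans_lt (card_lt_card ⟨fun v => ?_, fun hsub => ?_⟩)
    · simp only [mem_filter, mem_univ, true_and]
      exact fun h => h.1
    · have := hsub (show r ∈ _ by simpa using hr)
      simp at this

/-- A component can be oriented such that all vertices but a prescribed one are entered, with
changes in a set of connecting edges only. -/
lemma IsBlueComp.exists_orients_of_conn [Nonempty E] (hB : G.IsBlueComp comp lab) {T : Set E}
    (hT : T ⊆ G.blueIn lab c) (x : V)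
    (hconn : ∀ v, comp v = c → ReflTransGen (G.AdjIn T) x v) (hf : G.Orients f) :
    ∃ h, G.Orients h ∧ (∀ e ∉ T, h e = f e) ∧
      ∀ v, comp v = c → v ≠ x → ∃ e ∈ T, (h e).2 = v := by
  classical
  obtain ⟨p, par, lvl, ht⟩ := hB.exists_isTree hT x hconn
  -- A tree edge points to the vertex whose parent edge it is; by `IsTree.inj` there is only one
  -- such vertex.
  let h : E → V × V := fun e =>
    if H : ∃ v, comp v = c ∧ v ≠ x ∧ p v = e then (par H.choose, H.choose) else f e
  refine ⟨h, fun e => ?_, fun e he => ?_, fun v hv hvx => ⟨p v, ht.mem v hv hvx, ?_⟩⟩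
  · by_cases H : ∃ v, comp v = c ∧ v ≠ x ∧ p v = e
    · have hs := H.choose_spec
      simp only [h, dif_pos H]
      rw [← ht.ends _ hs.1 hs.2.1, hs.2.2]
    · simp only [h, dif_neg H]
      exact hf e
  · have H : ¬∃ v, comp v = c ∧ v ≠ x ∧ p v = e := by
      rintro ⟨v, hv, hvx, rfl⟩
      exact he (ht.mem v hv hvx)
    simp only [h, dif_neg H]
  · have H : ∃ w, comp w = c ∧ w ≠ x ∧ p w = p v := ⟨v, hv, hvx, rfl⟩
    have hs := H.choose_spec
    simp only [h, dif_pos H]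
    exact ht.inj hs.1 hs.2.1 hv hvx hs.2.2

lemma IsBlueComp.exists_orients_root [Nonempty E] (hB : G.IsBlueComp comp lab) (x : V)
    (hx : comp x = c) (hf : G.Orients f) :
    ∃ h, G.Orients h ∧ (∀ e ∉ G.blueIn lab c, h e = f e) ∧
      ∀ v, comp v = c → v ≠ x → ∃ e, G.color e = Color.blue ∧ (h e).2 = v := by
  obtain ⟨h, h1, h2, h3⟩ := hB.exists_orients_of_conn subset_rfl x
    (fun v hv => hx ▸ hB.conn_blueIn (hx.trans hv.symm)) hf
  refine ⟨h, h1, h2, fun v hv hvx => ?_⟩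
  obtain ⟨e, he, hev⟩ := h3 v hv hvx
  exact ⟨e, he.1, hev⟩

lemma exists_mem_blueIn_notMem {T : Finset E} (hT : T.card < G.eCount lab c) :
    ∃ b ∈ G.blueIn lab c, b ∉ T := by
  by_contra! hcon
  refine absurd (card_le_card (t := T) fun e he => ?_) (not_le.2 hT)
  exact hcon e (by simpa [blueIn] using he)

/-- A component with at least as many edges as vertices can be oriented such that all its vertices
are entered. -/
lemma IsBlueComp.exists_orients_all (hB : G.IsBlueComp comp lab)
    (hc : vCount comp c ≤ G.eCount lab c) (hf : G.Orients f) :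
    ∃ h, G.Orients h ∧ (∀ e ∉ G.blueIn lab c, h e = f e) ∧
      ∀ v, comp v = c → ∃ e, G.color e = Color.blue ∧ (h e).2 = v := by
  by_cases hne : ∃ r, comp r = c
  · obtain ⟨r, hr⟩ := hne
    have : Nonempty E := by
      have hpos : 0 < vCount comp c := card_pos.2 ⟨r, by simpa using hr⟩
      obtain ⟨e, -⟩ := card_pos.1 (hpos.trans_le hc)
      exact ⟨e⟩
    obtain ⟨T, hTc, hcard, hconn⟩ := hB.exists_spanning r hr
    -- The spanning tree spares an edge `b`. Its arc stays as it is, and the tree is directed away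
    -- from its head.
    obtain ⟨b, hb, hbT⟩ := exists_mem_blueIn_notMem (hcard.trans_le hc)
    have hbc : comp (f b).2 = c := (hB.head hf hb.1).trans hb.2
    obtain ⟨h, h1, h2, h3⟩ := hB.exists_orients_of_conn hTc (f b).2 (fun v hv => hconn _ v hbc hv) hf
    refine ⟨h, h1, fun e he => h2 e fun h => he (hTc h), fun v hv => ?_⟩
    by_cases hvb : v = (f b).2
    · exact ⟨b, hb.1, by rw [h2 b hbT, hvb]⟩
    · obtain ⟨e, he, hev⟩ := h3 v hv hvb
      exact ⟨e, (hTc he).1, hev⟩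
  · exact ⟨f, hf, fun _ _ => rfl, fun v hv => (hne ⟨v, hv⟩).elim⟩

lemma IsBlueComp.feasible_of_agree (hB : G.IsBlueComp comp lab) (hf : G.Feasible f)
    (hh : G.Orients h) (hoff : ∀ e ∉ G.blueIn lab c, h e = f e)
    (hin : ∀ v, comp v = c → ∃ e, G.color e = Color.blue ∧ (h e).2 = v) : G.Feasible h := by
  refine ⟨hh, fun v => ?_⟩
  by_cases hv : comp v = c
  · obtain ⟨e, he, hev⟩ := hin v hv
    exact sat_of_blue he hev
  · refine (hf.2 v).mono fun e he => ?_
    rwa [hoff e]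
    rintro ⟨h1, h2⟩
    exact hv (by rw [← he, hB.head hf.1 h1, h2])

lemma headDeg_red_congr {v : V} (H : ∀ e, G.color e = Color.red → g e = f e) :
    G.headDeg g Color.red v = G.headDeg f Color.red v := by
  apply le_antisymm <;> refine headDeg_mono fun e he hv => ?_
  · rwa [← H e he]
  · rwa [H e he]

/-- The blue arcs of a component can be rearranged at will, if some vertex of the component is
saturated by red arcs or if the component has more edges than vertices. -/
lemma IsBlueComp.reach_of_agree (hB : G.IsBlueComp comp lab) (hf : G.Feasible f)
    (hg : G.Feasible g) (hfg : ∀ e ∉ G.blueIn lab c, g e = f e)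
    (hc : (∃ x, comp x = c ∧ 2 ≤ G.headDeg f Color.red x) ∨ vCount comp c < G.eCount lab c) :
    G.Reach f g := by
  have hKmem : ∀ e ∈ G.blueIn lab c, ∀ v ∈ G.ends e, v ∈ {v | comp v = c} :=
    fun e he v hv => (hB.mem e he.1 v hv).trans he.2
  by_cases hE : Nonempty E
  swap
  · have : f = g := funext fun e => (hE ⟨e⟩).elim
    subst this; exact .refl
  rcases hc with ⟨x, hx, hrel⟩ | hc
  -- A vertex entered by two red arcs can be the root, since it does not depend on the blue arcs.
  · obtain ⟨p, par, lvl, ht⟩ := hB.exists_isTree (T := G.blueIn lab c) subset_rfl x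
      (fun v hv => hx ▸ hB.conn_blueIn (hx.trans hv.symm))
    refine reach_of_isTree ht (fun e he => he.1) subset_rfl hKmem hf hg hfg fun h _ hh => ?_
    refine sat_iff.2 (Or.inr ?_)
    rw [headDeg_red_congr fun e he => hh e (by simp [blueIn, he])]
    exact hrel
  · obtain ⟨e₀, he₀⟩ : ∃ e, e ∈ G.blueIn lab c := by
      obtain ⟨e, he⟩ := card_pos.1 ((Nat.zero_le _).trans_lt hc)
      exact ⟨e, by simpa [blueIn] using he⟩
    obtain ⟨T, hTc, hcard, hconn⟩ := hB.exists_spanning (f e₀).2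
      ((hB.head hf.1 he₀.1).trans he₀.2)
    -- The spanning tree has fewer edges than the component has vertices, so two edges `a` and `b`
    -- remain outside it. While one of them is fixed, its head can serve as the root.
    obtain ⟨a, ha, haT⟩ := exists_mem_blueIn_notMem (G := G) (lab := lab) (hcard.trans hc)
    obtain ⟨b, hb, hbT⟩ := exists_mem_blueIn_notMem (G := G) (lab := lab) (T := insert a T)
      (((card_insert_le _ _).trans hcard).trans_lt hc)
    rw [mem_insert, not_or] at hbT
    have hbc : comp (f b).2 = c := (hB.head hf.1 hb.1).trans hb.2
    -- As long as `a` keeps its direction, all other blue arcs of the component can be rearranged.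
    have hfixed : ∀ {f g : E → V × V}, G.Feasible f → G.Feasible g →
        (∀ e ∉ G.blueIn lab c, g e = f e) → g a = f a → G.Reach f g := by
      intro f g hf hg hfg hag
      have hac : comp (f a).2 = c := (hB.head hf.1 ha.1).trans ha.2
      obtain ⟨p, par, lvl, ht⟩ := hB.exists_isTree hTc (f a).2 (fun v hv => hconn _ v hac hv)
      refine reach_of_isTree (K := G.blueIn lab c \ {a}) ht (fun e he => (hTc he).1)
        (fun e he => ⟨hTc he, fun h => haT (by rw [← Set.mem_singleton_iff.1 h]; exact he)⟩)
        (fun e he => hKmem e he.1) hf hg (fun e he => ?_) fun h _ hh => ?_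
      · by_cases hea : e = a
        · rw [hea, hag]
        · exact hfg e fun h => he ⟨h, hea⟩
      · refine sat_of_blue (e := a) ha.1 ?_
        rw [hh a (by simp)]
    -- To reverse `a`, pass to an orientation in which `b` and the tree directed away from the head
    -- of `b` already enter all vertices; there `a` is superfluous.
    obtain ⟨h, h1, h2, h3⟩ := hB.exists_orients_of_conn hTc (f b).2 (fun v hv => hconn _ v hbc hv)
      hf.1
    have hoff : ∀ e ∉ G.blueIn lab c, h e = f e := fun e he => h2 e fun h => he (hTc h)
    have hhb : h b = f b := h2 b hbT.2
    have hfh : G.Feasible h := by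
      refine hB.feasible_of_agree hf h1 hoff fun v hv => ?_
      by_cases hvb : v = (f b).2
      · exact ⟨b, hb.1, by rw [hhb, hvb]⟩
      · obtain ⟨e, he, hev⟩ := h3 v hv hvb
        exact ⟨e, (hTc he).1, hev⟩
    have hoff' : ∀ e ∉ G.blueIn lab c, Function.update h a (h a).swap e = h e := fun e he => by
      rw [Function.update_of_ne]
      rintro rfl
      exact he ha
    have hhh : h a = f a := h2 a haT
    have hfh' : G.Feasible (Function.update h a (h a).swap) := by
      refine hB.feasible_of_agree hfh (h1.update_swap a) hoff' fun v hv => ?_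
      by_cases hvb : v = (f b).2
      · exact ⟨b, hb.1, by rw [Function.update_of_ne hbT.1, hhb, hvb]⟩
      · obtain ⟨e, he, hev⟩ := h3 v hv hvb
        refine ⟨e, (hTc he).1, ?_⟩
        rwa [Function.update_of_ne]
        rintro rfl
        exact haT he
    rcases hf.1.eq_or_swap hg.1 a with hga | hga
    · exact hfixed hf hg hfg hga
    · refine (hfixed hf hfh hoff hhh).trans (ReflTransGen.head ⟨hfh, hfh', a, rfl⟩ ?_)
      refine hfixed hfh' hg (fun e he => ?_) ?_
      · rw [hoff' e he, hoff e he, hfg e he]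
      · rw [Function.update_self, hhh, hga]

/-- Simultaneous rearrangement of the blue arcs of all components. -/
lemma IsBlueComp.reach_of_forall (hB : G.IsBlueComp comp lab) (hf : G.Feasible f)
    (hg : G.Feasible g) (hred : ∀ e, G.color e = Color.red → g e = f e)
    (hc : ∀ c, (∀ e ∈ G.blueIn lab c, g e = f e) ∨
      (∃ x, comp x = c ∧ 2 ≤ G.headDeg f Color.red x) ∨ vCount comp c < G.eCount lab c) :
    G.Reach f g := by
  -- The components in `W` have been switched to `g`. Each vertex meets the blue edges of one
  -- component only, so every such mixture is feasible and the components can be switched one by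
  -- one.
  let m : Finset κ → E → V × V := fun W e =>
    if G.color e = Color.blue ∧ lab e ∈ W then g e else f e
  have hmo : ∀ W, G.Orients (m W) := fun W e => by
    by_cases he : G.color e = Color.blue ∧ lab e ∈ W
    · simp only [m, if_pos he]; exact hg.1 e
    · simp only [m, if_neg he]; exact hf.1 e
  have hmr : ∀ W e, G.color e = Color.red → m W e = f e := fun W e he => by simp [m, he]
  have hm : ∀ W, G.Feasible (m W) := by
    refine fun W => ⟨hmo W, fun v => ?_⟩
    by_cases hv : comp v ∈ W
    · refine (hg.2 v).mono fun e he => ?_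
      cases hcol : G.color e with
      | red => rw [hmr W e hcol, ← hred e hcol, he]
      | blue =>
        have : lab e ∈ W := by rwa [← hB.head hg.1 hcol, he]
        simpa [m, hcol, this] using he
    · refine (hf.2 v).mono fun e he => ?_
      cases hcol : G.color e with
      | red => rw [hmr W e hcol, he]
      | blue =>
        have : lab e ∉ W := by rwa [← hB.head hf.1 hcol, he]
        simpa [m, hcol, this] using he
  have key : ∀ W, G.Reach f (m W) := by
    intro W
    induction W using Finset.induction_on with
    | empty =>
      have : m ∅ = f := by ext1 e; simp [m]
      rw [this]; exact .refl
    | insert c W hcW ih =>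
      refine ih.trans ?_
      have hagree : ∀ e ∉ G.blueIn lab c, m (insert c W) e = m W e := by
        intro e he
        have : ¬(G.color e = Color.blue ∧ lab e = c) := he
        simp only [m, mem_insert]
        by_cases hb : G.color e = Color.blue
        · have : lab e ≠ c := fun h => this ⟨hb, h⟩
          simp [hb, this]
        · simp [hb]
      rcases hc c with h1 | h1
      · have : m (insert c W) = m W := by
          ext1 e
          by_cases he : e ∈ G.blueIn lab c
          · simp only [m]
            rw [h1 e he]; simp
          · exact hagree e he
        rw [this]; exact .refl
      · refine hB.reach_of_agree (c := c) (hm _) (hm _) hagree (h1.imp_left ?_)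
        rintro ⟨x, hx, hrel⟩
        exact ⟨x, hx, by rwa [headDeg_red_congr (hmr W)]⟩
  have : m (univ.image lab) = g := by
    ext1 e
    cases hcol : G.color e with
    | red => rw [hmr _ e hcol, hred e hcol]
    | blue => simp [m, hcol]
  exact this ▸ key _

end Components

end ConstraintGraph

namespace ConstraintGraph

/-! ### Orientations as multisets of arcs -/

section Multisets

variable {V E : Type} [Fintype E] [DecidableEq V] [DecidableEq E]
variable {G : ConstraintGraph V E} {f g h : E → V × V}

lemma count_arcs (f : E → V × V) (a : V × V) (c : Color) :
    (G.arcs f).count (a, c) = (univ.filter fun e => f e = a ∧ G.color e = c).card := by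
  rw [arcs, Multiset.count_map, card_def, filter_val]
  congr 1
  refine Multiset.filter_congr fun e _ => ?_
  rw [Prod.mk.injEq, eq_comm, @eq_comm _ c]

lemma inDegree_arcs (f : E → V × V) (c : Color) (v : V) :
    inDegree (G.arcs f) c v = G.headDeg f c v := by
  rw [inDegree, arcs, Multiset.countP_map, headDeg, card_def, filter_val]

lemma isFeasible_arcs_iff (hf : G.Orients f) : G.IsFeasible (G.arcs f) ↔ G.Feasible f := by
  simp only [IsFeasible, Feasible, Sat, inDegree_arcs]
  exact ⟨fun h => ⟨hf, h.2⟩, fun h => ⟨⟨f, hf, rfl⟩, h.2⟩⟩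

/-- The exchanged arc comes from some edge, and reversing that edge gives `B`. If several edges
carry the same arc, any of them will do. -/
lemma Adjacent.exists_update {B : Multiset (Arc V)} (hAB : Adjacent (G.arcs f) B) :
    ∃ g, B = G.arcs g ∧ (g = f ∨ ∃ e, g = Function.update f e (f e).swap) := by
  rcases hAB with rfl | ⟨x, y, c, R, hA, hB⟩
  · exact ⟨f, rfl, Or.inl rfl⟩
  · have hmem : ((x, y), c) ∈ G.arcs f := hA ▸ Multiset.mem_cons_self _ _
    obtain ⟨e, -, he⟩ := Multiset.mem_map.1 hmem
    have h1 : ∀ g : E → V × V, G.arcs g =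
        (g e, G.color e) ::ₘ ((univ.erase e).val.map fun e => (g e, G.color e)) := by
      intro g
      rw [arcs, ← insert_erase (mem_univ e), insert_val_of_notMem (notMem_erase _ _),
        Multiset.map_cons]
      simp
    refine ⟨_, ?_, Or.inr ⟨e, rfl⟩⟩
    rw [h1 f, he, Multiset.cons_inj_right] at hA
    rw [hB, h1]
    obtain ⟨h2, h3⟩ := Prod.mk.injEq _ _ _ _ ▸ he
    rw [Function.update_self, h2, h3, ← hA]
    congr 1
    refine Multiset.map_congr rfl fun e' he' => ?_
    rw [Function.update_of_ne]
    rintro rfl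
    exact notMem_erase _ _ he'

lemma adjacent_update (f : E → V × V) (e : E) :
    Adjacent (G.arcs f) (G.arcs (Function.update f e (f e).swap)) := by
  have h1 : ∀ g : E → V × V, G.arcs g =
      (g e, G.color e) ::ₘ ((univ.erase e).val.map fun e => (g e, G.color e)) := by
    intro g
    rw [arcs, ← insert_erase (mem_univ e), insert_val_of_notMem (notMem_erase _ _),
      Multiset.map_cons]
    simp
  refine Or.inr ⟨(f e).1, (f e).2, G.color e, _, h1 f, ?_⟩
  rw [h1, Function.update_self]
  refine congrArg₂ _ rfl (Multiset.map_congr rfl fun e' he' => ?_)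
  rw [Function.update_of_ne]
  rintro rfl
  exact notMem_erase _ _ he'

lemma reconfigurable_iff_reflTransGen {A B : Multiset (Arc V)} :
    G.Reconfigurable A B ↔ G.IsFeasible A ∧
      ReflTransGen (fun A B => Adjacent A B ∧ G.IsFeasible B) A B := by
  constructor
  · rintro ⟨l, S, rfl, rfl, hS, hadj⟩
    refine ⟨hS 0 (Nat.zero_le _), ?_⟩
    have : ∀ i ≤ l, ReflTransGen (fun A B => Adjacent A B ∧ G.IsFeasible B) (S 0) (S i) := by
      intro i
      induction i with
      | zero => exact fun _ => .refl
      | succ i ih => exact fun hi => (ih (by omega)).tail ⟨hadj i (by omega), hS _ hi⟩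
    exact this l le_rfl
  · rintro ⟨hA, hAB⟩
    induction hAB with
    | refl => exact ⟨0, fun _ => A, rfl, rfl, fun _ _ => hA, fun i hi => (by omega)⟩
    | @tail B C _ hBC ih =>
      obtain ⟨l, S, h0, hl, hS, hadj⟩ := ih
      refine ⟨l + 1, fun i => if i ≤ l then S i else C, by simpa using h0, by simp, ?_, ?_⟩
      · intro i hi
        by_cases hil : i ≤ l
        · simpa [hil] using hS i hil
        · simpa [hil] using hBC.2
      · intro i hi
        by_cases hil : i + 1 ≤ l
        · have : i ≤ l := by omega
          simpa [hil, this] using hadj i (by omega)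
        · have : i = l := by omega
          subst this
          simpa [hl] using hBC.1

/-- A multiset forgets which of several parallel edges carries which arc, so the final function is
determined only up to having the arcs `B`. -/
lemma reconfigurable_arcs_iff (hf : G.Feasible f) {B : Multiset (Arc V)} :
    G.Reconfigurable (G.arcs f) B ↔ ∃ g, G.Reach f g ∧ G.Feasible g ∧ G.arcs g = B := by
  rw [reconfigurable_iff_reflTransGen]
  constructor
  · rintro ⟨-, h⟩
    induction h with
    | refl => exact ⟨f, .refl, hf, rfl⟩
    | tail _ hBC ih =>
      obtain ⟨g, h1, h2, rfl⟩ := ih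
      obtain ⟨g', rfl, rfl | ⟨e, rfl⟩⟩ := Adjacent.exists_update hBC.1
      · exact ⟨g', h1, h2, rfl⟩
      · have := (isFeasible_arcs_iff (h2.1.update_swap e)).1 hBC.2
        exact ⟨_, h1.tail ⟨h2, this, e, rfl⟩, this, rfl⟩
  · rintro ⟨g, h1, -, rfl⟩
    refine ⟨(isFeasible_arcs_iff hf.1).2 hf, ?_⟩
    induction h1 with
    | refl => exact .refl
    | tail _ h ih =>
      obtain ⟨-, h2, e, rfl⟩ := h
      exact ih.tail ⟨adjacent_update _ _, (isFeasible_arcs_iff h2.1).2 h2⟩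

end Multisets

/-! ### Reconfiguration of the red arcs -/

section Walks

variable {V E X κ : Type} [Fintype V] [Fintype E] [Fintype X] [DecidableEq V] [DecidableEq E]
  [DecidableEq X] [DecidableEq κ]

/-- `ι` enumerates the red edges. -/
structure IsRedEnum (G : ConstraintGraph V E) (ι : X → E) : Prop where
  inj : Function.Injective ι
  iff : ∀ e, G.color e = Color.red ↔ ∃ x, ι x = e

/-- At least two of the red arcs enter `v`. -/
def Rel (S : X → V × V) (v : V) : Prop := 2 ≤ (univ.filter fun x => (S x).2 = v).card

instance (S : X → V × V) (v : V) : Decidable (Rel S v) := inferInstanceAs (Decidable (_ ≤ _))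

/-- Some vertex of the component `c` is entered by two red arcs. -/
def Hit (comp : V → κ) (S : X → V × V) (c : κ) : Prop := ∃ v, comp v = c ∧ Rel S v

/-- `Walk comp tree S₀ S H`: the orientation `S` of the red edges is reached from `S₀` by reversals
of single arcs, such that in each step, each of the components in `tree` has a vertex that is
entered by two red arcs before and after that step; `H` is the set of components hit so far. -/
inductive Walk (comp : V → κ) (tree : κ → Prop) (S₀ : X → V × V) :
    (X → V × V) → (κ → Prop) → Prop
  | start : Walk comp tree S₀ S₀ (Hit comp S₀)
  | step {S S' : X → V × V} {H : κ → Prop} : Walk comp tree S₀ S H →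
      (S' = S ∨ ∃ x, S' = Function.update S x (S x).swap) →
      (∀ c, tree c → ∃ v, comp v = c ∧ Rel S v ∧ Rel S' v) →
      Walk comp tree S₀ S' fun c => H c ∨ Hit comp S' c

lemma Walk.start_subset {comp : V → κ} {tree : κ → Prop} {S₀ S : X → V × V} {H : κ → Prop}
    (hw : Walk comp tree S₀ S H) {c : κ} (hc : Hit comp S₀ c) : H c := by
  induction hw with
  | start => exact hc
  | step _ _ _ ih => exact Or.inl ih

lemma Walk.end_subset {comp : V → κ} {tree : κ → Prop} {S₀ S : X → V × V} {H : κ → Prop}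
    (hw : Walk comp tree S₀ S H) {c : κ} (hc : Hit comp S c) : H c := by
  cases hw with
  | start => exact hc
  | step => exact Or.inr hc

lemma rel_congr {S S' : X → V × V} (h : univ.val.map S' = univ.val.map S) (v : V) :
    Rel S' v ↔ Rel S v := by
  have key : ∀ S : X → V × V, (univ.filter fun x => (S x).2 = v).card =
      (univ.val.map S).countP fun a => a.2 = v := by
    intro S
    rw [Multiset.countP_map, card_def, filter_val]
  rw [Rel, Rel, key, key, h]

lemma hit_congr {comp : V → κ} {S S' : X → V × V} (h : univ.val.map S' = univ.val.map S) (c : κ) :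
    Hit comp S' c ↔ Hit comp S c :=
  exists_congr fun v => and_congr_right fun _ => rel_congr h v

/-- In a component with label `c`, arcs of the same head have the same tail in both
orientations. -/
def SamePred (G : ConstraintGraph V E) (comp : V → κ) (f g : E → V × V) (c : κ) : Prop :=
  ∀ e e', G.color e = Color.blue → G.color e' = Color.blue → comp (f e).2 = c →
    (f e).2 = (g e').2 → (f e).1 = (g e').1

variable {G : ConstraintGraph V E} {ι : X → E} {comp : V → κ} {lab : E → κ} {f g h : E → V × V}
  {c : κ}

lemma IsRedEnum.headDeg_eq (hι : G.IsRedEnum ι) (f : E → V × V) (v : V) :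
    G.headDeg f Color.red v = (univ.filter fun x => (f (ι x)).2 = v).card := by
  rw [headDeg, ← card_image_of_injective _ hι.inj]
  congr 1
  ext e
  simp only [mem_filter, mem_univ, true_and, mem_image]
  constructor
  · rintro ⟨h1, h2⟩
    obtain ⟨x, rfl⟩ := (hι.iff e).1 h2
    exact ⟨x, h1, rfl⟩
  · rintro ⟨x, h1, rfl⟩
    exact ⟨h1, (hι.iff _).2 ⟨x, rfl⟩⟩

lemma IsRedEnum.rel_iff (hι : G.IsRedEnum ι) (f : E → V × V) (v : V) :
    Rel (f ∘ ι) v ↔ 2 ≤ G.headDeg f Color.red v := by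
  rw [hι.headDeg_eq]; rfl

lemma IsRedEnum.sat_iff (hι : G.IsRedEnum ι) {f : E → V × V} {v : V} :
    G.Sat f v ↔ (∃ e, G.color e = Color.blue ∧ (f e).2 = v) ∨ Rel (f ∘ ι) v := by
  rw [hι.rel_iff, ConstraintGraph.sat_iff]

lemma IsRedEnum.count_map (hι : G.IsRedEnum ι) (f : E → V × V) (a : V × V) :
    (univ.val.map (f ∘ ι)).count a = (G.arcs f).count (a, Color.red) := by
  rw [count_arcs, Multiset.count_map, ← filter_val, ← card_def,
    ← card_image_of_injective _ hι.inj]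
  congr 1
  ext e
  simp only [mem_filter, mem_univ, true_and, mem_image, Function.comp]
  constructor
  · rintro ⟨x, rfl, rfl⟩
    exact ⟨rfl, (hι.iff _).2 ⟨x, rfl⟩⟩
  · rintro ⟨h1, h2⟩
    obtain ⟨x, rfl⟩ := (hι.iff e).1 h2
    exact ⟨x, h1.symm, rfl⟩

lemma IsRedEnum.arcs_eq_iff (hι : G.IsRedEnum ι) :
    G.arcs f = G.arcs g ↔ univ.val.map (f ∘ ι) = univ.val.map (g ∘ ι) ∧
      ∀ a, (G.arcs f).count (a, Color.blue) = (G.arcs g).count (a, Color.blue) := by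
  constructor
  · intro h
    refine ⟨Multiset.ext.2 fun a => ?_, fun a => by rw [h]⟩
    rw [hι.count_map, hι.count_map, h]
  · rintro ⟨h1, h2⟩
    refine Multiset.ext.2 fun ⟨a, col⟩ => ?_
    cases col with
    | red => rw [← hι.count_map, ← hι.count_map, h1]
    | blue => exact h2 a

lemma IsRedEnum.comp_congr (hι : G.IsRedEnum ι) (h : ∀ e, G.color e = Color.red → f e = g e) :
    f ∘ ι = g ∘ ι :=
  funext fun x => h _ ((hι.iff _).2 ⟨x, rfl⟩)

/-- In a component that is not hit and has as many edges as vertices, every vertex is entered by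
exactly one blue arc. -/
lemma IsBlueComp.existsUnique_head (hB : G.IsBlueComp comp lab) (hι : G.IsRedEnum ι)
    (hf : G.Feasible f) (hc : G.eCount lab c = vCount comp c) (hh : ¬Hit comp (f ∘ ι) c) {v : V}
    (hv : comp v = c) : ∃ e, (G.color e = Color.blue ∧ (f e).2 = v) ∧
      ∀ e', G.color e' = Color.blue → (f e').2 = v → e' = e := by
  have h1 := hB.headDeg_eq_one hf.1 hc (fun w hw => headDeg_pos.2
    ((hι.sat_iff.1 (hf.2 w)).resolve_right fun h => hh ⟨w, hw, h⟩)) hv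
  obtain ⟨e, he⟩ := card_eq_one.1 h1
  have hmem : ∀ e', ((f e').2 = v ∧ G.color e' = Color.blue) ↔ e' = e := fun e' => by
    have := congrArg (fun s => e' ∈ s) he
    simpa using this
  exact ⟨e, ((hmem e).2 rfl).symm, fun e' h2 h3 => (hmem e').1 ⟨h3, h2⟩⟩

/-- A blue reversal gives a stationary step of the walk. In a component with fewer edges than
vertices, a vertex without entering blue arc must have two red ones; for a red reversal, the same
vertex serves before and after. In a component with as many edges as vertices, no blue arc can
change before the first hit. -/
lemma exists_walk_of_reach (hB : G.IsBlueComp comp lab) (hι : G.IsRedEnum ι)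
    (h : G.Reach f g) :
    ∃ H, Walk comp (fun c => G.eCount lab c < vCount comp c) (f ∘ ι) (g ∘ ι) H ∧
      ∀ c, G.eCount lab c = vCount comp c → H c ∨ ∀ e ∈ G.blueIn lab c, g e = f e := by
  induction h with
  | refl => exact ⟨_, .start, fun _ _ => Or.inr fun _ _ => rfl⟩
  | @tail g g' _ hs ih =>
    obtain ⟨H, hw, hH⟩ := ih
    obtain ⟨hg, hg', e, rfl⟩ := hs
    refine ⟨_, hw.step ?_ ?_, ?_⟩
    · cases hcol : G.color e with
      | red =>
        obtain ⟨x, rfl⟩ := (hι.iff e).1 hcol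
        exact Or.inr ⟨x, Function.update_comp_eq_of_injective _ hι.inj _ _⟩
      | blue =>
        refine Or.inl (hι.comp_congr fun e' he' => Function.update_of_ne ?_ _ _)
        rintro rfl
        rw [hcol] at he'
        cases he'
    · intro c hc
      cases hcol : G.color e with
      | red =>
        obtain ⟨v, hv, h0⟩ := hB.exists_headDeg_eq_zero hg.1 hc
        have h0' : ¬∃ e, G.color e = Color.blue ∧ (g e).2 = v := by
          rw [← headDeg_pos, h0]; exact lt_irrefl 0
        refine ⟨v, hv, (hι.sat_iff.1 (hg.2 v)).resolve_left h0',
          (hι.sat_iff.1 (hg'.2 v)).resolve_left ?_⟩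
        rintro ⟨e', he', hv'⟩
        rw [Function.update_of_ne] at hv'
        · exact h0' ⟨e', he', hv'⟩
        · rintro rfl
          rw [hcol] at he'
          cases he'
      | blue =>
        obtain ⟨v, hv, h0⟩ := hB.exists_headDeg_eq_zero hg.1 hc
        have h0' : ¬∃ e, G.color e = Color.blue ∧ (g e).2 = v := by
          rw [← headDeg_pos, h0]; exact lt_irrefl 0
        have hr := (hι.sat_iff.1 (hg.2 v)).resolve_left h0'
        refine ⟨v, hv, hr, ?_⟩
        have hcongr : Function.update g e (g e).swap ∘ ι = g ∘ ι := by
          refine hι.comp_congr fun e' he' => Function.update_of_ne ?_ _ _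
          rintro rfl
          rw [hcol] at he'
          cases he'
        rwa [hcongr]
    · intro c hc
      by_cases hhit : Hit comp (Function.update g e (g e).swap ∘ ι) c
      · exact Or.inl (Or.inr hhit)
      rcases hH c hc with h1 | h1
      · exact Or.inl (Or.inl h1)
      by_cases hg2 : H c
      · exact Or.inl (Or.inl hg2)
      refine Or.inr fun e' he' => ?_
      by_cases hee : e' = e
      swap
      · rw [Function.update_of_ne hee, h1 e' he']
      subst hee
      -- Before and after the step, exactly one blue arc enters the old head of `e'`. If afterwards
      -- this is `e'` itself, then `e'` is a loop and its arc has not changed; otherwise two blue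
      -- arcs entered that vertex before.
      rw [← h1 e' he']
      by_contra hne
      rw [Function.update_self] at hne
      have hcomp : comp (g e').2 = c := (hB.head hg.1 he'.1).trans he'.2
      obtain ⟨e₁, ⟨h2, h3⟩, h4⟩ := hB.existsUnique_head hι hg hc
        (fun h => hg2 (hw.end_subset h)) hcomp
      have h5 := h4 e' he'.1 rfl
      obtain ⟨e₂, ⟨h6, h7⟩, h8⟩ := hB.existsUnique_head hι hg' hc hhit hcomp
      by_cases hee : e₂ = e'
      · rw [hee, Function.update_self] at h7
        exact hne (Prod.ext h7.symm h7)
      · rw [Function.update_of_ne hee] at h7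
        exact hee ((h4 e₂ h6 h7).trans h5.symm)

end Walks

end ConstraintGraph

namespace ConstraintGraph

/-! ### Reconfigurability as a condition on the red arcs -/

section Characterization

variable {V E X κ : Type} [Fintype V] [Fintype E] [Fintype X] [DecidableEq V] [DecidableEq E]
  [DecidableEq X] [DecidableEq κ]
variable {G : ConstraintGraph V E} {ι : X → E} {comp : V → κ} {lab : E → κ} {f g h : E → V × V}
  {c : κ}

/-- Moves the blue arcs of all components in `Q` to `b` at once. By `hin` the result is feasible,
and by `hQ` each of these components needs no change or is free to change. -/
lemma IsRedEnum.reach_set_blue (hι : G.IsRedEnum ι) (hB : G.IsBlueComp comp lab)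
    {F b : E → V × V} (hF : G.Feasible F) (hb : G.Orients b) (Q : κ → Prop)
    (hin : ∀ v, Q (comp v) → (∃ e, G.color e = Color.blue ∧ (b e).2 = v) ∨ Rel (F ∘ ι) v)
    (hQ : ∀ c, Q c → (∀ e ∈ G.blueIn lab c, b e = F e) ∨ Hit comp (F ∘ ι) c ∨
      vCount comp c < G.eCount lab c) :
    ∃ h, G.Reach F h ∧ G.Feasible h ∧ h ∘ ι = F ∘ ι ∧
      (∀ e, G.color e = Color.blue → Q (lab e) → h e = b e) ∧
      ∀ e, ¬(G.color e = Color.blue ∧ Q (lab e)) → h e = F e := by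
  classical
  let h : E → V × V := fun e => if G.color e = Color.blue ∧ Q (lab e) then b e else F e
  have hpos : ∀ e, G.color e = Color.blue → Q (lab e) → h e = b e :=
    fun e h1 h2 => if_pos ⟨h1, h2⟩
  have hneg : ∀ e, ¬(G.color e = Color.blue ∧ Q (lab e)) → h e = F e := fun e h1 => if_neg h1
  have hred : ∀ e, G.color e = Color.red → h e = F e := fun e he => hneg e (by simp [he])
  have hcomp : h ∘ ι = F ∘ ι := hι.comp_congr hred
  have hfeas : G.Feasible h := by
    refine ⟨fun e => ?_, fun v => hι.sat_iff.2 ?_⟩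
    · by_cases he : G.color e = Color.blue ∧ Q (lab e)
      · rw [hpos e he.1 he.2]; exact hb e
      · rw [hneg e he]; exact hF.1 e
    · rw [hcomp]
      by_cases hv : Q (comp v)
      · refine (hin v hv).imp_left ?_
        rintro ⟨e, he, hev⟩
        refine ⟨e, he, ?_⟩
        rwa [hpos e he]
        rwa [← hB.head hb he, hev]
      · refine (hι.sat_iff.1 (hF.2 v)).imp_left ?_
        rintro ⟨e, he, hev⟩
        refine ⟨e, he, ?_⟩
        rwa [hneg e]
        rintro ⟨-, h2⟩
        rw [← hB.head hF.1 he, hev] at h2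
        exact hv h2
  refine ⟨h, hB.reach_of_forall hF hfeas hred fun c => ?_, hfeas, hcomp, hpos, hneg⟩
  by_cases hc : Q c
  · rcases hQ c hc with h1 | ⟨v, h1, h2⟩ | h1
    · left
      intro e he
      rw [hpos e he.1 (by rwa [he.2]), h1 e he]
    · exact Or.inr (Or.inl ⟨v, h1, (hι.rel_iff _ _).1 h2⟩)
    · exact Or.inr (Or.inr h1)
  · left
    intro e he
    refine hneg e ?_
    rintro ⟨-, h2⟩
    rw [he.2] at h2
    exact hc h2

/-- Lifts a walk of the red arcs. A component with as many edges as vertices keeps the arcs of `f`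
until it is hit for the first time and has those of `β` from then on; one with more edges has those
of `β` from the outset. Components with fewer edges are given a new root before each step. -/
lemma IsRedEnum.exists_reach_of_walk (hι : G.IsRedEnum ι) (hB : G.IsBlueComp comp lab)
    (hf : G.Feasible f) {β : E → V × V} (hβ : G.Orients β)
    (hin : ∀ v, vCount comp (comp v) ≤ G.eCount lab (comp v) →
      ∃ e, G.color e = Color.blue ∧ (β e).2 = v)
    {S : X → V × V} {H : κ → Prop}
    (hw : Walk comp (fun c => G.eCount lab c < vCount comp c) (f ∘ ι) S H) :
    ∃ F, G.Reach f F ∧ G.Feasible F ∧ F ∘ ι = S ∧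
      ∀ e, G.color e = Color.blue → vCount comp (lab e) ≤ G.eCount lab (lab e) →
        (vCount comp (lab e) < G.eCount lab (lab e) ∨ H (lab e) → F e = β e) ∧
        (¬(vCount comp (lab e) < G.eCount lab (lab e) ∨ H (lab e)) → F e = f e) := by
  induction hw with
  | start =>
    obtain ⟨F, h1, h2, h3, h4, h5⟩ := hι.reach_set_blue hB hf hβ
      (fun c => vCount comp c ≤ G.eCount lab c ∧
        (vCount comp c < G.eCount lab c ∨ Hit comp (f ∘ ι) c))
      (fun v hv => Or.inl (hin v hv.1)) (fun c hc => Or.inr hc.2.symm)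
    exact ⟨F, h1, h2, h3, fun e he hle => ⟨fun h => h4 e he ⟨hle, h⟩,
      fun h => h5 e fun h' => h h'.2.2⟩⟩
  | @step S S' H hw hS htree ih =>
    obtain ⟨F, hF1, hF2, rfl, hF4⟩ := ih
    by_cases hE : Nonempty E
    swap
    · refine ⟨F, hF1, hF2, ?_, fun e => (hE ⟨e⟩).elim⟩
      rcases hS with rfl | ⟨x, -⟩
      exacts [rfl, (hE ⟨ι x⟩).elim]
    -- Outside the trees, blue arcs alone satisfy all vertices: those of `β`, or those of `f` if the
    -- component has not been hit, in particular not by `f`.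
    have hnt : ∀ v, vCount comp (comp v) ≤ G.eCount lab (comp v) →
        ∃ e, G.color e = Color.blue ∧ (F e).2 = v := by
      intro v hv
      by_cases hc : vCount comp (comp v) < G.eCount lab (comp v) ∨ H (comp v)
      · obtain ⟨e, he, hev⟩ := hin v hv
        have hlab := hB.head hβ he
        rw [hev] at hlab
        exact ⟨e, he, by rw [(hF4 e he (hlab ▸ hv)).1 (hlab ▸ hc), hev]⟩
      · obtain ⟨e, he, hev⟩ := (hι.sat_iff.1 (hf.2 v)).resolve_right
          fun h => hc (Or.inr (hw.start_subset ⟨v, rfl, h⟩))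
        have hlab := hB.head hf.1 he
        rw [hev] at hlab
        exact ⟨e, he, by rw [(hF4 e he (hlab ▸ hv)).2 (hlab ▸ hc), hev]⟩
    -- The root of each tree is a vertex entered by two red arcs both before and after the step.
    have hz : ∀ c, ∃ b, G.eCount lab c < vCount comp c → G.Orients b ∧
        ∀ v, comp v = c → (∃ e, G.color e = Color.blue ∧ (b e).2 = v) ∨
          (Rel (F ∘ ι) v ∧ Rel S' v) := by
      intro c
      by_cases hc : G.eCount lab c < vCount comp c
      · obtain ⟨z, hzc, hz⟩ := htree c hc
        obtain ⟨b, h1, -, h3⟩ := hB.exists_orients_root z hzc hF2.1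
        refine ⟨b, fun _ => ⟨h1, fun v hv => ?_⟩⟩
        by_cases hvz : v = z
        · exact Or.inr (hvz ▸ hz)
        · exact Or.inl (h3 v hv hvz)
      · exact ⟨F, fun h => (hc h).elim⟩
    choose b hb using hz
    have hbo : G.Orients (fun e => if G.eCount lab (lab e) < vCount comp (lab e) then b (lab e) e
        else F e) := by
      intro e
      by_cases he : G.eCount lab (lab e) < vCount comp (lab e)
      · simp only [if_pos he]; exact (hb _ he).1 e
      · simp only [if_neg he]; exact hF2.1 e
    have hbin : ∀ v, G.eCount lab (comp v) < vCount comp (comp v) →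
        (∃ e, G.color e = Color.blue ∧ ((fun e => if G.eCount lab (lab e) < vCount comp (lab e)
          then b (lab e) e else F e) e).2 = v) ∨ (Rel (F ∘ ι) v ∧ Rel S' v) := by
      intro v hv
      refine ((hb _ hv).2 v rfl).imp_left ?_
      rintro ⟨e, he, hev⟩
      have hlab : comp v = lab e := by rw [← hev, hB.head (hb _ hv).1 he]
      refine ⟨e, he, ?_⟩
      simp only
      rw [if_pos (hlab ▸ hv), ← hlab, hev]
    -- With the trees directed away from these roots, every other vertex is entered by a blue arc,
    -- so the red arc can be reversed.
    obtain ⟨m, hm1, hm2, hm3, hm4, hm5⟩ := hι.reach_set_blue hB hF2 hbo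
      (fun c => G.eCount lab c < vCount comp c)
      (fun v hv => (hbin v hv).imp_right And.left)
      (fun c hc => Or.inr (Or.inl (by
        obtain ⟨v, h1, h2, -⟩ := htree c hc
        exact ⟨v, h1, h2⟩)))
    obtain ⟨m', hm1', hm2', hm3', hm4'⟩ : ∃ m', G.Reach m m' ∧ G.Feasible m' ∧ m' ∘ ι = S' ∧
        ∀ e, G.color e = Color.blue → m' e = m e := by
      rcases hS with rfl | ⟨x, rfl⟩
      · exact ⟨m, .refl, hm2, hm3, fun _ _ => rfl⟩
      · have hcomp : Function.update m (ι x) (m (ι x)).swap ∘ ι =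
            Function.update (F ∘ ι) x ((F ∘ ι) x).swap := by
          rw [Function.update_comp_eq_of_injective _ hι.inj, ← hm3]
          rfl
        have hoff : ∀ e, G.color e = Color.blue →
            Function.update m (ι x) (m (ι x)).swap e = m e := by
          intro e he
          rw [Function.update_of_ne]
          rintro rfl
          rw [(hι.iff _).2 ⟨x, rfl⟩] at he
          cases he
        have hfeas : G.Feasible (Function.update m (ι x) (m (ι x)).swap) := by
          refine ⟨hm2.1.update_swap _, fun v => hι.sat_iff.2 ?_⟩
          rw [hcomp]
          by_cases hv : G.eCount lab (comp v) < vCount comp (comp v)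
          · refine (hbin v hv).imp ?_ And.right
            rintro ⟨e, he, hev⟩
            have hlab : comp v = lab e := by rw [← hev, hB.head hbo he]
            exact ⟨e, he, by rw [hoff e he, hm4 e he (hlab ▸ hv), hev]⟩
          · obtain ⟨e, he, hev⟩ := hnt v (not_lt.1 hv)
            have hlab : comp v = lab e := by rw [← hev, hB.head hF2.1 he]
            exact Or.inl ⟨e, he, by rw [hoff e he, hm5 e fun h => hv (hlab ▸ h.2), hev]⟩
        exact ⟨_, .single ⟨hm2, hfeas, _, rfl⟩, hfeas, hcomp, hoff⟩
    have hm'F : ∀ e, G.color e = Color.blue → vCount comp (lab e) ≤ G.eCount lab (lab e) →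
        m' e = F e := fun e he hle => by
      rw [hm4' e he, hm5 e fun h => absurd h.2 (not_lt.2 hle)]
    -- Components hit by the new red arcs adopt `β` now, since the hit may be lost in the next step.
    obtain ⟨F', h1, h2, h3, h4, h5⟩ := hι.reach_set_blue hB hm2' hβ
      (fun c => vCount comp c ≤ G.eCount lab c ∧
        (vCount comp c < G.eCount lab c ∨ H c ∨ Hit comp S' c))
      (fun v hv => Or.inl (hin v hv.1)) (fun c hc => by
        rw [hm3']
        rcases hc.2 with h | h | h
        · exact Or.inr (Or.inr h)
        · left
          rintro e ⟨he, rfl⟩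
          rw [hm'F e he hc.1, (hF4 e he hc.1).1 (Or.inr h)]
        · exact Or.inr (Or.inl h))
    refine ⟨F', ((hF1.trans hm1).trans hm1').trans h1, h2, h3.trans hm3', fun e he hle =>
      ⟨fun h => h4 e he ⟨hle, h⟩, fun h => ?_⟩⟩
    rw [h5 e fun h' => h h'.2.2, hm'F e he hle]
    exact (hF4 e he hle).2 fun h' => h (h'.imp_right Or.inl)

/-- Reconfigurability of constraint graphs in terms of the red arcs. The predicate `δ` has to tell
whether the blue arcs of a component with as many edges as vertices differ in the two orientations,
unless one of these orientations hits that component. -/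
theorem reconfigurable_iff_walk (hB : G.IsBlueComp comp lab) (hι : G.IsRedEnum ι)
    (hf : G.Feasible f) (hg : G.Feasible g) (δ : κ → Prop)
    (hδ : ∀ c, G.eCount lab c = vCount comp c → ¬Hit comp (f ∘ ι) c → ¬Hit comp (g ∘ ι) c →
      (δ c ↔ ¬G.SamePred comp f g c)) :
    G.Reconfigurable (G.arcs f) (G.arcs g) ↔
      ∃ S H, Walk comp (fun c => G.eCount lab c < vCount comp c) (f ∘ ι) S H ∧
        univ.val.map S = univ.val.map (g ∘ ι) ∧
        ∀ c, G.eCount lab c = vCount comp c → δ c → H c := by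
  classical
  rw [reconfigurable_arcs_iff hf]
  constructor
  · rintro ⟨g', hr, hg', harcs⟩
    obtain ⟨H, hw, hH⟩ := exists_walk_of_reach hB hι hr
    have hred := (hι.arcs_eq_iff.1 harcs).1
    refine ⟨_, H, hw, hred, fun c hc hδc => ?_⟩
    by_contra hHc
    have hg'f := (hH c hc).resolve_left hHc
    have hnf : ¬Hit comp (f ∘ ι) c := fun h => hHc (hw.start_subset h)
    have hng : ¬Hit comp (g ∘ ι) c := fun h => hHc (hw.end_subset ((hit_congr hred c).2 h))
    -- A component that is never hit ends with the arcs of `f`, so these are arcs of `g`. As only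
    -- one blue arc of `g` enters each of its vertices, the tails agree.
    refine (hδ c hc hnf hng).1 hδc fun e e' he he' hec heads => ?_
    have hlab : lab e = c := (hB.head hf.1 he).symm.trans hec
    have hmem : (f e, Color.blue) ∈ G.arcs g := by
      rw [← harcs]
      refine Multiset.mem_map.2 ⟨e, mem_univ _, ?_⟩
      rw [hg'f e ⟨he, hlab⟩, he]
    obtain ⟨e'', -, he''⟩ := Multiset.mem_map.1 hmem
    obtain ⟨h1, h2⟩ := Prod.mk.inj he''
    obtain ⟨e₀, -, h0⟩ := hB.existsUnique_head hι hg hc hng hec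
    have h3 := h0 e'' h2 (by rw [h1])
    have h4 := h0 e' he' heads.symm
    rw [← h1, h3, h4]
  · rintro ⟨S, H, hw, hS, hH⟩
    -- Where `g` does not hit a component, `β` is already `g`. Where `g` hits, any orientation that
    -- enters all vertices will do, because the component can be corrected at the end.
    obtain ⟨β, hβ, hβin, hβg⟩ : ∃ β, G.Orients β ∧
        (∀ v, vCount comp (comp v) ≤ G.eCount lab (comp v) →
          ∃ e, G.color e = Color.blue ∧ (β e).2 = v) ∧
        ∀ e, G.color e = Color.blue → ¬Hit comp (g ∘ ι) (lab e) → β e = g e := by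
      have : ∀ c, ∃ b, G.Orients b ∧ (vCount comp c ≤ G.eCount lab c →
          ∀ v, comp v = c → ∃ e, G.color e = Color.blue ∧ (b e).2 = v) ∧
          (¬Hit comp (g ∘ ι) c → b = g) := by
        intro c
        by_cases hh : Hit comp (g ∘ ι) c
        · by_cases hc : vCount comp c ≤ G.eCount lab c
          · obtain ⟨b, h1, -, h3⟩ := hB.exists_orients_all hc hg.1
            exact ⟨b, h1, fun _ => h3, fun h => (h hh).elim⟩
          · exact ⟨g, hg.1, fun h => (hc h).elim, fun _ => rfl⟩
        · exact ⟨g, hg.1, fun _ v hv => (hι.sat_iff.1 (hg.2 v)).resolve_right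
            fun h => hh ⟨v, hv, h⟩, fun _ => rfl⟩
      choose b hb1 hb2 hb3 using this
      refine ⟨fun e => b (lab e) e, fun e => hb1 _ e, fun v hv => ?_, fun e he h => ?_⟩
      · obtain ⟨e, he, hev⟩ := hb2 _ hv v rfl
        have hlab : comp v = lab e := by rw [← hev, hB.head (hb1 _) he]
        exact ⟨e, he, show (b (lab e) e).2 = v by rw [← hlab, hev]⟩
      · simp only [hb3 _ h]
    obtain ⟨F, hF1, hF2, rfl, hF4⟩ := hι.exists_reach_of_walk hB hf hβ hβin hw
    -- Adopt `g` except in the components with as many edges as vertices that were never hit; those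
    -- cannot move, and their arcs are compared as multisets below.
    obtain ⟨F', h1, h2, h3, h4, h5⟩ := hι.reach_set_blue hB hF2 hg.1
      (fun c => ¬(G.eCount lab c = vCount comp c ∧ ¬H c))
      (fun v _ => by
        rw [rel_congr hS]
        exact hι.sat_iff.1 (hg.2 v))
      (fun c hc => by
        rcases lt_trichotomy (G.eCount lab c) (vCount comp c) with hlt | heq | hgt
        · right; left
          obtain ⟨v, hv, h0⟩ := hB.exists_headDeg_eq_zero hF2.1 hlt
          refine ⟨v, hv, (hι.sat_iff.1 (hF2.2 v)).resolve_left ?_⟩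
          rw [← headDeg_pos, h0]; exact lt_irrefl 0
        · have hHc : H c := by_contra fun h => hc ⟨heq, h⟩
          by_cases hh : Hit comp (g ∘ ι) c
          · exact Or.inr (Or.inl ((hit_congr hS c).2 hh))
          · left
            rintro e ⟨he, rfl⟩
            rw [(hF4 e he heq.ge).1 (Or.inr hHc), hβg e he hh]
        · exact Or.inr (Or.inr hgt))
    refine ⟨F', hF1.trans h1, h2, hι.arcs_eq_iff.2 ⟨by rw [h3, hS], fun a => ?_⟩⟩
    rw [count_arcs, count_arcs]
    by_cases hc : G.eCount lab (comp a.2) = vCount comp (comp a.2) ∧ ¬H (comp a.2)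
    · have hnf : ¬Hit comp (f ∘ ι) (comp a.2) := fun h => hc.2 (hw.start_subset h)
      have hng : ¬Hit comp (g ∘ ι) (comp a.2) :=
        fun h => hc.2 (hw.end_subset ((hit_congr hS _).2 h))
      have hsame : G.SamePred comp f g (comp a.2) :=
        not_not.1 fun h => hc.2 (hH _ hc.1 ((hδ _ hc.1 hnf hng).2 h))
      have hF'f : ∀ e, G.color e = Color.blue → lab e = comp a.2 → F' e = f e := by
        intro e he hlab
        rw [h5 e fun h => h.2 (hlab ▸ hc), (hF4 e he (hlab ▸ hc.1.ge)).2]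
        rw [hlab]
        exact fun h => h.elim (fun h => absurd hc.1 h.ne') hc.2
      -- In `f` and in `g` a single blue arc enters `a.2`, and `SamePred` makes these two arcs
      -- equal. Hence `a` has the same multiplicity, zero or one, although different parallel edges
      -- may carry it.
      obtain ⟨e₁, ⟨he₁, hv₁⟩, hu₁⟩ := hB.existsUnique_head hι hf hc.1 hnf (v := a.2) rfl
      obtain ⟨e₂, ⟨he₂, hv₂⟩, hu₂⟩ := hB.existsUnique_head hι hg hc.1 hng (v := a.2) rfl
      have htail := hsame e₁ e₂ he₁ he₂ (by rw [hv₁]) (hv₁.trans hv₂.symm)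
      have heq : f e₁ = g e₂ := Prod.ext htail (hv₁.trans hv₂.symm)
      have hl₁ : lab e₁ = comp a.2 := by rw [← hB.head hf.1 he₁, hv₁]
      by_cases ha : f e₁ = a
      · have e1 : (univ.filter fun e => F' e = a ∧ G.color e = Color.blue) = {e₁} := by
          ext e
          simp only [mem_filter, mem_univ, true_and, mem_singleton]
          constructor
          · rintro ⟨h6, h7⟩
            have hl : lab e = comp a.2 := by rw [← hB.head h2.1 h7, h6]
            exact hu₁ e h7 (by rw [← hF'f e h7 hl, h6])
          · rintro rfl
            exact ⟨by rw [hF'f e he₁ hl₁, ha], he₁⟩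
        have e2 : (univ.filter fun e => g e = a ∧ G.color e = Color.blue) = {e₂} := by
          ext e
          simp only [mem_filter, mem_univ, true_and, mem_singleton]
          constructor
          · rintro ⟨h6, h7⟩
            exact hu₂ e h7 (by rw [h6])
          · rintro rfl
            exact ⟨by rw [← heq, ha], he₂⟩
        rw [e1, e2, card_singleton, card_singleton]
      · have e1 : (univ.filter fun e => F' e = a ∧ G.color e = Color.blue) = ∅ := by
          refine filter_eq_empty_iff.2 fun e _ => ?_
          rintro ⟨h6, h7⟩
          have hl : lab e = comp a.2 := by rw [← hB.head h2.1 h7, h6]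
          have h8 := hF'f e h7 hl
          have := hu₁ e h7 (by rw [← h8, h6])
          exact ha (by rw [← this, ← h8, h6])
        have e2 : (univ.filter fun e => g e = a ∧ G.color e = Color.blue) = ∅ := by
          refine filter_eq_empty_iff.2 fun e _ => ?_
          rintro ⟨h6, h7⟩
          have := hu₂ e h7 (by rw [h6])
          exact ha (by rw [heq, ← this, h6])
        rw [e1, e2]
    · congr 1
      refine filter_congr fun e _ => and_congr_left fun he => ?_
      by_cases hl : lab e = comp a.2
      · rw [h4 e he (by rwa [hl])]
      · refine iff_of_false (fun h => hl ?_) (fun h => hl ?_)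
        · rw [← hB.head h2.1 he, h]
        · rw [← hB.head hg.1 he, h]

end Characterization

end ConstraintGraph

/-! ### The kernel -/

/-- The four vertices of a slot of the kernel: the port takes the red arcs, the hub represents a
blue component, and the hub together with the last two vertices may form a triangle. -/
inductive Part
  | port
  | hub
  | left
  | right
  deriving DecidableEq

instance : Fintype Part := ⟨{.port, .hub, .left, .right}, fun x => by cases x <;> decide⟩

/-- A vertex of the kernel. -/
abbrev KVertex (Q : Type) : Type := Q × Part

/-- An edge of the kernel. -/
abbrev KEdge (Q X : Type) : Type := (Q × Part) ⊕ X

/-- The slots `Q` of a kernel. Every slot `i` belongs to a vertex `vert i`; the slots that represent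
a vertex and a component are selected by `slot` and `root`. -/
structure Slots (V κ Q : Type) where
  /-- the labels of the blue components -/
  comp : V → κ
  /-- the vertex of a slot -/
  vert : Q → V
  /-- the slot that represents a vertex -/
  slot : V → Q
  /-- the slot that represents a component -/
  root : κ → Q
  /-- the components with fewer edges than vertices -/
  tree : κ → Prop
  /-- the components with as many edges as vertices that have to be hit -/
  need : κ → Prop
  vert_slot : ∀ i, vert (slot (vert i)) = vert i
  comp_root : ∀ i, comp (vert (root (comp (vert i)))) = comp (vert i)
  not_need : ∀ c, tree c → ¬need c

namespace Slots

section

variable {V E X κ Q : Type} [Fintype V] [Fintype E] [Fintype X] [Fintype Q] [DecidableEq V]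
  [DecidableEq E] [DecidableEq X] [DecidableEq κ] [DecidableEq Q]
variable (D : Slots V κ Q)

/-- The slot `i` represents its vertex. -/
def Prim (i : Q) : Prop := D.slot (D.vert i) = i

/-- The slot `i` represents its component. -/
def Root (i : Q) : Prop := D.root (D.comp (D.vert i)) = i

/-- The slot `i` represents a component with fewer edges than vertices. -/
def TreeRoot (i : Q) : Prop := D.Root i ∧ D.tree (D.comp (D.vert i))

/-- The slot `i` represents a component that has to be hit. -/
def NeedRoot (i : Q) : Prop := D.Root i ∧ D.need (D.comp (D.vert i))

open Classical in
/-- The neighbour of a port. -/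
noncomputable def other (i : Q) : KVertex Q :=
  if D.Prim i then (D.root (D.comp (D.vert i)), .hub) else (i, .port)

/-- The red arcs of the kernel. -/
def mapRed (S : X → V × V) (x : X) : KVertex Q × KVertex Q :=
  ((D.slot (S x).1, .port), (D.slot (S x).2, .port))

/-- An arc in a prescribed direction. -/
def dirArc (d : Bool) (x y : KVertex Q) : KVertex Q × KVertex Q := if d then (x, y) else (y, x)

open Classical in
/-- The orientation of the kernel with red arcs according to `S` and triangles in direction `d`. -/
noncomputable def orient (d : Bool) (S : X → V × V) : KEdge Q X → KVertex Q × KVertex Q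
  | .inl (i, .port) =>
    if ConstraintGraph.Rel S (D.vert i) then ((i, .port), D.other i) else (D.other i, (i, .port))
  | .inl (i, .hub) =>
    if D.TreeRoot i then ((i, .left), (i, .left)) else
      if D.NeedRoot i then dirArc d (i, .hub) (i, .left) else ((i, .hub), (i, .hub))
  | .inl (i, .left) =>
    if D.NeedRoot i then dirArc d (i, .left) (i, .right) else ((i, .left), (i, .left))
  | .inl (i, .right) =>
    if D.NeedRoot i then dirArc d (i, .right) (i, .hub) else ((i, .right), (i, .right))
  | .inr x => D.mapRed S x

/-- The constraint graph of the kernel. -/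
noncomputable def graph (S : X → V × V) : ConstraintGraph (KVertex Q) (KEdge Q X) where
  ends e := s((D.orient true S e).1, (D.orient true S e).2)
  color := Sum.elim (fun _ => .blue) fun _ => .red

open Classical in
/-- The component labels of the kernel. -/
noncomputable def kComp : KVertex Q → κ ⊕ KVertex Q
  | (i, .port) => if D.Prim i then .inl (D.comp (D.vert i)) else .inr (i, .port)
  | (i, .hub) => if D.Root i then .inl (D.comp (D.vert i)) else .inr (i, .hub)
  | (i, .left) => if D.NeedRoot i then .inl (D.comp (D.vert i)) else .inr (i, .left)
  | (i, .right) => if D.NeedRoot i then .inl (D.comp (D.vert i)) else .inr (i, .right)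

open Classical in
/-- The component labels of the edges of the kernel. -/
noncomputable def kLab (S : X → V × V) : KEdge Q X → κ ⊕ KVertex Q
  | .inl (i, .hub) => if D.TreeRoot i then .inr (i, .left) else D.kComp (i, .hub)
  | .inl w => D.kComp w
  | .inr x => D.kComp (D.mapRed S x).1

variable {D}

/-! ### Blue components of the kernel -/

lemma TreeRoot.not_needRoot {i : Q} (h : D.TreeRoot i) : ¬D.NeedRoot i :=
  fun h' => D.not_need _ h.2 h'.2

lemma prim_slot (i : Q) : D.Prim (D.slot (D.vert i)) := by
  rw [Prim, D.vert_slot]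

lemma root_root (i : Q) : D.Root (D.root (D.comp (D.vert i))) := by
  rw [Root, D.comp_root]

lemma kComp_slot {v : V} (hv : ∃ i, D.vert i = v) :
    D.kComp (D.slot v, .port) = .inl (D.comp v) := by
  obtain ⟨i, rfl⟩ := hv
  simp only [kComp, if_pos (prim_slot i), D.vert_slot]

lemma kComp_root {c : κ} (hc : ∃ i, D.comp (D.vert i) = c) :
    D.kComp (D.root c, .hub) = .inl c := by
  obtain ⟨i, rfl⟩ := hc
  simp only [kComp, if_pos (root_root i), D.comp_root]

lemma kComp_other (i : Q) : D.kComp (D.other i) = D.kComp (i, .port) := by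
  by_cases h : D.Prim i
  · simp only [other, if_pos h]
    rw [kComp_root ⟨i, rfl⟩]
    simp only [kComp, if_pos h]
  · simp only [other, if_neg h]

lemma exists_comp_of_kComp {w : KVertex Q} {c : κ} (h : D.kComp w = .inl c) :
    D.comp (D.vert w.1) = c := by
  obtain ⟨i, _ | _ | _ | _⟩ := w <;> simp only [kComp] at h <;> split_ifs at h <;>
    exact Sum.inl.inj h

lemma eq_of_kComp {w w' : KVertex Q} (h : D.kComp w = .inr w') : w = w' := by
  obtain ⟨i, _ | _ | _ | _⟩ := w <;> simp only [kComp] at h <;> split_ifs at h <;>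
    exact Sum.inr.inj h

variable {S : X → V × V}

lemma orient_port_cases (d : Bool) (S : X → V × V) (i : Q) :
    D.orient d S (.inl (i, .port)) = ((i, .port), D.other i) ∨
      D.orient d S (.inl (i, .port)) = (D.other i, (i, .port)) := by
  simp only [orient]
  split_ifs <;> simp

/-- Neither the direction of the triangles nor the red arcs affect the component of a blue edge, so
one labelling serves all orientations of the kernel. -/
lemma kComp_ends (d : Bool) (S₀ S : X → V × V) (w : KVertex Q) :
    D.kComp (D.orient d S (.inl w)).1 = D.kLab S₀ (.inl w) ∧
      D.kComp (D.orient d S (.inl w)).2 = D.kLab S₀ (.inl w) := by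
  obtain ⟨i, _ | _ | _ | _⟩ := w
  · rcases orient_port_cases (D := D) d S i with h | h <;> rw [h] <;>
      simp [kLab, kComp_other]
  · by_cases ht : D.TreeRoot i
    · have := ht.not_needRoot
      simp [orient, kLab, kComp, ht, this]
    · by_cases hn : D.NeedRoot i
      · have := hn.1
        cases d <;> simp [orient, kLab, kComp, ht, hn, this, dirArc]
      · simp [orient, kLab, ht, hn]
  · by_cases hn : D.NeedRoot i
    · cases d <;> simp [orient, kLab, kComp, hn, dirArc]
    · simp [orient, kLab, hn]
  · by_cases hn : D.NeedRoot i
    · have := hn.1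
      cases d <;> simp [orient, kLab, kComp, hn, this, dirArc]
    · simp [orient, kLab, hn]

lemma orients_orient (d : Bool) {S₀ : X → V × V}
    (hS : ∀ x, s((S x).1, (S x).2) = s((S₀ x).1, (S₀ x).2)) :
    (D.graph S₀).Orients (D.orient d S) := by
  rintro (⟨i, _ | _ | _ | _⟩ | x)
  · simp only [graph]
    rcases orient_port_cases (D := D) d S i with h | h <;>
      rcases orient_port_cases (D := D) true S₀ i with h' | h' <;> rw [h, h'] <;>
      first | rfl | exact Sym2.eq_swap
  · simp only [graph, orient]
    split_ifs
    · rfl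
    · cases d <;> first | rfl | exact Sym2.eq_swap
    · rfl
  · simp only [graph, orient]
    split_ifs
    · cases d <;> first | rfl | exact Sym2.eq_swap
    · rfl
  · simp only [graph, orient]
    split_ifs
    · cases d <;> first | rfl | exact Sym2.eq_swap
    · rfl
  · have := congrArg (Sym2.map fun v => (D.slot v, Part.port)) (hS x)
    simpa [graph, orient, mapRed] using this

lemma isRedEnum_inr : (D.graph S).IsRedEnum (Sum.inr : X → KEdge Q X) where
  inj := Sum.inr_injective
  iff e := by cases e <;> simp [graph]

lemma adj_port (i : Q) :
    (D.graph S).AdjIn {e | (D.graph S).color e = Color.blue} (i, .port) (D.other i) := by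
  refine ⟨.inl (i, .port), rfl, ?_⟩
  simp only [graph]
  rcases orient_port_cases (D := D) true S i with h | h <;> rw [h]
  exact Sym2.eq_swap

/-- A vertex with label `c` is the hub of `c`, a port joined to it, or a corner of its triangle,
hence at distance at most one from the hub. -/
lemma reach_hub {w : KVertex Q} {c : κ} (h : D.kComp w = .inl c) :
    ReflTransGen ((D.graph S).AdjIn {e | (D.graph S).color e = Color.blue})
      w (D.root c, .hub) := by
  obtain rfl := exists_comp_of_kComp h
  obtain ⟨i, _ | _ | _ | _⟩ := w <;> simp only [kComp] at h <;> split_ifs at h with hi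
  · refine .single ?_
    have := adj_port (D := D) (S := S) i
    rwa [other, if_pos hi] at this
  · have : D.root (D.comp (D.vert i)) = i := hi
    simp only [this]; exact .refl
  · have hr : D.root (D.comp (D.vert i)) = i := hi.1
    have ht : ¬D.TreeRoot i := fun h => h.not_needRoot hi
    simp only [hr]
    refine .single ⟨.inl (i, .hub), rfl, ?_⟩
    simp [graph, orient, hi, ht, dirArc]
  · have hr : D.root (D.comp (D.vert i)) = i := hi.1
    simp only [hr]
    refine .single ⟨.inl (i, .right), rfl, ?_⟩
    simp [graph, orient, hi, dirArc]

lemma isBlueComp_graph : (D.graph S).IsBlueComp D.kComp (D.kLab S) where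
  mem := by
    rintro (w | x) he v hv
    · have := kComp_ends (D := D) true S S w
      rcases Sym2.mem_iff.1 hv with rfl | rfl
      exacts [this.1, this.2]
    · simp [graph] at he
  conn u v huv := by
    cases hu : D.kComp u with
    | inl c =>
      exact (reach_hub hu).trans
        (ConstraintGraph.AdjIn.reflTransGen_symm (reach_hub (huv ▸ hu)))
    | inr w =>
      rw [eq_of_kComp hu, eq_of_kComp (huv.symm.trans hu)]

lemma eCount_graph (c : κ ⊕ KVertex Q) : (D.graph S).eCount (D.kLab S) c =
    (univ.filter fun w : KVertex Q => D.kLab S (.inl w) = c).card := by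
  rw [ConstraintGraph.eCount, ← card_image_of_injective (univ.filter _)
    (Sum.inl_injective (α := KVertex Q) (β := X))]
  congr 1
  ext e
  simp only [mem_image, mem_filter, mem_univ, true_and]
  cases e <;> simp [graph]

/-- Blue edges are indexed by vertices, and an edge lies in the component of its index, except at
the hub of a tree. This makes the numbers of edges and vertices agree. -/
lemma kLab_eq_iff {c : κ} (hc : ¬D.tree c) (w : KVertex Q) :
    D.kLab S (.inl w) = .inl c ↔ D.kComp w = .inl c := by
  obtain ⟨i, _ | _ | _ | _⟩ := w
  · rfl
  · by_cases ht : D.TreeRoot i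
    · have hr := ht.1
      simp only [kLab, kComp, if_pos ht, if_pos hr, reduceCtorEq, Sum.inl.injEq, false_iff]
      rintro rfl
      exact hc ht.2
    · simp only [kLab, if_neg ht]
  · rfl
  · rfl

lemma kComp_eq_of_kLab {c : κ} {w : KVertex Q} (h : D.kLab S (.inl w) = .inl c) :
    D.kComp w = .inl c := by
  obtain ⟨i, _ | _ | _ | _⟩ := w
  · exact h
  · by_cases ht : D.TreeRoot i
    · simp [kLab, ht] at h
    · simpa [kLab, ht] using h
  · exact h
  · exact h

lemma eCount_eq {c : κ} (hc : ¬D.tree c) :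
    (D.graph S).eCount (D.kLab S) (.inl c) = ConstraintGraph.vCount D.kComp (.inl c) := by
  rw [eCount_graph, ConstraintGraph.vCount]
  congr 1
  exact filter_congr fun w _ => kLab_eq_iff hc w

/-- The edge indexed by the hub of a tree is a loop at `left`, in another component, and is missing
here. -/
lemma eCount_lt {c : κ} (hc : D.tree c) (ht : ∃ i, D.comp (D.vert i) = c) :
    (D.graph S).eCount (D.kLab S) (.inl c) < ConstraintGraph.vCount D.kComp (.inl c) := by
  rw [eCount_graph, ConstraintGraph.vCount]
  refine card_lt_card ⟨fun w => ?_, fun hsub => ?_⟩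
  · simp only [mem_filter, mem_univ, true_and]
    exact kComp_eq_of_kLab
  · have := hsub (show (D.root c, Part.hub) ∈ _ by simpa using kComp_root ht)
    obtain ⟨i, rfl⟩ := ht
    have hroot : D.TreeRoot (D.root (D.comp (D.vert i))) :=
      ⟨root_root i, by rwa [D.comp_root]⟩
    rw [mem_filter] at this
    simp [kLab, hroot] at this

/-- Vertices outside the represented components form singletons with at least one loop, so they are
no further trees. -/
lemma exists_of_eCount_lt {c' : κ ⊕ KVertex Q}
    (h : (D.graph S).eCount (D.kLab S) c' < ConstraintGraph.vCount D.kComp c') :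
    ∃ c, c' = .inl c ∧ D.tree c := by
  cases c' with
  | inl c => exact ⟨c, rfl, by_contra fun hc => absurd (eCount_eq (S := S) hc) h.ne⟩
  | inr w =>
    refine absurd h (not_lt.2 ?_)
    rw [eCount_graph, ConstraintGraph.vCount]
    refine card_le_card fun w' => ?_
    simp only [mem_filter, mem_univ, true_and]
    intro hw'
    obtain rfl := eq_of_kComp hw'
    obtain ⟨i, _ | _ | _ | _⟩ := w'
    · exact hw'
    · have : ¬D.TreeRoot i := fun ht => by simp [kComp, ht.1] at hw'
      simpa [kLab, this] using hw'
    · exact hw'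
    · exact hw'

/-! ### Red arcs and walks of the kernel -/

lemma rel_mapRed (hS : ∀ x, ∃ i, D.vert i = (S x).2) {v : V} (hv : ∃ i, D.vert i = v) :
    ConstraintGraph.Rel (D.mapRed S) (D.slot v, .port) ↔ ConstraintGraph.Rel S v := by
  rw [ConstraintGraph.Rel, ConstraintGraph.Rel]
  have : ∀ x, (D.mapRed S x).2 = (D.slot v, .port) ↔ (S x).2 = v := by
    intro x
    obtain ⟨i, hi⟩ := hS x
    obtain ⟨j, rfl⟩ := hv
    refine ⟨fun h => ?_, fun h => by simp [mapRed, h]⟩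
    have := congrArg D.vert (Prod.mk.inj h).1
    rwa [← hi, D.vert_slot, D.vert_slot, hi] at this
  simp only [this]

lemma exists_of_rel {S : X → V × V} {v : V} (h : ConstraintGraph.Rel S v) :
    ∃ x, (S x).2 = v := by
  obtain ⟨x, hx⟩ := card_pos.1 (lt_of_lt_of_le (by norm_num) h : 0 < _)
  exact ⟨x, by simpa using hx⟩

lemma exists_of_rel_mapRed (hS : ∀ x, ∃ i, D.vert i = (S x).2) {w : KVertex Q}
    (h : ConstraintGraph.Rel (D.mapRed S) w) :
    ∃ v, (∃ i, D.vert i = v) ∧ w = (D.slot v, .port) ∧ ConstraintGraph.Rel S v := by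
  obtain ⟨x, rfl⟩ := exists_of_rel h
  exact ⟨(S x).2, hS x, rfl, (rel_mapRed hS (hS x)).1 h⟩

lemma hit_mapRed (hS : ∀ x, ∃ i, D.vert i = (S x).2) (c' : κ ⊕ KVertex Q) :
    ConstraintGraph.Hit D.kComp (D.mapRed S) c' ↔
      ∃ c, c' = .inl c ∧ ConstraintGraph.Hit D.comp S c := by
  constructor
  · rintro ⟨w, rfl, hw⟩
    obtain ⟨v, hv, rfl, hr⟩ := exists_of_rel_mapRed hS hw
    exact ⟨D.comp v, kComp_slot hv, v, rfl, hr⟩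
  · rintro ⟨c, rfl, v, rfl, hr⟩
    obtain ⟨x, rfl⟩ := exists_of_rel hr
    exact ⟨_, kComp_slot (hS x), (rel_mapRed hS (hS x)).2 hr⟩

/-- The port of a vertex with two entering red arcs sends its blue arc to the hub; every other
representing port receives it. A tree is hit, so some port feeds its hub, which has no other blue
arc. The remaining vertices have loops or triangle arcs. -/
lemma feasible_orient (d : Bool) {S₀ : X → V × V}
    (hS₀ : ∀ x, s((S x).1, (S x).2) = s((S₀ x).1, (S₀ x).2))
    (hS : ∀ x, ∃ i, D.vert i = (S x).2)
    (hit : ∀ c, D.tree c → ConstraintGraph.Hit D.comp S c) :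
    (D.graph S₀).Feasible (D.orient d S) := by
  refine ⟨orients_orient d hS₀, fun w => isRedEnum_inr.sat_iff.2 ?_⟩
  have hred : D.orient d S ∘ Sum.inr = D.mapRed S := rfl
  rw [hred]
  obtain ⟨i, _ | _ | _ | _⟩ := w
  · by_cases hp : D.Prim i
    · by_cases hr : ConstraintGraph.Rel S (D.vert i)
      · right
        have := (rel_mapRed hS ⟨i, rfl⟩).2 hr
        rwa [show D.slot (D.vert i) = i from hp] at this
      · exact Or.inl ⟨.inl (i, .port), rfl, by simp [orient, hr]⟩
    · exact Or.inl ⟨.inl (i, .port), rfl, by simp [orient, other, hp]⟩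
  · by_cases ht : D.TreeRoot i
    · left
      obtain ⟨v, hv, hr⟩ := hit _ ht.2
      obtain ⟨x, rfl⟩ := exists_of_rel hr
      obtain ⟨j, hj⟩ := hS x
      rw [← hj] at hv hr
      refine ⟨.inl (D.slot (D.vert j), .port), rfl, ?_⟩
      have hri : D.root (D.comp (D.vert i)) = i := ht.1
      simp [orient, D.vert_slot, hr, other, prim_slot, hv, hri]
    · by_cases hn : D.NeedRoot i
      · cases d
        · exact Or.inl ⟨.inl (i, .hub), rfl, by simp [orient, ht, hn, dirArc]⟩
        · exact Or.inl ⟨.inl (i, .right), rfl, by simp [orient, hn, dirArc]⟩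
      · exact Or.inl ⟨.inl (i, .hub), rfl, by simp [orient, ht, hn]⟩
  · by_cases hn : D.NeedRoot i
    · have ht : ¬D.TreeRoot i := fun h => h.not_needRoot hn
      cases d
      · exact Or.inl ⟨.inl (i, .left), rfl, by simp [orient, hn, dirArc]⟩
      · exact Or.inl ⟨.inl (i, .hub), rfl, by simp [orient, ht, hn, dirArc]⟩
    · exact Or.inl ⟨.inl (i, .left), rfl, by simp [orient, hn]⟩
  · by_cases hn : D.NeedRoot i
    · cases d
      · exact Or.inl ⟨.inl (i, .right), rfl, by simp [orient, hn, dirArc]⟩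
      · exact Or.inl ⟨.inl (i, .left), rfl, by simp [orient, hn, dirArc]⟩
    · exact Or.inl ⟨.inl (i, .right), rfl, by simp [orient, hn]⟩

lemma mapRed_update (S : X → V × V) (x : X) :
    D.mapRed (Function.update S x (S x).swap) =
      Function.update (D.mapRed S) x (D.mapRed S x).swap := by
  ext1 y
  by_cases hy : y = x
  · subst hy; simp [mapRed]
  · simp [mapRed, hy]

variable {S₀ S₁ : X → V × V}

lemma touched_update {P : V → Prop} (hS : ∀ x, P (S x).1 ∧ P (S x).2) {S' : X → V × V}
    (h : S' = S ∨ ∃ x, S' = Function.update S x (S x).swap) (x : X) :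
    P (S' x).1 ∧ P (S' x).2 := by
  rcases h with rfl | ⟨y, rfl⟩
  · exact hS x
  · by_cases hy : x = y
    · subst hy; simpa using (hS x).symm
    · simpa [hy] using hS x

/-- Ports have two entering red arcs exactly when their vertices do, so the steps carry over; all
trees of the kernel come from `D.tree`. -/
lemma walk_mapRed (h₀ : ∀ x, (∃ i, D.vert i = (S₀ x).1) ∧ ∃ i, D.vert i = (S₀ x).2)
    {tree : κ → Prop} (htree : ∀ c, D.tree c → tree c) {H : κ → Prop}
    (hw : ConstraintGraph.Walk D.comp tree S₀ S H) :
    (∀ x, (∃ i, D.vert i = (S x).1) ∧ ∃ i, D.vert i = (S x).2) ∧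
    ∃ H', ConstraintGraph.Walk D.kComp (fun c => (D.graph S₀).eCount (D.kLab S₀) c <
      ConstraintGraph.vCount D.kComp c) (D.mapRed S₀) (D.mapRed S) H' ∧
      ∀ c, H c → H' (.inl c) := by
  induction hw with
  | start =>
    exact ⟨h₀, _, .start, fun c hc => (hit_mapRed (fun x => (h₀ x).2) _).2 ⟨c, rfl, hc⟩⟩
  | @step S S' H hw hS htr ih =>
    obtain ⟨hT, H', hw', hH⟩ := ih
    have hT' := touched_update (P := fun v => ∃ i, D.vert i = v) hT hS
    refine ⟨hT', _, hw'.step (hS.imp (congrArg _) ?_) (fun c' hc' => ?_), fun c hc => ?_⟩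
    · rintro ⟨x, rfl⟩
      exact ⟨x, mapRed_update S x⟩
    · obtain ⟨c, rfl, hc⟩ := exists_of_eCount_lt hc'
      obtain ⟨v, rfl, h1, h2⟩ := htr c (htree c hc)
      obtain ⟨x, rfl⟩ := exists_of_rel h1
      exact ⟨_, kComp_slot (hT x).2, (rel_mapRed (fun x => (hT x).2) (hT x).2).2 h1,
        (rel_mapRed (fun x => (hT' x).2) (hT x).2).2 h2⟩
    · rcases hc with hc | hc
      · exact Or.inl (hH c hc)
      · exact Or.inr ((hit_mapRed (fun x => (hT' x).2) _).2 ⟨c, rfl, hc⟩)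

/-- Reversals commute with `mapRed`, so every step in the kernel comes from a step in the original.
Trees need a slot here, since otherwise the kernel has no component that enforces their support. -/
lemma exists_walk_of_mapRed (h₀ : ∀ x, (∃ i, D.vert i = (S₀ x).1) ∧ ∃ i, D.vert i = (S₀ x).2)
    {tree : κ → Prop} (htree : ∀ c, tree c → D.tree c ∧ ∃ i, D.comp (D.vert i) = c)
    {S' : X → KVertex Q × KVertex Q} {H' : κ ⊕ KVertex Q → Prop}
    (hw : ConstraintGraph.Walk D.kComp (fun c => (D.graph S₀).eCount (D.kLab S₀) c <
      ConstraintGraph.vCount D.kComp c) (D.mapRed S₀) S' H') :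
    ∃ S H, S' = D.mapRed S ∧ ConstraintGraph.Walk D.comp tree S₀ S H ∧
      (∀ x, (∃ i, D.vert i = (S x).1) ∧ ∃ i, D.vert i = (S x).2) ∧
      ∀ c, H' (.inl c) → H c := by
  induction hw with
  | start =>
    refine ⟨S₀, _, rfl, .start, h₀, fun c hc => ?_⟩
    obtain ⟨c', h1, h2⟩ := (hit_mapRed (fun x => (h₀ x).2) _).1 hc
    rwa [Sum.inl.inj h1]
  | @step S' S'' H' hw hS htr ih =>
    obtain ⟨S, H, rfl, hw', hT, hH⟩ := ih
    obtain ⟨T, rfl, hT'⟩ : ∃ T, S'' = D.mapRed T ∧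
        (T = S ∨ ∃ x, T = Function.update S x (S x).swap) := by
      rcases hS with rfl | ⟨x, rfl⟩
      · exact ⟨S, rfl, Or.inl rfl⟩
      · exact ⟨_, (mapRed_update S x).symm, Or.inr ⟨x, rfl⟩⟩
    have hTT := touched_update (P := fun v => ∃ i, D.vert i = v) hT hT'
    refine ⟨T, _, rfl, hw'.step hT' fun c hc => ?_, hTT, fun c hc => ?_⟩
    · obtain ⟨h1, h2⟩ := htree c hc
      obtain ⟨w, hw, h3, h4⟩ := htr _ (eCount_lt h1 h2)
      obtain ⟨v, hv, rfl, h5⟩ := exists_of_rel_mapRed (fun x => (hT x).2) h3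
      rw [kComp_slot hv] at hw
      exact ⟨v, Sum.inl.inj hw, h5, (rel_mapRed (fun x => (hTT x).2) hv).1 h4⟩
    · rcases hc with hc | hc
      · exact Or.inl (hH c hc)
      · obtain ⟨c', h1, h2⟩ := (hit_mapRed (fun x => (hTT x).2) _).1 hc
        rw [Sum.inl.inj h1]
        exact Or.inr h2

/-- On vertices that have a slot, `vert` inverts `slot`, so different red arcs are not identified.
-/
lemma map_mapRed_eq_iff (hS : ∀ x, (∃ i, D.vert i = (S x).1) ∧ ∃ i, D.vert i = (S x).2)
    (h₁ : ∀ x, (∃ i, D.vert i = (S₁ x).1) ∧ ∃ i, D.vert i = (S₁ x).2) :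
    univ.val.map (D.mapRed S) = univ.val.map (D.mapRed S₁) ↔
      univ.val.map S = univ.val.map S₁ := by
  have hl : ∀ S : X → V × V, univ.val.map (D.mapRed S) =
      (univ.val.map S).map fun a => ((D.slot a.1, Part.port), (D.slot a.2, Part.port)) := by
    intro S
    rw [Multiset.map_map]; rfl
  have hr : ∀ S : X → V × V, (∀ x, (∃ i, D.vert i = (S x).1) ∧ ∃ i, D.vert i = (S x).2) →
      univ.val.map S = (univ.val.map (D.mapRed S)).map fun a => (D.vert a.1.1, D.vert a.2.1) := by
    intro S hS
    rw [Multiset.map_map]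
    refine Multiset.map_congr rfl fun x _ => ?_
    obtain ⟨⟨i, hi⟩, ⟨j, hj⟩⟩ := hS x
    refine Prod.ext ?_ ?_
    · simp only [Function.comp, mapRed]
      rw [← hi, D.vert_slot]
    · simp only [Function.comp, mapRed]
      rw [← hj, D.vert_slot]
  constructor
  · intro h
    rw [hr S hS, hr S₁ h₁, h]
  · intro h
    rw [hl, hl, h]

/-- Such a component has one vertex only, and all its blue arcs are loops. -/
lemma samePred_of_inr (w : KVertex Q) :
    ConstraintGraph.SamePred (D.graph S₀) D.kComp (D.orient true S₀) (D.orient false S₁) (.inr w) := by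
  have key : ∀ (d : Bool) (S : X → V × V) (e : KEdge Q X),
      (D.graph S₀).color e = Color.blue → D.kComp (D.orient d S e).2 = .inr w →
      (D.orient d S e).1 = w ∧ (D.orient d S e).2 = w := by
    rintro d S (w' | x) he h
    · have hk := kComp_ends (D := D) d S S w'
      refine ⟨eq_of_kComp (D := D) ?_, eq_of_kComp h⟩
      rw [hk.1, ← hk.2, h]
    · simp [graph] at he
  intro e e' he he' hc heads
  obtain ⟨h1, -⟩ := key true S₀ e he hc
  obtain ⟨h2, -⟩ := key false S₁ e' he' (heads ▸ hc)
  rw [h1, h2]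

/-- Without a hit, the hub feeds all ports in both orientations, and loops have no direction. Only a
triangle, present if `c` has to be hit, distinguishes them. -/
lemma samePred_iff {c : κ} (hc : ¬D.tree c) (ht : ∃ i, D.comp (D.vert i) = c)
    (hn₀ : ¬ConstraintGraph.Hit D.comp S₀ c) (hn₁ : ¬ConstraintGraph.Hit D.comp S₁ c) :
    (D.graph S₀).SamePred D.kComp (D.orient true S₀) (D.orient false S₁) (.inl c) ↔
      ¬D.need c := by
  constructor
  · intro h hn
    obtain ⟨i, rfl⟩ := ht
    set r := D.root (D.comp (D.vert i)) with hr
    have hroot : D.NeedRoot r := ⟨root_root i, by rwa [hr, D.comp_root]⟩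
    have htree : ¬D.TreeRoot r := fun h => h.not_needRoot hroot
    have := h (.inl (r, .right)) (.inl (r, .hub)) rfl rfl
      (by
        simp only [orient, if_pos hroot, dirArc, if_true]
        exact kComp_root ⟨i, rfl⟩) (by simp [orient, hroot, htree, dirArc])
    simp [orient, hroot, htree, dirArc] at this
  · intro hn
    have hroot : ∀ i, D.comp (D.vert i) = c → ¬D.TreeRoot i ∧ ¬D.NeedRoot i := by
      rintro i rfl
      exact ⟨fun h => hc h.2, fun h => hn h.2⟩
    have key : ∀ (d : Bool) (S : X → V × V), ¬ConstraintGraph.Hit D.comp S c → ∀ w : KVertex Q,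
        D.kComp (D.orient d S (.inl w)).2 = .inl c →
        (D.orient d S (.inl w)).2 = w ∧ (D.orient d S (.inl w)).1 =
          if w.2 = Part.port then D.other w.1 else w := by
      intro d S hS w hw
      have hk := kComp_ends (D := D) d S S w
      have hwc : D.kComp w = .inl c := kComp_eq_of_kLab (S := S) (hk.2.symm.trans hw)
      have hwi := exists_comp_of_kComp hwc
      obtain ⟨h1, h2⟩ := hroot _ hwi
      obtain ⟨i, _ | _ | _ | _⟩ := w
      · have hnr : ¬ConstraintGraph.Rel S (D.vert i) := fun h => hS ⟨_, hwi, h⟩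
        simp [orient, hnr]
      · simp_all [orient]
      · simp_all [orient]
      · simp_all [orient]
    rintro (w | x) (w' | x') he he' hcomp heads
    · obtain ⟨h1, h2⟩ := key true S₀ hn₀ w hcomp
      obtain ⟨h3, h4⟩ := key false S₁ hn₁ w' (heads ▸ hcomp)
      rw [h1, h3] at heads
      rw [h2, h4, heads]
    all_goals simp [graph] at he he'

/-- The kernel is equivalent to the original instance. -/
theorem reconfigurable_graph_iff {G : ConstraintGraph V E} {ι : X → E} {lab : E → κ}
    {f g : E → V × V} (hB : G.IsBlueComp D.comp lab) (hι : G.IsRedEnum ι)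
    (hf : G.Feasible f) (hg : G.Feasible g) (δ : κ → Prop)
    (hδ : ∀ c, G.eCount lab c = ConstraintGraph.vCount D.comp c →
      ¬ConstraintGraph.Hit D.comp (f ∘ ι) c → ¬ConstraintGraph.Hit D.comp (g ∘ ι) c →
      (δ c ↔ ¬G.SamePred D.comp f g c))
    (htree : ∀ c, D.tree c ↔ G.eCount lab c < ConstraintGraph.vCount D.comp c)
    (hneed : ∀ c, D.need c ↔ G.eCount lab c = ConstraintGraph.vCount D.comp c ∧ δ c)
    (htouch : ∀ x, (∃ i, D.vert i = (f (ι x)).1) ∧ ∃ i, D.vert i = (f (ι x)).2)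
    (hgood : ∀ c, D.need c → ∃ i, D.comp (D.vert i) = c) :
    (D.graph (f ∘ ι)).Feasible (D.orient true (f ∘ ι)) ∧
    (D.graph (f ∘ ι)).Feasible (D.orient false (g ∘ ι)) ∧
    ((D.graph (f ∘ ι)).Reconfigurable ((D.graph (f ∘ ι)).arcs (D.orient true (f ∘ ι)))
      ((D.graph (f ∘ ι)).arcs (D.orient false (g ∘ ι))) ↔
      G.Reconfigurable (G.arcs f) (G.arcs g)) := by
  have hends : ∀ x, s((g (ι x)).1, (g (ι x)).2) = s((f (ι x)).1, (f (ι x)).2) :=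
    fun x => (hg.1 _).trans (hf.1 _).symm
  have htouch' : ∀ x, (∃ i, D.vert i = (g (ι x)).1) ∧ ∃ i, D.vert i = (g (ι x)).2 := by
    intro x
    rcases hf.1.eq_or_swap hg.1 (ι x) with h | h <;> rw [h]
    exacts [htouch x, (htouch x).symm]
  have hithit : ∀ f, G.Feasible f → ∀ c, D.tree c →
      ConstraintGraph.Hit D.comp (f ∘ ι) c := by
    intro f hf c hc
    obtain ⟨v, hv, h0⟩ := hB.exists_headDeg_eq_zero hf.1 ((htree c).1 hc)
    refine ⟨v, hv, (hι.sat_iff.1 (hf.2 v)).resolve_left ?_⟩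
    rw [← ConstraintGraph.headDeg_pos, h0]
    exact lt_irrefl 0
  have hf' : (D.graph (f ∘ ι)).Feasible (D.orient true (f ∘ ι)) :=
    feasible_orient true (fun _ => rfl) (fun x => (htouch x).2) (hithit f hf)
  have hg' : (D.graph (f ∘ ι)).Feasible (D.orient false (g ∘ ι)) :=
    feasible_orient false hends (fun x => (htouch' x).2) (hithit g hg)
  refine ⟨hf', hg', ?_⟩
  -- Both sides become statements about red walks, with `need` in the role of `δ` for the kernel. A
  -- component with as many edges as vertices and without need imposes nothing, so it also models
  -- components with surplus edges.
  rw [ConstraintGraph.reconfigurable_iff_walk hB hι hf hg δ hδ,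
    ConstraintGraph.reconfigurable_iff_walk (lab := D.kLab (f ∘ ι)) isBlueComp_graph isRedEnum_inr
      hf' hg' (fun c' => ∃ c, c' = .inl c ∧ D.need c) (fun c' hc' hn₀ hn₁ => ?_)]
  · constructor
    · rintro ⟨S', H', hw, hS, hH⟩
      obtain ⟨S, H, rfl, hw', hT, hHH⟩ := exists_walk_of_mapRed (S₀ := f ∘ ι) htouch
        (tree := fun c => G.eCount lab c < ConstraintGraph.vCount D.comp c) (fun c hc => by
          refine ⟨(htree c).2 hc, ?_⟩
          -- A tree is hit by the initial orientation, so it contains an end of a red edge and has a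
          -- slot.
          obtain ⟨v, rfl, hr⟩ := hithit f hf c ((htree c).2 hc)
          obtain ⟨x, rfl⟩ := exists_of_rel hr
          obtain ⟨i, hi⟩ := (htouch x).2
          exact ⟨i, by rw [hi]; rfl⟩) hw
      refine ⟨S, H, hw', (map_mapRed_eq_iff hT htouch').1 hS, fun c h1 h2 => hHH c ?_⟩
      have hn := (hneed c).2 ⟨h1, h2⟩
      exact hH _ (eCount_eq fun ht => D.not_need c ht hn) ⟨c, rfl, hn⟩
    · rintro ⟨S, H, hw, hS, hH⟩
      obtain ⟨hT, H', hw', hHH⟩ := walk_mapRed (S₀ := f ∘ ι) htouch (fun c hc => (htree c).1 hc) hw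
      refine ⟨_, H', hw', (map_mapRed_eq_iff hT htouch').2 hS, ?_⟩
      rintro _ - ⟨c, rfl, hn⟩
      exact hHH c (hH c ((hneed c).1 hn).1 ((hneed c).1 hn).2)
  · have hred : ∀ (d : Bool) (S : X → V × V), D.orient d S ∘ Sum.inr = D.mapRed S := fun _ _ => rfl
    rw [hred, hit_mapRed (S := f ∘ ι) fun x => (htouch x).2] at hn₀
    rw [hred, hit_mapRed (S := g ∘ ι) fun x => (htouch' x).2] at hn₁
    cases c' with
    | inr w => simp [samePred_of_inr]
    | inl c =>
      by_cases ht : ∃ i, D.comp (D.vert i) = c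
      · have hnt : ¬D.tree c := fun h => absurd hc' (eCount_lt h ht).ne
        rw [samePred_iff hnt ht (fun h => hn₀ ⟨c, rfl, h⟩) (fun h => hn₁ ⟨c, rfl, h⟩)]
        simp
      · refine iff_of_false ?_ (not_not.2 ?_)
        · rintro ⟨c', h1, h2⟩
          rw [Sum.inl.inj h1] at ht
          exact ht (hgood _ h2)
        · intro e e' _ _ hcomp
          exact (ht ⟨_, exists_comp_of_kComp hcomp⟩).elim

end

end Slots

/-! ### Relabelling vertices and edges -/

section Relabel

variable {V E V' E' : Type} [Fintype E] [Fintype E'] [DecidableEq V] [DecidableEq V']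
  [DecidableEq E] [DecidableEq E']

/-- The same graph with other names of the vertices and edges. -/
def ConstraintGraph.relabel (G : ConstraintGraph V E) (φ : V ≃ V') (ψ : E ≃ E') :
    ConstraintGraph V' E' where
  ends e := (G.ends (ψ.symm e)).map φ
  color e := G.color (ψ.symm e)

/-- The same orientation with other names of the vertices and edges. -/
def relabelOrient (φ : V ≃ V') (ψ : E ≃ E') (f : E → V × V) (e : E') : V' × V' :=
  Prod.map φ φ (f (ψ.symm e))

/-- The same arcs with other names of the vertices. -/
def mapArcs (φ : V ≃ V') (A : Multiset (Arc V)) : Multiset (Arc V') :=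
  A.map fun a => (Prod.map φ φ a.1, a.2)

namespace ConstraintGraph

variable {G : ConstraintGraph V E} (φ : V ≃ V') (ψ : E ≃ E')

lemma arcs_relabel (f : E → V × V) :
    (G.relabel φ ψ).arcs (relabelOrient φ ψ f) = mapArcs φ (G.arcs f) := by
  rw [mapArcs, arcs, arcs, Multiset.map_map, ← map_univ_equiv ψ, map_val, Multiset.map_map]
  refine Multiset.map_congr rfl fun e _ => ?_
  simp [relabel, relabelOrient]

lemma orients_relabel {f : E → V × V} (hf : G.Orients f) :
    (G.relabel φ ψ).Orients (relabelOrient φ ψ f) := by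
  intro e
  exact congrArg (Sym2.map φ) (hf (ψ.symm e))

lemma inDegree_mapArcs (A : Multiset (Arc V)) (c : Color) (v : V) :
    inDegree (mapArcs φ A) c (φ v) = inDegree A c v := by
  rw [inDegree, inDegree, mapArcs, Multiset.countP_map, ← Multiset.countP_eq_card_filter]
  congr 1
  ext a
  simp

lemma IsFeasible.relabel {A : Multiset (Arc V)} (hA : G.IsFeasible A) :
    (G.relabel φ ψ).IsFeasible (mapArcs φ A) := by
  obtain ⟨⟨f, hf, rfl⟩, h⟩ := hA
  refine ⟨⟨_, orients_relabel φ ψ hf, (arcs_relabel φ ψ f).symm⟩, fun v => ?_⟩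
  obtain ⟨v, rfl⟩ := φ.surjective v
  rw [inDegree_mapArcs, inDegree_mapArcs]
  exact h v

lemma Reconfigurable.relabel {A B : Multiset (Arc V)} (h : G.Reconfigurable A B) :
    (G.relabel φ ψ).Reconfigurable (mapArcs φ A) (mapArcs φ B) := by
  obtain ⟨l, S, rfl, rfl, hS, hadj⟩ := h
  refine ⟨l, fun i => mapArcs φ (S i), rfl, rfl, fun i hi => (hS i hi).relabel φ ψ,
    fun i hi => ?_⟩
  rcases hadj i hi with h | ⟨x, y, c, R, h1, h2⟩
  · exact Or.inl (congrArg _ h)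
  · refine Or.inr ⟨φ x, φ y, c, mapArcs φ R, ?_, ?_⟩
    · simp [mapArcs, h1]
    · simp [mapArcs, h2]

lemma reconfigurable_relabel_iff {A B : Multiset (Arc V)} :
    (G.relabel φ ψ).Reconfigurable (mapArcs φ A) (mapArcs φ B) ↔ G.Reconfigurable A B := by
  refine ⟨fun h => ?_, Reconfigurable.relabel φ ψ⟩
  have h' := h.relabel φ.symm ψ.symm
  have h1 : (G.relabel φ ψ).relabel φ.symm ψ.symm = G := by
    cases G
    simp [ConstraintGraph.relabel, Sym2.map_map]
  have h2 : ∀ A, mapArcs φ.symm (mapArcs φ A) = A := by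
    intro A
    rw [mapArcs, mapArcs, Multiset.map_map]
    exact (Multiset.map_congr rfl fun a _ => by simp [Prod.map]).trans (Multiset.map_id _)
  rwa [h1, h2, h2] at h'

end ConstraintGraph

/-- The instance of C2C given by two feasible orientations of a graph and numberings of its vertices
and edges. -/
def C2CInstance.ofEquiv {n m : ℕ} (G : ConstraintGraph V E) (f g : E → V × V)
    (hf : G.Feasible f) (hg : G.Feasible g) (φ : V ≃ Fin n) (ψ : E ≃ Fin m) : C2CInstance where
  n := n
  m := m
  G := G.relabel φ ψ
  ini := relabelOrient φ ψ f
  tar := relabelOrient φ ψ g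
  ini_ends := ConstraintGraph.orients_relabel φ ψ hf.1
  tar_ends := ConstraintGraph.orients_relabel φ ψ hg.1
  ini_feasible := by
    rw [ConstraintGraph.arcs_relabel]
    exact ((ConstraintGraph.isFeasible_arcs_iff hf.1).2 hf).relabel φ ψ
  tar_feasible := by
    rw [ConstraintGraph.arcs_relabel]
    exact ((ConstraintGraph.isFeasible_arcs_iff hg.1).2 hg).relabel φ ψ

lemma C2CInstance.isYes_ofEquiv {n m : ℕ} {G : ConstraintGraph V E} {f g : E → V × V}
    {hf : G.Feasible f} {hg : G.Feasible g} {φ : V ≃ Fin n} {ψ : E ≃ Fin m} :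
    (C2CInstance.ofEquiv G f g hf hg φ ψ).IsYes ↔ G.Reconfigurable (G.arcs f) (G.arcs g) := by
  rw [← ConstraintGraph.reconfigurable_relabel_iff φ ψ, ← ConstraintGraph.arcs_relabel φ ψ,
    ← ConstraintGraph.arcs_relabel φ ψ]
  rfl

lemma C2CInstance.isStoredIn_ofEquiv {n m : ℕ} {G : ConstraintGraph V E} {f g : E → V × V}
    {hf : G.Feasible f} {hg : G.Feasible g} {φ : V ≃ Fin n} {ψ : E ≃ Fin m} {M : Memory}
    (hn : M 0 0 = n) (hm : M 0 1 = m)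
    (h : ∀ e : E, M 1 (ψ e) = φ (f e).1 ∧ M 2 (ψ e) = φ (f e).2 ∧ M 3 (ψ e) = φ (g e).1 ∧
      M 4 (ψ e) = φ (g e).2 ∧ M 5 (ψ e) = (G.color e).weight) :
    (C2CInstance.ofEquiv G f g hf hg φ ψ).IsStoredIn M := by
  refine ⟨hn, hm, fun e => ?_⟩
  obtain ⟨e, rfl⟩ := ψ.surjective (e : Fin m)
  simpa [C2CInstance.ofEquiv, relabelOrient, ConstraintGraph.relabel] using h e

end Relabel

/-! ### A fixed no-instance -/

/-- A directed triangle and its reversal. -/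
def noInstance : C2CInstance where
  n := 3
  m := 3
  G := ⟨![s(0, 1), s(1, 2), s(2, 0)], fun _ => .blue⟩
  ini := ![(0, 1), (1, 2), (2, 0)]
  tar := ![(1, 0), (2, 1), (0, 2)]
  ini_ends := by decide
  tar_ends := by decide
  ini_feasible := ⟨⟨_, by decide, rfl⟩, by decide⟩
  tar_feasible := ⟨⟨_, by decide, rfl⟩, by decide⟩

/-- A directed blue triangle is frozen: reversing an arc leaves its head without any entering arc.
-/
lemma not_isYes_noInstance : ¬noInstance.IsYes := by
  have hini : noInstance.G.Feasible noInstance.ini :=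
    (ConstraintGraph.isFeasible_arcs_iff noInstance.ini_ends).1 noInstance.ini_feasible
  rw [C2CInstance.IsYes, C2CInstance.iniArcs, ConstraintGraph.reconfigurable_arcs_iff hini]
  rintro ⟨g, hr, -, hg⟩
  have hstuck : ∀ e, ∃ v, ¬noInstance.G.Sat
      (Function.update noInstance.ini e (noInstance.ini e).swap) v := by
    unfold ConstraintGraph.Sat
    decide
  have : g = noInstance.ini := by
    clear hg
    induction hr with
    | refl => rfl
    | tail _ hs ih =>
      subst ih
      obtain ⟨-, h2, e, rfl⟩ := hs
      obtain ⟨v, hv⟩ := hstuck e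
      exact (hv (h2.2 v)).elim
  subst this
  have hne : noInstance.iniArcs ≠ noInstance.tarArcs := by decide
  exact hne hg

/-! ### Numbering the kernel -/

/-- The position of a vertex in its slot. -/
def Part.index : Part → Fin 4
  | .port => 0
  | .hub => 1
  | .left => 2
  | .right => 3

/-- The positions of the vertices of a slot are `0, …, 3`. -/
def Part.equivFin : Part ≃ Fin 4 where
  toFun := Part.index
  invFun := ![.port, .hub, .left, .right]
  left_inv q := by cases q <;> rfl
  right_inv q := by revert q; decide

/-- The numbering of the vertices of a kernel. -/
def kVertexEquiv (N : ℕ) : KVertex (Fin N) ≃ Fin (N * 4) :=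
  ((Equiv.refl _).prodCongr Part.equivFin).trans finProdFinEquiv

/-- The numbering of the edges of a kernel. -/
def kEdgeEquiv (N k : ℕ) : KEdge (Fin N) (Fin k) ≃ Fin (N * 4 + k) :=
  ((kVertexEquiv N).sumCongr (Equiv.refl _)).trans finSumFinEquiv

lemma kVertexEquiv_val {N : ℕ} (i : Fin N) (q : Part) :
    (kVertexEquiv N (i, q) : ℕ) = (i + i) + (i + i) + q.index := by
  simp [kVertexEquiv, Part.equivFin, finProdFinEquiv]
  omega

lemma kEdgeEquiv_inl_val {N k : ℕ} (w : KVertex (Fin N)) :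
    (kEdgeEquiv N k (.inl w) : ℕ) = kVertexEquiv N w := by
  simp [kEdgeEquiv]

lemma kEdgeEquiv_inr_val {N k : ℕ} (x : Fin k) :
    (kEdgeEquiv N k (.inr x) : ℕ) = N * 4 + x := by
  simp [kEdgeEquiv]

/-! ### Programming the random access machine -/

lemma Memory.update_eq (M : Memory) (a i x : ℕ) :
    M.update a i x = Function.update M a (Function.update (M a) i x) := by
  funext b j
  by_cases hb : b = a
  · subst hb
    by_cases hj : j = i <;> simp [Memory.update, Function.update, hj]
  · simp [Memory.update, hb]

/-- The program `P` started on `M` halts within time `T`, with a memory that satisfies `Q`. -/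
def Exec (P : Program) (M : Memory) (T : ℕ) (Q : Memory → Prop) : Prop :=
  ∃ M' t, P.Run M M' t ∧ t ≤ T ∧ Q M'

lemma Exec.seq {P P' : Program} {M : Memory} {T T' : ℕ} {Q Q' : Memory → Prop}
    (h : Exec P M T Q) (h' : ∀ M', Q M' → Exec P' M' T' Q') :
    Exec (.seq P P') M (T + T') Q' := by
  obtain ⟨M', t, hr, ht, hQ⟩ := h
  obtain ⟨M'', t', hr', ht', hQ'⟩ := h' M' hQ
  exact ⟨M'', t + t', hr.seq hr', Nat.add_le_add ht ht', hQ'⟩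

lemma Exec.mono {P : Program} {M : Memory} {T T' : ℕ} {Q Q' : Memory → Prop}
    (h : Exec P M T Q) (hT : T ≤ T') (hQ : ∀ M', Q M' → Q' M') : Exec P M T' Q' := by
  obtain ⟨M', t, hr, ht, hQ'⟩ := h
  exact ⟨M', t, hr, ht.trans hT, hQ M' hQ'⟩

lemma exec_write {M : Memory} {a : ℕ} {i e : Expr} {T : ℕ} {Q : Memory → Prop}
    (hT : i.cost + e.cost + 1 ≤ T) (hQ : Q (M.update a (i.eval M) (e.eval M))) :
    Exec (.write a i e) M T Q :=
  ⟨_, _, .write M a i e, hT, hQ⟩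

lemma exec_ite {M : Memory} {e : Expr} {P P' : Program} {T : ℕ} {Q : Memory → Prop}
    (h : e.eval M ≠ 0 → Exec P M T Q) (h' : e.eval M = 0 → Exec P' M T Q) :
    Exec (.ite e P P') M (e.cost + 1 + T) Q := by
  by_cases he : e.eval M = 0
  · obtain ⟨M', t, hr, ht, hQ⟩ := h' he
    exact ⟨M', _, .ite_false he hr, by omega, hQ⟩
  · obtain ⟨M', t, hr, ht, hQ⟩ := h he
    exact ⟨M', _, .ite_true he hr, by omega, hQ⟩

/-- Execute `P` with cell 0 of array `c` running through `0, …, bound - 1`. -/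
def forLoop (c : ℕ) (bound : Expr) (P : Program) : Program :=
  .seq (.write c (.const 0) (.const 0))
    (.loop (.sub bound (.read c (.const 0)))
      (.seq P (.write c (.const 0) (.add (.read c (.const 0)) (.const 1)))))

/-- A round costs at most `T` for the body, `bound.cost + 4` for the test and 6 for the increment.
The extra round in the bound pays for the initialization and the last test. The body has to preserve
the counter. -/
lemma exec_forLoop {c N T : ℕ} {bound : Expr} {P : Program} {M : Memory}
    (Inv : ℕ → Memory → Prop) (h0 : Inv 0 (M.update c 0 0))
    (hb : ∀ j ≤ N, ∀ M, Inv j M → bound.eval M = N)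
    (hstep : ∀ j < N, ∀ M, Inv j M → M c 0 = j →
      Exec P M T fun M' => M' c 0 = j ∧ Inv (j + 1) (M'.update c 0 (j + 1))) :
    Exec (forLoop c bound P) M ((N + 1) * (T + bound.cost + 20)) (Inv N) := by
  have hcost : (Expr.sub bound (.read c (.const 0))).cost = bound.cost + 3 := by
    simp [Expr.cost]
  have key : ∀ d j, j + d = N → ∀ M, Inv j M → M c 0 = j →
      Exec (.loop (.sub bound (.read c (.const 0)))
        (.seq P (.write c (.const 0) (.add (.read c (.const 0)) (.const 1))))) M
        (d * (T + bound.cost + 20) + (bound.cost + 4)) (Inv N) := by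
    intro d
    induction d with
    | zero =>
      intro j hj M hM hMc
      obtain rfl : j = N := by omega
      refine ⟨M, _, .loop_false ?_, ?_, hM⟩
      · simp [Expr.eval, hb _ le_rfl M hM, hMc]
      · rw [hcost]; omega
    | succ d ih =>
      intro j hj M hM hMc
      obtain ⟨M', t, hr, ht, hM'c, hInv⟩ := hstep j (by omega) M hM hMc
      obtain ⟨M'', t', hr', ht', hQ⟩ := ih (j + 1) (by omega) _ hInv (by simp [Memory.update])
      have hw := Program.Run.write M' c (.const 0) (.add (.read c (.const 0)) (.const 1))
      simp only [Expr.eval, hM'c] at hw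
      refine ⟨M'', _, .loop_true ?_ (hr.seq hw) hr', ?_, hQ⟩
      · simp only [Expr.eval, hb j (by omega) M hM, hMc]
        omega
      · rw [hcost]
        simp only [Expr.cost]
        have : (d + 1) * (T + bound.cost + 20) = d * (T + bound.cost + 20) +
          (T + bound.cost + 20) := by ring
        omega
  obtain ⟨M', t, hr, ht, hQ⟩ := key N 0 (by omega) _ h0 (by simp [Memory.update])
  refine ⟨M', _, (Program.Run.write M c (.const 0) (.const 0)).seq hr, ?_, hQ⟩
  have : (N + 1) * (T + bound.cost + 20) = N * (T + bound.cost + 20) +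
    (T + bound.cost + 20) := by ring
  simp only [Expr.cost]
  omega

/-- A loop that writes one cell of array `a` per round, with the round in cell 0 of array 6. -/
def scatter (a : ℕ) (bound cond idx v v' : Expr) : Program :=
  forLoop 6 bound (.ite cond (.write a idx v) (.write a idx v'))

/-- The result of updating an array in rounds `0, …, N - 1`. -/
def iterate (upd : ℕ → (ℕ → ℕ) → ℕ → ℕ) (A : ℕ → ℕ) : ℕ → ℕ → ℕ
  | 0 => A
  | j + 1 => upd j (iterate upd A j)

/-- The memories `M` and `M'` agree outside array `a` and the round counter. -/
abbrev AgreeOff (a : ℕ) (M M' : Memory) : Prop := ∀ b, b ≠ a → b ≠ 6 → M' b = M b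

/-- The hypotheses speak of every memory that agrees with `M` outside array `a` and the counter, so
nothing has to be known about the intermediate memories. With expressions of total cost at most 70,
a round including the loop overhead stays below 100. -/
lemma exec_scatter {a N : ℕ} {bound cond idx v v' : Expr} {M : Memory} (ha : a ≠ 6)
    (upd : ℕ → (ℕ → ℕ) → ℕ → ℕ)
    (hb : ∀ M', AgreeOff a M M' → bound.eval M' = N)
    (hu : ∀ j < N, ∀ M', AgreeOff a M M' → M' 6 0 = j →
      Function.update (M' a) (idx.eval M') (if cond.eval M' ≠ 0 then v.eval M' else v'.eval M') =
        upd j (M' a))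
    (hcost : bound.cost + cond.cost + idx.cost + v.cost + v'.cost ≤ 70) :
    Exec (scatter a bound cond idx v v') M ((N + 1) * 100) fun M' =>
      AgreeOff a M M' ∧ M' a = iterate upd (M a) N := by
  have h := exec_forLoop (c := 6) (N := N) (bound := bound)
    (P := .ite cond (.write a idx v) (.write a idx v')) (M := M)
    (T := cond.cost + idx.cost + v.cost + v'.cost + 2)
    (fun j M' => AgreeOff a M M' ∧ M' a = iterate upd (M a) j)
    ⟨fun b _ hb6 => by simp [Memory.update_eq, hb6], by simp [Memory.update_eq, ha, iterate]⟩
    (fun j _ M' hM' => hb M' hM'.1) ?_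
  · refine h.mono ?_ fun _ h => h
    exact Nat.mul_le_mul_left _ (by omega)
  · rintro j hj M' ⟨h1, h2⟩ h3
    have hu' := hu j hj M' h1 h3
    have hgoal : ∀ x, x = (if cond.eval M' ≠ 0 then v.eval M' else v'.eval M') →
        (M'.update a (idx.eval M') x) 6 0 = j ∧
        AgreeOff a M ((M'.update a (idx.eval M') x).update 6 0 (j + 1)) ∧
        ((M'.update a (idx.eval M') x).update 6 0 (j + 1)) a = iterate upd (M a) (j + 1) := by
      rintro x rfl
      refine ⟨?_, fun b hba hb6 => ?_, ?_⟩
      · simp [Memory.update_eq, ha.symm, h3]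
      · simp [Memory.update_eq, hb6, hba, h1 b hba hb6]
      · rw [iterate, ← h2, ← hu', Memory.update_eq, Memory.update_eq,
          Function.update_of_ne ha, Function.update_self]
    by_cases hc : cond.eval M' = 0
    · exact ⟨_, _, .ite_false hc (.write ..), by omega, hgoal _ (by simp [hc])⟩
    · exact ⟨_, _, .ite_true hc (.write ..), by omega, hgoal _ (by simp [hc])⟩

/-- `A x` is the number of rounds `j < N` with `C j` that are charged to `x`. -/
def IsCount (N : ℕ) (C : ℕ → Prop) (X A : ℕ → ℕ) : Prop :=
  ∀ x, ∃ s : Finset ℕ, (∀ j, j ∈ s ↔ j < N ∧ C j ∧ X j = x) ∧ A x = s.card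

/-- `A` arises from `A₀` by assigning `V j` to position `X j` for the rounds `j < N` with `C j`. -/
def IsAssign (N : ℕ) (C : ℕ → Prop) (X V A₀ A : ℕ → ℕ) : Prop :=
  ∀ x, (∃ j < N, C j ∧ X j = x ∧ A x = V j) ∨ ((∀ j < N, C j → X j ≠ x) ∧ A x = A₀ x)

/-- Count the rounds satisfying `cond` at the position `idx`. -/
def countIf (a : ℕ) (bound cond idx : Expr) : Program :=
  scatter a bound cond idx (.add (.read a idx) (.const 1)) (.read a idx)

lemma exec_countIf {a N : ℕ} {bound cond idx : Expr} {M : Memory} (ha : a ≠ 6)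
    (C : ℕ → Prop) (X : ℕ → ℕ)
    (hb : ∀ M', AgreeOff a M M' → bound.eval M' = N)
    (hu : ∀ j < N, ∀ M', AgreeOff a M M' → M' 6 0 = j →
      (cond.eval M' ≠ 0 ↔ C j) ∧ idx.eval M' = X j)
    (h0 : ∀ x, M a x = 0)
    (hcost : bound.cost + cond.cost + 3 * idx.cost ≤ 60) :
    Exec (countIf a bound cond idx) M ((N + 1) * 100) fun M' =>
      AgreeOff a M M' ∧ IsCount N C X (M' a) := by
  classical
  refine (exec_scatter ha (fun j A => Function.update A (X j)
    (if C j then A (X j) + 1 else A (X j))) hb (fun j hj M' hM' hj' => ?_) ?_).mono le_rfl ?_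
  · obtain ⟨h1, h2⟩ := hu j hj M' hM' hj'
    by_cases hc : C j
    · have := h1.2 hc
      simp [Expr.eval, h2, hc, this]
    · have : cond.eval M' = 0 := by simpa using mt h1.1 hc
      simp [Expr.eval, h2, hc, this]
  · simp only [Expr.cost]; omega
  · rintro M' ⟨h1, h2⟩
    refine ⟨h1, ?_⟩
    rw [h2]
    clear hb hu h2
    induction N with
    | zero => exact fun x => ⟨∅, by simp, by simp [iterate, h0]⟩
    | succ N ih =>
      intro x
      obtain ⟨s, hs, hcard⟩ := ih x
      by_cases hc : C N ∧ X N = x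
      · obtain ⟨hC, rfl⟩ := hc
        refine ⟨insert N s, fun j => ?_, ?_⟩
        · rw [mem_insert, hs]
          constructor
          · rintro (rfl | h)
            exacts [⟨by omega, hC, rfl⟩, ⟨by omega, h.2⟩]
          · rintro ⟨h1, h2⟩
            rcases Nat.lt_succ_iff_lt_or_eq.1 h1 with h | h
            exacts [Or.inr ⟨h, h2⟩, Or.inl h]
        · have : N ∉ s := fun h => absurd ((hs N).1 h).1 (lt_irrefl N)
          rw [card_insert_of_notMem this, ← hcard]
          simp [iterate, hC]
      · refine ⟨s, fun j => ?_, ?_⟩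
        · rw [hs]
          refine ⟨fun h => ⟨by omega, h.2⟩, fun ⟨h1, h2⟩ => ⟨?_, h2⟩⟩
          rcases Nat.lt_succ_iff_lt_or_eq.1 h1 with h | rfl
          exacts [h, (hc h2).elim]
        · rw [← hcard]
          by_cases hX : x = X N
          · have : ¬C N := fun h => hc ⟨h, hX.symm⟩
            simp [iterate, hX, this]
          · simp [iterate, hX]

/-- Assign `v` to the position `idx` in the rounds that satisfy `cond`. -/
def assignIf (a : ℕ) (bound cond idx v : Expr) : Program :=
  scatter a bound cond idx v (.read a idx)

/-- If several rounds write to one position, the last one survives; `IsAssign` leaves this open, as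
any of them is good enough. -/
lemma exec_assignIf {a N : ℕ} {bound cond idx v : Expr} {M : Memory} (ha : a ≠ 6)
    (C : ℕ → Prop) (X V : ℕ → ℕ)
    (hb : ∀ M', AgreeOff a M M' → bound.eval M' = N)
    (hu : ∀ j < N, ∀ M', AgreeOff a M M' → M' 6 0 = j →
      (cond.eval M' ≠ 0 ↔ C j) ∧ idx.eval M' = X j ∧ v.eval M' = V j)
    (hcost : bound.cost + cond.cost + 2 * idx.cost + v.cost ≤ 69) :
    Exec (assignIf a bound cond idx v) M ((N + 1) * 100) fun M' =>
      AgreeOff a M M' ∧ IsAssign N C X V (M a) (M' a) := by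
  classical
  refine (exec_scatter ha (fun j A => Function.update A (X j)
    (if C j then V j else A (X j))) hb (fun j hj M' hM' hj' => ?_) ?_).mono le_rfl ?_
  · obtain ⟨h1, h2, h3⟩ := hu j hj M' hM' hj'
    by_cases hc : C j
    · have := h1.2 hc
      simp [h2, h3, hc, this]
    · have : cond.eval M' = 0 := by simpa using mt h1.1 hc
      simp [Expr.eval, h2, hc, this]
  · simp only [Expr.cost]; omega
  · rintro M' ⟨h1, h2⟩
    refine ⟨h1, ?_⟩
    rw [h2]
    clear hb hu h2
    induction N with
    | zero => exact fun x => Or.inr ⟨by simp, rfl⟩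
    | succ N ih =>
      intro x
      by_cases hc : C N ∧ X N = x
      · obtain ⟨hC, rfl⟩ := hc
        exact Or.inl ⟨N, by omega, hC, rfl, by simp [iterate, hC]⟩
      · have hA : iterate (fun j A => Function.update A (X j) (if C j then V j else A (X j)))
            (M a) (N + 1) x = iterate (fun j A => Function.update A (X j)
              (if C j then V j else A (X j))) (M a) N x := by
          by_cases hX : x = X N
          · have : ¬C N := fun h => hc ⟨h, hX.symm⟩
            simp [iterate, hX, this]
          · simp [iterate, hX]
        rcases ih x with ⟨j, hj, h⟩ | ⟨h, h'⟩
        · exact Or.inl ⟨j, by omega, h.1, h.2.1, hA ▸ h.2.2⟩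
        · refine Or.inr ⟨fun j hj hCj hXj => ?_, hA ▸ h'⟩
          rcases Nat.lt_succ_iff_lt_or_eq.1 hj with hj | rfl
          exacts [h j hj hCj hXj, hc ⟨hCj, hXj⟩]

/-- Since the positions are distinct, nothing is overwritten and all values are known exactly. -/
lemma exec_fill {a N : ℕ} {bound cond idx v v' : Expr} {M : Memory} (ha : a ≠ 6)
    (X V : ℕ → ℕ) (hX : ∀ i < N, ∀ j < N, X i = X j → i = j)
    (hb : ∀ M', AgreeOff a M M' → bound.eval M' = N)
    (hu : ∀ j < N, ∀ M', AgreeOff a M M' → M' 6 0 = j →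
      idx.eval M' = X j ∧ (if cond.eval M' ≠ 0 then v.eval M' else v'.eval M') = V j)
    (hcost : bound.cost + cond.cost + idx.cost + v.cost + v'.cost ≤ 70) :
    Exec (scatter a bound cond idx v v') M ((N + 1) * 100) fun M' =>
      AgreeOff a M M' ∧ (∀ j < N, M' a (X j) = V j) ∧
        ∀ x, (∀ j < N, X j ≠ x) → M' a x = M a x := by
  refine (exec_scatter ha (fun j A => Function.update A (X j) (V j)) hb
    (fun j hj M' hM' hj' => ?_) hcost).mono le_rfl ?_
  · obtain ⟨h1, h2⟩ := hu j hj M' hM' hj'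
    rw [h1, h2]
  · rintro M' ⟨h1, h2⟩
    refine ⟨h1, ?_⟩
    rw [h2]
    clear hb hu h2
    induction N with
    | zero => exact ⟨by simp, fun x _ => rfl⟩
    | succ N ih =>
      obtain ⟨h3, h4⟩ := ih fun i hi j hj => hX i (by omega) j (by omega)
      refine ⟨fun j hj => ?_, fun x hx => ?_⟩
      · by_cases hjN : j = N
        · subst hjN; simp [iterate]
        · have : X j ≠ X N := fun h => hjN (hX j hj N (by omega) h)
          simp only [iterate, Function.update_of_ne this]
          exact h3 j (by omega)
      · have : x ≠ X N := fun h => hx N (by omega) h.symm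
        simp only [iterate, Function.update_of_ne this]
        exact h4 x fun j hj => hx j (by omega)

/-! ### Computing the blue components -/

/-- The current round. -/
def roundE : Expr := .read 6 (.const 0)

/-- The number of vertices. -/
def nE : Expr := .read 0 (.const 0)

/-- The number of edges. -/
def mE : Expr := .read 0 (.const 1)

/-- The distance of two numbers. -/
def distE (e f : Expr) : Expr := .add (.sub e f) (.sub f e)

lemma distE_eval (e f : Expr) (M : Memory) : (distE e f).eval M = 0 ↔ e.eval M = f.eval M := by
  simp only [distE, Expr.eval]
  omega

lemma input_n (I : C2CInstance) : I.input 0 0 = I.n := rfl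

lemma input_m (I : C2CInstance) : I.input 0 1 = I.m := rfl

lemma arrayOf_fin {m : ℕ} (g : Fin m → ℕ) (e : Fin m) : arrayOf g e = g e := by
  simp [arrayOf]

lemma input_ini_fst (I : C2CInstance) (e : Fin I.m) : I.input 1 e = (I.ini e).1 :=
  arrayOf_fin (fun e => ((I.ini e).1 : ℕ)) e

lemma input_ini_snd (I : C2CInstance) (e : Fin I.m) : I.input 2 e = (I.ini e).2 :=
  arrayOf_fin (fun e => ((I.ini e).2 : ℕ)) e

lemma input_tar_fst (I : C2CInstance) (e : Fin I.m) : I.input 3 e = (I.tar e).1 :=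
  arrayOf_fin (fun e => ((I.tar e).1 : ℕ)) e

lemma input_tar_snd (I : C2CInstance) (e : Fin I.m) : I.input 4 e = (I.tar e).2 :=
  arrayOf_fin (fun e => ((I.tar e).2 : ℕ)) e

lemma input_weight (I : C2CInstance) (e : Fin I.m) : I.input 5 e = (I.G.color e).weight :=
  arrayOf_fin (fun e => (I.G.color e).weight) e

lemma input_of_six_le (I : C2CInstance) {b : ℕ} (hb : 6 ≤ b) (x : ℕ) : I.input b x = 0 := by
  obtain ⟨c, rfl⟩ := Nat.exists_eq_add_of_le' hb
  rfl

/-- Merge the components of the ends of a blue edge, one edge after the other. -/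
def componentsProgram : Program :=
  .seq (scatter 10 nE (.const 1) roundE roundE (.const 0))
    (forLoop 9 mE (.ite (.sub (.read 5 (.read 9 (.const 0))) (.const 1))
      (.seq (.write 7 (.const 0) (.read 10 (.read 1 (.read 9 (.const 0)))))
        (.seq (.write 8 (.const 0) (.read 10 (.read 2 (.read 9 (.const 0)))))
          (scatter 10 nE (distE (.read 10 roundE) (.read 7 (.const 0))) roundE
            (.read 10 roundE) (.read 8 (.const 0)))))
      .skip))

/-- Cells in which the memory still is the input, after the components have been computed. -/
def ScratchFree (I : C2CInstance) (M : Memory) : Prop :=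
  ∀ b, b < 6 ∨ 10 < b → M b = I.input b

/-- An additional edge between `s` and `t` merges just their two classes, which is what giving the
label of `t` to the class of `s` does. -/
lemma relabel_eq_iff {V : Type} {R R' : V → V → Prop} {C C' : V → ℕ} {s t : V}
    (hC : ∀ u v, C u = C v ↔ ReflTransGen R u v)
    (hC' : ∀ v, C' v = if C v = C s then C t else C v)
    (hR' : ∀ u v, R' u v ↔ R u v ∨ (u = s ∧ v = t) ∨ (u = t ∧ v = s)) (u v : V) :
    C' u = C' v ↔ ReflTransGen R' u v := by
  have hmono : ∀ {u v}, C u = C v → ReflTransGen R' u v := fun h =>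
    ReflTransGen.mono (fun a b hab => (hR' a b).2 (Or.inl hab)) _ _ ((hC _ _).1 h)
  have hst : R' s t := (hR' s t).2 (Or.inr (Or.inl ⟨rfl, rfl⟩))
  have hts : R' t s := (hR' t s).2 (Or.inr (Or.inr ⟨rfl, rfl⟩))
  constructor
  · intro h
    rw [hC', hC'] at h
    split_ifs at h with h1 h2 h2
    · exact hmono (h1.trans h2.symm)
    · exact ((hmono h1).tail hst).trans (hmono h)
    · exact ((hmono h).tail hts).trans (hmono h2.symm)
    · exact hmono h
  · intro h
    induction h with
    | refl => rfl
    | @tail x y _ hxy ih =>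
      rw [ih]
      have hs : C' s = C t := by rw [hC', if_pos rfl]
      have ht : C' t = C t := by rw [hC']; split_ifs <;> rfl
      rcases (hR' x y).1 hxy with h1 | ⟨rfl, rfl⟩ | ⟨rfl, rfl⟩
      · rw [hC', hC', (hC x y).2 (.single h1)]
      · rw [hs, ht]
      · rw [hs, ht]

lemma exec_components (I : C2CInstance) :
    Exec componentsProgram I.input ((I.n + 1) * 100 + (I.m + 1) * ((I.n + 1) * 100 + 100))
      fun M => ScratchFree I M ∧ ∀ u v : Fin I.n, M 10 u = M 10 v ↔
        ReflTransGen (I.G.AdjIn {e | I.G.color e = Color.blue}) u v := by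
  have hn : ∀ {M M'}, ScratchFree I M → AgreeOff 10 M M' → nE.eval M' = I.n := by
    intro M M' h1 h2
    simp only [nE, Expr.eval]
    rw [h2 0 (by norm_num) (by norm_num), h1 0 (by norm_num), input_n]
  refine Exec.seq (Q := fun M => ScratchFree I M ∧ ∀ v : Fin I.n, M 10 v = v)
    ((exec_fill (N := I.n) (by norm_num) id id (fun _ _ _ _ h => h)
      (fun M' h => hn (fun _ _ => rfl) h) (fun j _ M' _ hj => by simp [roundE, Expr.eval, hj])
      (by decide)).mono le_rfl ?_) ?_
  · rintro M ⟨h1, h2, -⟩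
    refine ⟨fun b hb => h1 b (by omega) (by omega), fun v => h2 v v.2⟩
  · rintro M ⟨hM1, hM2⟩
    refine (exec_forLoop (N := I.m) (T := (I.n + 1) * 100 + 50)
      (fun j M => ScratchFree I M ∧ ∀ u v : Fin I.n, M 10 u = M 10 v ↔
        ReflTransGen (I.G.AdjIn {e | I.G.color e = Color.blue ∧ e.val < j}) u v)
      ⟨?_, ?_⟩ ?_ ?_).mono ?_ ?_
    · intro b hb
      have : b ≠ 9 := by omega
      rw [Memory.update_eq, Function.update_of_ne this, hM1 b hb]
    · intro u v
      rw [Memory.update_eq, Function.update_of_ne (by norm_num), hM2, hM2, ← Fin.ext_iff]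
      constructor
      · rintro rfl; exact .refl
      · intro h
        induction h with
        | refl => rfl
        | tail _ h _ =>
          obtain ⟨e, he, -⟩ := h
          exact absurd he.2 (Nat.not_lt_zero _)
    · intro j _ M hM
      simp only [mE, Expr.eval]
      rw [hM.1 0 (by norm_num), input_m]
    · rintro j hj M ⟨hS, hC⟩ hMj
      have hw := input_weight I ⟨j, hj⟩
      have ht := input_ini_fst I ⟨j, hj⟩
      have hh := input_ini_snd I ⟨j, hj⟩
      simp only at hw ht hh
      have hcost : (Expr.sub (.read 5 (.read 9 (.const 0))) (.const 1)).cost = 5 := rfl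
      refine (exec_ite (T := (I.n + 1) * 100 + 30) (fun hc => ?_) (fun hc => ?_)).mono
        (by rw [hcost]; omega) fun _ h => h
      · have hblue : I.G.color ⟨j, hj⟩ = Color.blue := by
          simp only [Expr.eval, hMj, hS 5 (by norm_num), hw] at hc
          cases hcol : I.G.color ⟨j, hj⟩ with
          | red => simp [hcol, Color.weight] at hc
          | blue => rfl
        set s := (I.ini ⟨j, hj⟩).1 with hs
        set t := (I.ini ⟨j, hj⟩).2 with ht'
        -- Both labels are copied first, because the label of `s` itself may be overwritten during
        -- the sweep.
        refine (Exec.seq (T := 15) (T' := 15 + (I.n + 1) * 100) (exec_write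
          (Q := fun M' => (∀ b, b ≠ 7 → M' b = M b) ∧ M' 7 0 = M 10 s) (by decide) ?_) ?_).mono
          (by omega) fun _ h => h
        · simp +contextual [Memory.update_eq, Expr.eval, hMj, hS 1 (by norm_num), ht]
        · rintro M₁ ⟨hM₁, hM₁'⟩
          refine Exec.seq (exec_write (Q := fun M' => (∀ b, b ≠ 7 → b ≠ 8 → M' b = M b) ∧
            M' 7 0 = M 10 s ∧ M' 8 0 = M 10 t) (by decide) ?_) ?_
          · simp +contextual [Memory.update_eq, Expr.eval, hMj, hM₁, hM₁', hS 2 (by norm_num), hh]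
          · rintro M₂ ⟨hM₂, hM₂', hM₂''⟩
            have hS₂ : ScratchFree I M₂ := fun b hb => by
              rw [hM₂ b (by omega) (by omega), hS b hb]
            refine (exec_scatter (N := I.n) (by norm_num) (fun j A => Function.update A j
              (if A j = M 10 s then M 10 t else A j)) (fun M' h => hn hS₂ h) ?_
              (by decide)).mono le_rfl ?_
            · intro i _ M' hM' hi
              have h7 := hM' 7 (by norm_num) (by norm_num)
              have h8 := hM' 8 (by norm_num) (by norm_num)
              by_cases heq : M' 10 i = M 10 s
              · have := (distE_eval (.read 10 roundE) (.read 7 (.const 0)) M').2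
                  (by simp [Expr.eval, roundE, hi, h7, hM₂', heq])
                rw [if_neg (not_not.2 this)]
                simp [Expr.eval, roundE, hi, h8, hM₂'', heq]
              · have := mt (distE_eval (.read 10 roundE) (.read 7 (.const 0)) M').1
                  (by simp [Expr.eval, roundE, hi, h7, hM₂', heq])
                rw [if_pos this]
                simp [Expr.eval, roundE, hi, heq]
            · rintro M' ⟨h1, h2⟩
              have hM'' : ∀ b, b ≠ 6 → b ≠ 7 → b ≠ 8 → b ≠ 10 → M' b = M b := fun b h6 h7 h8 h10 => by
                rw [h1 b h10 h6, hM₂ b h7 h8]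
              refine ⟨by rw [hM'' 9 (by norm_num) (by norm_num) (by norm_num) (by norm_num), hMj],
                ?_, ?_⟩
              · intro b hb
                have : b ≠ 9 := by omega
                rw [Memory.update_eq, Function.update_of_ne this,
                  hM'' b (by omega) (by omega) (by omega) (by omega), hS b hb]
              · rw [Memory.update_eq, Function.update_of_ne (by norm_num)]
                -- A round reads and writes only its own position, so the sweep acts pointwise.
                have hiter : ∀ N (x : ℕ), iterate (fun j A => Function.update A j
                    (if A j = M 10 s then M 10 t else A j)) (M 10) N x =
                    if x < N ∧ M 10 x = M 10 s then M 10 t else M 10 x := by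
                  intro N
                  induction N with
                  | zero => intro x; simp [iterate]
                  | succ N ih =>
                    intro x
                    by_cases hx : x = N
                    · subst hx
                      simp [iterate, ih]
                    · have : x < N + 1 ↔ x < N := by omega
                      simp only [iterate, Function.update_of_ne hx, ih, this]
                rw [hM₂ 10 (by norm_num) (by norm_num)] at h2
                refine relabel_eq_iff (s := s) (t := t) (C := fun v : Fin I.n => M 10 v)
                  (C' := fun v : Fin I.n => M' 10 v) hC (fun v => ?_) (fun u v => ?_)
                · rw [h2, hiter]
                  simp
                · have hends : I.G.ends ⟨j, hj⟩ = s(s, t) := (I.ini_ends _).symm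
                  constructor
                  · rintro ⟨e, ⟨he1, he2⟩, he3⟩
                    by_cases hej : e.val = j
                    · right
                      have : e = ⟨j, hj⟩ := Fin.ext hej
                      subst this
                      rw [hends, Sym2.eq_iff] at he3
                      rcases he3 with h | h
                      · exact Or.inl ⟨h.1.symm, h.2.symm⟩
                      · exact Or.inr ⟨h.2.symm, h.1.symm⟩
                    · exact Or.inl ⟨e, ⟨he1, by omega⟩, he3⟩
                  · rintro (⟨e, ⟨he1, he2⟩, he3⟩ | ⟨rfl, rfl⟩ | ⟨rfl, rfl⟩)
                    · exact ⟨e, ⟨he1, by omega⟩, he3⟩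
                    · exact ⟨⟨j, hj⟩, ⟨hblue, by simp⟩, hends⟩
                    · exact ⟨⟨j, hj⟩, ⟨hblue, by simp⟩, hends.trans Sym2.eq_swap⟩
      · have hred : I.G.color ⟨j, hj⟩ ≠ Color.blue := by
          intro hblue
          simp [Expr.eval, hMj, hS 5 (by norm_num), hw, hblue, Color.weight] at hc
        refine ⟨M, 1, .skip M, by omega, hMj, fun b hb => ?_, fun u v => ?_⟩
        · have : b ≠ 9 := by omega
          rw [Memory.update_eq, Function.update_of_ne this, hS b hb]
        · rw [Memory.update_eq, Function.update_of_ne (by norm_num), hC]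
          have : {e : Fin I.m | I.G.color e = Color.blue ∧ e.val < j} =
              {e : Fin I.m | I.G.color e = Color.blue ∧ e.val < j + 1} := by
            ext e
            refine ⟨fun h => ⟨h.1, by have := h.2; omega⟩, fun h => ⟨h.1, ?_⟩⟩
            rcases Nat.lt_succ_iff_lt_or_eq.1 h.2 with h' | h'
            · exact h'
            · have : e = ⟨j, hj⟩ := Fin.ext h'
              subst this
              exact (hred h.1).elim
          rw [this]
    · refine Nat.mul_le_mul_left _ ?_
      have : mE.cost = 2 := rfl
      omega
    · rintro M ⟨h1, h2⟩
      refine ⟨h1, fun u v => ?_⟩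
      rw [h2]
      have : {e : Fin I.m | I.G.color e = Color.blue ∧ e.val < I.m} =
          {e : Fin I.m | I.G.color e = Color.blue} := by
        ext e
        exact ⟨fun h => h.1, fun h => ⟨h, e.2⟩⟩
      rw [this]

/-! ### Computing the data of the kernel -/

/-- The number of weights less than two among the first `j` ones. -/
def redCount (W : ℕ → ℕ) : ℕ → ℕ
  | 0 => 0
  | j + 1 => redCount W j + (2 - W j)

/-- The number of red edges. -/
def kE : Expr := .read 11 mE

/-- The number of slots. -/
def slotsE : Expr := .add kE kE

/-- The current edge is red. -/
def redE : Expr := .sub (.const 2) (.read 5 roundE)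

/-- The current edge is blue. -/
def blueE : Expr := .sub (.read 5 roundE) (.const 1)

/-- List the red edges and the vertices of the slots. -/
def slotsProgram : Program :=
  .seq (scatter 11 mE (.const 1) (.add roundE (.const 1)) (.add (.read 11 roundE) redE) (.const 0)) <|
  .seq (assignIf 12 mE redE (.read 11 roundE) roundE) <|
  .seq (scatter 13 kE (.const 1) roundE (.read 1 (.read 12 roundE)) (.const 0))
    (scatter 13 kE (.const 1) (.add kE roundE) (.read 2 (.read 12 roundE)) (.const 0))

/-- The memory after `slotsProgram`. -/
structure HasSlots (I : C2CInstance) (C : ℕ → ℕ) (M : Memory) : Prop where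
  input : ∀ b < 6, M b = I.input b
  zero : ∀ b, 13 < b → ∀ x, M b x = 0
  comp : M 10 = C
  rank : M 11 I.m = redCount (I.input 5) I.m
  list : IsAssign I.m (fun j => I.input 5 j < 2) (redCount (I.input 5)) id (fun _ => 0) (M 12)
  tails : ∀ j < redCount (I.input 5) I.m, M 13 j = I.input 1 (M 12 j)
  heads : ∀ j < redCount (I.input 5) I.m, M 13 (redCount (I.input 5) I.m + j) = I.input 2 (M 12 j)

/-- Array 11 holds at position `j` the number of red edges before `j`; its cell 0 is zero from the
start. The `j`-th red edge gives slots `j` and `k + j` to its initial tail and head. -/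
lemma exec_slots {I : C2CInstance} {M : Memory} (hM : ScratchFree I M)
    (hk : redCount (I.input 5) I.m ≤ I.m) :
    Exec slotsProgram M ((I.m + 1) * 400) (HasSlots I (M 10)) := by
  have e0 := hM 0 (by norm_num)
  have e1 := hM 1 (by norm_num)
  have e2 := hM 2 (by norm_num)
  have e5 := hM 5 (by norm_num)
  set W := I.input 5 with hW
  have hiter : ∀ (A : ℕ → ℕ) (N j : ℕ), A 0 = 0 → j ≤ N → iterate (fun j A => Function.update A (j + 1)
      (A j + (2 - W j))) A N j = redCount W j := by
    intro A N
    induction N with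
    | zero =>
      rintro j hA hj
      obtain rfl : j = 0 := by omega
      simp [iterate, redCount, hA]
    | succ N ih =>
      intro j hA hj
      by_cases hjN : j = N + 1
      · subst hjN
        simp [iterate, redCount, ih N hA le_rfl]
      · simp only [iterate, Function.update_of_ne hjN]
        exact ih j hA (by omega)
  obtain ⟨M₁, t₁, r₁, b₁, a₁, f₁⟩ := exec_scatter (a := 11) (N := I.m) (M := M) (bound := mE)
    (cond := .const 1) (idx := .add roundE (.const 1)) (v := .add (.read 11 roundE) redE)
    (v' := .const 0) (by norm_num)
    (fun j A => Function.update A (j + 1) (A j + (2 - W j)))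
    (fun M' h => by simp [mE, Expr.eval, h, e0, input_m])
    (fun j hj M' h hj' => by simp [Expr.eval, redE, roundE, hj', h, e5]) (by decide)
  have hrank : ∀ j ≤ I.m, M₁ 11 j = redCount W j := fun j hj => by
    rw [f₁, hiter _ _ _ (by rw [hM 11 (by norm_num), input_of_six_le I (by norm_num)]) hj]
  obtain ⟨M₂, t₂, r₂, b₂, a₂, f₂⟩ := exec_assignIf (a := 12) (N := I.m) (M := M₁) (bound := mE)
    (cond := redE) (idx := .read 11 roundE) (v := roundE) (by norm_num) (fun j => W j < 2)
    (redCount W) id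
    (fun M' h => by simp [mE, Expr.eval, h, a₁, e0, input_m])
    (fun j hj M' h hj' => by
      simp [Expr.eval, redE, roundE, hj', h, a₁, e5, hrank j hj.le]
      omega) (by decide)
  have hkE : ∀ {M'}, AgreeOff 13 M₂ M' → kE.eval M' = redCount W I.m := fun h => by
    simp [kE, mE, Expr.eval, h, a₂, a₁, e0, input_m, hrank]
  obtain ⟨M₃, t₃, r₃, b₃, a₃, f₃, -⟩ := exec_fill (a := 13) (N := redCount W I.m) (M := M₂)
    (bound := kE) (cond := .const 1) (idx := roundE) (v := .read 1 (.read 12 roundE))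
    (v' := .const 0) (by norm_num) id (fun j => I.input 1 (M₂ 12 j)) (fun _ _ _ _ h => h)
    (fun M' h => hkE h)
    (fun j hj M' h hj' => by simp [Expr.eval, roundE, hj', h, a₂, a₁, e1]) (by decide)
  have hkE' : ∀ {M'}, AgreeOff 13 M₃ M' → kE.eval M' = redCount W I.m := fun h => by
    simp [kE, mE, Expr.eval, h, a₃, a₂, a₁, e0, input_m, hrank]
  obtain ⟨M₄, t₄, r₄, b₄, a₄, f₄, g₄⟩ := exec_fill (a := 13) (N := redCount W I.m) (M := M₃)
    (bound := kE) (cond := .const 1) (idx := .add kE roundE) (v := .read 2 (.read 12 roundE))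
    (v' := .const 0) (by norm_num) (fun j => redCount W I.m + j) (fun j => I.input 2 (M₂ 12 j))
    (fun _ _ _ _ h => by simpa using h)
    (fun M' h => hkE' h)
    (fun j hj M' h hj' => by
      refine ⟨?_, by simp [Expr.eval, roundE, hj', h, a₃, a₂, a₁, e2]⟩
      have := hkE' h
      simp only [Expr.eval, this, roundE, hj']) (by decide)
  refine ⟨M₄, _, r₁.seq (r₂.seq (r₃.seq r₄)), ?_, ?_⟩
  · have : (redCount W I.m + 1) * 100 ≤ (I.m + 1) * 100 := Nat.mul_le_mul_right _ (by omega)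
    omega
  · have hoff : ∀ b, b ≠ 6 → b ≠ 11 → b ≠ 12 → b ≠ 13 → M₄ b = M b := fun b h1 h2 h3 h4 => by
      rw [a₄ b h4 h1, a₃ b h4 h1, a₂ b h3 h1, a₁ b h2 h1]
    have h12 : M₄ 12 = M₂ 12 := by
      rw [a₄ 12 (by norm_num) (by norm_num), a₃ 12 (by norm_num) (by norm_num)]
    have h11 : M₄ 11 = M₁ 11 := by
      rw [a₄ 11 (by norm_num) (by norm_num), a₃ 11 (by norm_num) (by norm_num),
        a₂ 11 (by norm_num) (by norm_num)]
    refine ⟨fun b hb => ?_, fun b hb x => ?_, ?_, ?_, ?_, fun j hj => ?_, fun j hj => ?_⟩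
    · rw [hoff b (by omega) (by omega) (by omega) (by omega), hM b (by omega)]
    · rw [hoff b (by omega) (by omega) (by omega) (by omega), hM b (by omega),
        input_of_six_le I (by omega)]
    · exact hoff 10 (by norm_num) (by norm_num) (by norm_num) (by norm_num)
    · rw [h11, hrank _ le_rfl]
    · rw [h12]
      have : M₁ 12 = fun _ => 0 := by
        funext x
        rw [a₁ 12 (by norm_num) (by norm_num), hM 12 (by norm_num),
          input_of_six_le I (by norm_num)]
      rwa [this] at f₂
    · rw [g₄ j (fun i _ => (show redCount (I.input 5) I.m + i ≠ j by omega)), h12]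
      exact f₃ j hj
    · rw [h12]
      exact f₄ j hj

/-- The label of the component of the current vertex. -/
def compE : Expr := .read 10 roundE

/-- Compute the representatives of vertices and components, the degrees, the sizes of the
components and the differences between the two orientations. -/
def dataProgram : Program :=
  .seq (assignIf 14 slotsE (.const 1) (.read 13 roundE) roundE) <|
  .seq (assignIf 15 slotsE (.const 1) (.read 10 (.read 13 roundE)) (.add roundE (.const 1))) <|
  .seq (countIf 16 mE redE (.read 2 roundE)) <|
  .seq (countIf 17 mE redE (.read 4 roundE)) <|
  .seq (countIf 18 nE (.const 1) compE) <|
  .seq (countIf 19 mE blueE (.read 10 (.read 2 roundE))) <|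
  .seq (assignIf 20 mE blueE (.read 2 roundE) (.read 1 roundE)) <|
  .seq (assignIf 21 mE blueE (.read 4 roundE) (.read 3 roundE)) <|
  .seq (assignIf 22 nE (distE (.read 20 roundE) (.read 21 roundE)) compE (.const 1))
    (assignIf 23 nE (.sub (.read 22 compE) (.add (distE (.read 19 compE) (.read 18 compE))
      (.read 15 compE))) (.const 0) (.const 1))

/-- The memory after `dataProgram`. -/
structure HasData (I : C2CInstance) (C : ℕ → ℕ) (M : Memory) : Prop where
  input : ∀ b < 6, M b = I.input b
  zero : ∀ b, 23 < b → ∀ x, M b x = 0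
  comp : M 10 = C
  rank : M 11 I.m = redCount (I.input 5) I.m
  list : IsAssign I.m (fun j => I.input 5 j < 2) (redCount (I.input 5)) id (fun _ => 0) (M 12)
  tails : ∀ j < redCount (I.input 5) I.m, M 13 j = I.input 1 (M 12 j)
  heads : ∀ j < redCount (I.input 5) I.m, M 13 (redCount (I.input 5) I.m + j) = I.input 2 (M 12 j)
  slot : IsAssign (redCount (I.input 5) I.m + redCount (I.input 5) I.m) (fun _ => True) (M 13) id
    (fun _ => 0) (M 14)
  root : IsAssign (redCount (I.input 5) I.m + redCount (I.input 5) I.m) (fun _ => True)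
    (fun j => C (M 13 j)) (fun j => j + 1) (fun _ => 0) (M 15)
  iniDeg : IsCount I.m (fun j => I.input 5 j < 2) (I.input 2) (M 16)
  tarDeg : IsCount I.m (fun j => I.input 5 j < 2) (I.input 4) (M 17)
  vCount : IsCount I.n (fun _ => True) C (M 18)
  eCount : IsCount I.m (fun j => 1 < I.input 5 j) (fun j => C (I.input 2 j)) (M 19)
  iniPred : IsAssign I.m (fun j => 1 < I.input 5 j) (I.input 2) (I.input 1) (fun _ => 0) (M 20)
  tarPred : IsAssign I.m (fun j => 1 < I.input 5 j) (I.input 4) (I.input 3) (fun _ => 0) (M 21)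
  diff : IsAssign I.n (fun v => M 20 v ≠ M 21 v) C (fun _ => 1) (fun _ => 0) (M 22)
  bad : IsAssign I.n (fun v => M 22 (C v) = 1 ∧ M 19 (C v) = M 18 (C v) ∧ M 15 (C v) = 0)
    (fun _ => 0) (fun _ => 1) (fun _ => 0) (M 23)

lemma IsAssign.le_one {N : ℕ} {P : ℕ → Prop} {X A : ℕ → ℕ}
    (h : IsAssign N P X (fun _ => 1) (fun _ => 0) A) (x : ℕ) : A x ≤ 1 := by
  rcases h x with ⟨j, -, -, -, h⟩ | ⟨-, h⟩ <;> rw [h]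
  exact Nat.zero_le 1

/-- Each sweep fills an array of its own, so earlier results persist. The arrays above 13 start with
zeros, the default value in the specification. -/
lemma exec_data {I : C2CInstance} {C : ℕ → ℕ} {M : Memory} (hM : HasSlots I C M)
    (hk : redCount (I.input 5) I.m ≤ I.m) :
    Exec dataProgram M ((I.n + 1 + (I.m + 1)) * 2000) (HasData I C) := by
  have e0 := hM.input 0 (by norm_num)
  have e1 := hM.input 1 (by norm_num)
  have e2 := hM.input 2 (by norm_num)
  have e3 := hM.input 3 (by norm_num)
  have e4 := hM.input 4 (by norm_num)
  have e5 := hM.input 5 (by norm_num)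
  have ec := hM.comp
  have er := hM.rank
  have hz : ∀ b, 13 < b → M b = fun _ => 0 := fun b hb => funext (hM.zero b hb)
  set W := I.input 5 with hW
  set k := redCount W I.m with hkdef
  obtain ⟨M₁, t₁, r₁, b₁, a₁, f₁⟩ := exec_assignIf (a := 14) (N := k + k) (M := M)
    (bound := slotsE) (cond := .const 1) (idx := .read 13 roundE) (v := roundE) (by norm_num)
    (fun _ => True) (M 13) id
    (fun M' h => by simp [slotsE, kE, mE, Expr.eval, h, e0, input_m, er])
    (fun j hj M' h hj' => by simp [Expr.eval, roundE, hj', h]) (by decide)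
  rw [hz 14 (by norm_num)] at f₁
  obtain ⟨M₂, t₂, r₂, b₂, a₂, f₂⟩ := exec_assignIf (a := 15) (N := k + k) (M := M₁)
    (bound := slotsE) (cond := .const 1) (idx := .read 10 (.read 13 roundE))
    (v := .add roundE (.const 1)) (by norm_num)
    (fun _ => True) (fun j => C (M 13 j)) (fun j => j + 1)
    (fun M' h => by simp [slotsE, kE, mE, Expr.eval, h, a₁, e0, input_m, er])
    (fun j hj M' h hj' => by simp [Expr.eval, roundE, hj', h, a₁, ec]) (by decide)
  rw [a₁ 15 (by norm_num) (by norm_num), hz 15 (by norm_num)] at f₂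
  obtain ⟨M₃, t₃, r₃, b₃, a₃, f₃⟩ := exec_countIf (a := 16) (N := I.m) (M := M₂)
    (bound := mE) (cond := redE) (idx := .read 2 roundE) (by norm_num)
    (fun j => W j < 2) (I.input 2)
    (fun M' h => by simp [mE, Expr.eval, h, a₁, a₂, e0, input_m])
    (fun j hj M' h hj' => by
      simp [Expr.eval, redE, roundE, hj', h, a₁, a₂, e5, e2]; omega)
    (fun x => by simp [a₁, a₂, hz]) (by decide)
  obtain ⟨M₄, t₄, r₄, b₄, a₄, f₄⟩ := exec_countIf (a := 17) (N := I.m) (M := M₃)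
    (bound := mE) (cond := redE) (idx := .read 4 roundE) (by norm_num)
    (fun j => W j < 2) (I.input 4)
    (fun M' h => by simp [mE, Expr.eval, h, a₁, a₂, a₃, e0, input_m])
    (fun j hj M' h hj' => by
      simp [Expr.eval, redE, roundE, hj', h, a₁, a₂, a₃, e5, e4]; omega)
    (fun x => by simp [a₁, a₂, a₃, hz]) (by decide)
  obtain ⟨M₅, t₅, r₅, b₅, a₅, f₅⟩ := exec_countIf (a := 18) (N := I.n) (M := M₄)
    (bound := nE) (cond := .const 1) (idx := compE) (by norm_num)
    (fun _ => True) C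
    (fun M' h => by simp [nE, Expr.eval, h, a₁, a₂, a₃, a₄, e0, input_n])
    (fun j hj M' h hj' => by
      simp [Expr.eval, compE, roundE, hj', h, a₁, a₂, a₃, a₄, ec])
    (fun x => by simp [a₁, a₂, a₃, a₄, hz]) (by decide)
  obtain ⟨M₆, t₆, r₆, b₆, a₆, f₆⟩ := exec_countIf (a := 19) (N := I.m) (M := M₅)
    (bound := mE) (cond := blueE) (idx := .read 10 (.read 2 roundE)) (by norm_num)
    (fun j => 1 < W j) (fun j => C (I.input 2 j))
    (fun M' h => by simp [mE, Expr.eval, h, a₁, a₂, a₃, a₄, a₅, e0, input_m])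
    (fun j hj M' h hj' => by
      simp [Expr.eval, blueE, roundE, hj', h, a₁, a₂, a₃, a₄, a₅, e5, e2, ec]; omega)
    (fun x => by simp [a₁, a₂, a₃, a₄, a₅, hz]) (by decide)
  obtain ⟨M₇, t₇, r₇, b₇, a₇, f₇⟩ := exec_assignIf (a := 20) (N := I.m) (M := M₆)
    (bound := mE) (cond := blueE) (idx := .read 2 roundE) (v := .read 1 roundE) (by norm_num)
    (fun j => 1 < W j) (I.input 2) (I.input 1)
    (fun M' h => by simp [mE, Expr.eval, h, a₁, a₂, a₃, a₄, a₅, a₆, e0, input_m])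
    (fun j hj M' h hj' => by
      simp [Expr.eval, blueE, roundE, hj', h, a₁, a₂, a₃, a₄, a₅, a₆, e5, e2, e1]; omega)
    (by decide)
  obtain ⟨M₈, t₈, r₈, b₈, a₈, f₈⟩ := exec_assignIf (a := 21) (N := I.m) (M := M₇)
    (bound := mE) (cond := blueE) (idx := .read 4 roundE) (v := .read 3 roundE) (by norm_num)
    (fun j => 1 < W j) (I.input 4) (I.input 3)
    (fun M' h => by simp [mE, Expr.eval, h, a₁, a₂, a₃, a₄, a₅, a₆, a₇, e0, input_m])
    (fun j hj M' h hj' => by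
      simp [Expr.eval, blueE, roundE, hj', h, a₁, a₂, a₃, a₄, a₅, a₆, a₇, e5, e4, e3]; omega)
    (by decide)
  have hdist : ∀ x y : ℕ, x - y + (y - x) = 0 ↔ x = y := by omega
  obtain ⟨M₉, t₉, r₉, b₉, a₉, f₉⟩ := exec_assignIf (a := 22) (N := I.n) (M := M₈)
    (bound := nE) (cond := distE (.read 20 roundE) (.read 21 roundE)) (idx := compE)
    (v := .const 1) (by norm_num) (fun v => M₈ 20 v ≠ M₈ 21 v) C (fun _ => 1)
    (fun M' h => by simp [nE, Expr.eval, h, a₁, a₂, a₃, a₄, a₅, a₆, a₇, a₈, e0, input_n])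
    (fun j hj M' h hj' => by
      refine ⟨?_, by simp [Expr.eval, compE, roundE, hj', h, a₁, a₂, a₃, a₄, a₅, a₆, a₇, a₈, ec],
        rfl⟩
      rw [ne_eq, distE_eval]
      simp only [Expr.eval, roundE, hj', h 20 (by norm_num) (by norm_num),
        h 21 (by norm_num) (by norm_num), ne_eq]) (by decide)
  rw [show M₈ 22 = fun _ => 0 by simp [a₁, a₂, a₃, a₄, a₅, a₆, a₇, a₈, hz]] at f₉
  obtain ⟨M', t', r', b', a', f'⟩ := exec_assignIf (a := 23) (N := I.n) (M := M₉)
    (bound := nE) (cond := .sub (.read 22 compE) (.add (distE (.read 19 compE) (.read 18 compE))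
      (.read 15 compE))) (idx := .const 0)
    (v := .const 1) (by norm_num)
    (fun v => M₉ 22 (C v) = 1 ∧ M₉ 19 (C v) = M₉ 18 (C v) ∧ M₉ 15 (C v) = 0)
    (fun _ => 0) (fun _ => 1)
    (fun M' h => by simp [nE, Expr.eval, h, a₁, a₂, a₃, a₄, a₅, a₆, a₇, a₈, a₉, e0, input_n])
    (fun j hj M' h hj' => by
      refine ⟨?_, rfl, rfl⟩
      have hc : compE.eval M' = C j := by
        simp [Expr.eval, compE, roundE, hj', h, a₁, a₂, a₃, a₄, a₅, a₆, a₇, a₈, a₉, ec]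
      -- As the entry of array 22 is at most one, the truncated difference is nonzero only if the
      -- entry is one, the counts agree and no slot is recorded.
      have h1 := f₉.le_one (C j)
      simp only [Expr.eval, distE, hc, h 22 (by norm_num) (by norm_num),
        h 19 (by norm_num) (by norm_num), h 18 (by norm_num) (by norm_num),
        h 15 (by norm_num) (by norm_num)]
      omega) (by decide)
  rw [show M₉ 23 = fun _ => 0 by simp [a₁, a₂, a₃, a₄, a₅, a₆, a₇, a₈, a₉, hz]] at f'
  refine ⟨M', _, r₁.seq (r₂.seq (r₃.seq (r₄.seq (r₅.seq (r₆.seq (r₇.seq (r₈.seq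
    (r₉.seq r')))))))), ?_, ?_⟩
  · have : (k + k + 1) * 100 ≤ (I.m + I.m + 2) * 100 := Nat.mul_le_mul_right _ (by omega)
    omega
  · have hlow : ∀ b, b ≠ 6 → b < 14 ∨ 23 < b → M' b = M b := fun b h1 h2 => by
      rw [a' b (by omega) h1, a₉ b (by omega) h1, a₈ b (by omega) h1, a₇ b (by omega) h1,
        a₆ b (by omega) h1, a₅ b (by omega) h1, a₄ b (by omega) h1, a₃ b (by omega) h1,
        a₂ b (by omega) h1, a₁ b (by omega) h1]
    have h12 := hlow 12 (by norm_num) (by norm_num)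
    have h13 := hlow 13 (by norm_num) (by norm_num)
    have h14 : M' 14 = M₁ 14 := by simp [a₂, a₃, a₄, a₅, a₆, a₇, a₈, a₉, a']
    have h15 : M' 15 = M₂ 15 := by simp [a₃, a₄, a₅, a₆, a₇, a₈, a₉, a']
    have h16 : M' 16 = M₃ 16 := by simp [a₄, a₅, a₆, a₇, a₈, a₉, a']
    have h17 : M' 17 = M₄ 17 := by simp [a₅, a₆, a₇, a₈, a₉, a']
    have h18 : M' 18 = M₅ 18 := by simp [a₆, a₇, a₈, a₉, a']
    have h19 : M' 19 = M₆ 19 := by simp [a₇, a₈, a₉, a']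
    have h20 : M' 20 = M₇ 20 := by simp [a₈, a₉, a']
    have h21 : M' 21 = M₈ 21 := by simp [a₉, a']
    have h22 : M' 22 = M₉ 22 := by simp [a']
    refine ⟨fun b hb => ?_, fun b hb x => ?_, ?_, ?_, ?_, ?_, ?_, ?_, ?_, ?_, ?_, ?_, ?_, ?_, ?_,
      ?_, ?_⟩
    · rw [hlow b (by omega) (by omega), hM.input b hb]
    · rw [hlow b (by omega) (by omega), hM.zero b (by omega)]
    · rw [hlow 10 (by norm_num) (by norm_num), ec]
    · rw [hlow 11 (by norm_num) (by norm_num), er]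
    · rw [h12]; exact hM.list
    · rw [h12, h13]; exact hM.tails
    · rw [h12, h13]; exact hM.heads
    · rw [h13, h14]; exact f₁
    · rw [h13, h15]; exact f₂
    · rw [h16]; exact f₃
    · rw [h17]; exact f₄
    · rw [h18]; exact f₅
    · rw [h19]; exact f₆
    · rw [h20]; rwa [show M₆ 20 = fun _ => 0 by simp [a₁, a₂, a₃, a₄, a₅, a₆, hz]] at f₇
    · rw [h21]; rwa [show M₇ 21 = fun _ => 0 by simp [a₁, a₂, a₃, a₄, a₅, a₆, a₇, hz]] at f₈
    · rw [h20, h21, h22]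
      rwa [a₈ 20 (by norm_num) (by norm_num)] at f₉
    · rw [h22, h19, h18, h15]
      rw [show M₉ 19 = M₆ 19 by simp [a₇, a₈, a₉], show M₉ 18 = M₅ 18 by simp [a₆, a₇, a₈, a₉],
        show M₉ 15 = M₂ 15 by simp [a₃, a₄, a₅, a₆, a₇, a₈, a₉]] at f'
      exact f'

/-! ### Writing the kernel -/

/-- Four times the value of `e`. -/
def quadE (e : Expr) : Expr := .add (.add e e) (.add e e)

/-- The vertex of the current slot. -/
def vertE : Expr := .read 13 roundE

/-- The label of the component of the current slot. -/
def slotCompE : Expr := .read 10 vertE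

/-- The current slot represents its component. -/
def rootE : Expr := .sub (.const 1) (distE (.read 15 slotCompE) (.add roundE (.const 1)))

/-- The current slot represents its vertex. -/
def primE : Expr := .sub (.const 1) (distE (.read 14 vertE) roundE)

/-- Compute the types of the slots and the ends of the red edges of the kernel. -/
def typesProgram : Program :=
  .seq (assignIf 24 slotsE rootE roundE
    (.sub (.const 1) (.sub (.const 1) (.sub (.read 18 slotCompE) (.read 19 slotCompE))))) <|
  .seq (assignIf 25 slotsE rootE roundE
    (.sub (.read 22 slotCompE) (distE (.read 19 slotCompE) (.read 18 slotCompE)))) <|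
  .seq (scatter 26 slotsE primE roundE
    (.add (quadE (.sub (.read 15 slotCompE) (.const 1))) (.const 1)) (quadE roundE)) <|
  .seq (scatter 27 kE (.const 1) roundE (quadE (.read 14 (.read 1 (.read 12 roundE)))) (.const 0)) <|
  .seq (scatter 28 kE (.const 1) roundE (quadE (.read 14 (.read 2 (.read 12 roundE)))) (.const 0)) <|
  .seq (scatter 29 kE (.const 1) roundE (quadE (.read 14 (.read 3 (.read 12 roundE)))) (.const 0))
    (scatter 30 kE (.const 1) roundE (quadE (.read 14 (.read 4 (.read 12 roundE)))) (.const 0))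

/-- The results of `typesProgram`, in terms of those of `dataProgram`. -/
structure HasTypes (I : C2CInstance) (C : ℕ → ℕ) (M M' : Memory) : Prop where
  old : ∀ b < 24, b ≠ 6 → M' b = M b
  tree : ∀ i < redCount (I.input 5) I.m + redCount (I.input 5) I.m, M' 24 i =
    if M 15 (C (M 13 i)) = i + 1 ∧ M 19 (C (M 13 i)) < M 18 (C (M 13 i)) then 1 else 0
  need : ∀ i < redCount (I.input 5) I.m + redCount (I.input 5) I.m, M' 25 i =
    if M 15 (C (M 13 i)) = i + 1 ∧ M 22 (C (M 13 i)) = 1 ∧ M 19 (C (M 13 i)) = M 18 (C (M 13 i))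
    then 1 else 0
  other : ∀ i < redCount (I.input 5) I.m + redCount (I.input 5) I.m, M' 26 i =
    if M 14 (M 13 i) = i then 4 * (M 15 (C (M 13 i)) - 1) + 1 else 4 * i
  iniTail : ∀ j < redCount (I.input 5) I.m, M' 27 j = 4 * M 14 (I.input 1 (M 12 j))
  iniHead : ∀ j < redCount (I.input 5) I.m, M' 28 j = 4 * M 14 (I.input 2 (M 12 j))
  tarTail : ∀ j < redCount (I.input 5) I.m, M' 29 j = 4 * M 14 (I.input 3 (M 12 j))
  tarHead : ∀ j < redCount (I.input 5) I.m, M' 30 j = 4 * M 14 (I.input 4 (M 12 j))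

lemma quadE_eval (e : Expr) (M : Memory) : (quadE e).eval M = 4 * e.eval M := by
  simp only [quadE, Expr.eval]
  omega

lemma IsAssign.eq_of_id {N : ℕ} {P : ℕ → Prop} {V A : ℕ → ℕ} [DecidablePred P]
    (h : IsAssign N P id V (fun _ => 0) A) {i : ℕ} (hi : i < N) :
    A i = if P i then V i else 0 := by
  rcases h i with ⟨j, -, h1, h3, h2⟩ | ⟨h1, h2⟩
  · obtain rfl : j = i := h3
    rw [if_pos h1, h2]
  · rw [if_neg fun hP => h1 i hi hP rfl, h2]

/-- Truncated subtraction replaces Boolean operations: one minus a distance tests equality, and `1 -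
(1 - (x - y))` is the truth value of `y < x`. -/
lemma exec_types {I : C2CInstance} {C : ℕ → ℕ} {M : Memory} (hM : HasData I C M)
    (hk : redCount (I.input 5) I.m ≤ I.m) :
    Exec typesProgram M ((I.m + 1) * 2000) (HasTypes I C M) := by
  have e0 := hM.input 0 (by norm_num)
  have e1 := hM.input 1 (by norm_num)
  have e2 := hM.input 2 (by norm_num)
  have e3 := hM.input 3 (by norm_num)
  have e4 := hM.input 4 (by norm_num)
  have ec := hM.comp
  have er := hM.rank
  have hz : ∀ b, 23 < b → M b = fun _ => 0 := fun b hb => funext (hM.zero b hb)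
  set k := redCount (I.input 5) I.m with hkdef
  have hroot : ∀ {M' : Memory} {j}, (∀ b, b < 24 → b ≠ 6 → M' b = M b) → M' 6 0 = j →
      slotCompE.eval M' = C (M 13 j) ∧
      (rootE.eval M' ≠ 0 ↔ M 15 (C (M 13 j)) = j + 1) := by
    intro M' j h hj
    have hc : slotCompE.eval M' = C (M 13 j) := by
      simp [slotCompE, vertE, roundE, Expr.eval, h, hj, ec]
    refine ⟨hc, ?_⟩
    simp only [rootE, distE, Expr.eval, hc, roundE, hj, h 15 (by norm_num) (by norm_num)]
    omega
  have hslots : ∀ {M' : Memory}, (∀ b, b < 24 → b ≠ 6 → M' b = M b) →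
      kE.eval M' = k ∧ slotsE.eval M' = k + k := by
    intro M' h
    simp [slotsE, kE, mE, Expr.eval, h, e0, input_m, er]
  obtain ⟨M₁, t₁, r₁, b₁, a₁, f₁⟩ := exec_assignIf (a := 24) (N := k + k) (M := M)
    (bound := slotsE) (cond := rootE) (idx := roundE)
    (v := .sub (.const 1) (.sub (.const 1) (.sub (.read 18 slotCompE) (.read 19 slotCompE))))
    (by norm_num) (fun j => M 15 (C (M 13 j)) = j + 1) id
    (fun j => 1 - (1 - (M 18 (C (M 13 j)) - M 19 (C (M 13 j)))))
    (fun M' h => (hslots fun b hb hb6 => h b (by omega) hb6).2)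
    (fun j hj M' h hj' => by
      obtain ⟨h1, h2⟩ := hroot (fun b hb hb6 => h b (by omega) hb6) hj'
      refine ⟨h2, by simp [Expr.eval, roundE, hj'], ?_⟩
      simp [Expr.eval, h1, h]) (by decide)
  rw [hz 24 (by norm_num)] at f₁
  have o₁ : ∀ b, b < 24 → b ≠ 6 → M₁ b = M b := fun b hb hb6 => a₁ b (by omega) hb6
  obtain ⟨M₂, t₂, r₂, b₂, a₂, f₂⟩ := exec_assignIf (a := 25) (N := k + k) (M := M₁)
    (bound := slotsE) (cond := rootE) (idx := roundE)
    (v := .sub (.read 22 slotCompE) (distE (.read 19 slotCompE) (.read 18 slotCompE)))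
    (by norm_num) (fun j => M 15 (C (M 13 j)) = j + 1) id
    (fun j => M 22 (C (M 13 j)) - (M 19 (C (M 13 j)) - M 18 (C (M 13 j)) +
      (M 18 (C (M 13 j)) - M 19 (C (M 13 j)))))
    (fun M' h => (hslots fun b hb hb6 => (h b (by omega) hb6).trans (o₁ b hb hb6)).2)
    (fun j hj M' h hj' => by
      have h' : ∀ b, b < 24 → b ≠ 6 → M' b = M b :=
        fun b hb hb6 => (h b (by omega) hb6).trans (o₁ b hb hb6)
      obtain ⟨h1, h2⟩ := hroot h' hj'
      refine ⟨h2, by simp [Expr.eval, roundE, hj'], ?_⟩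
      simp [Expr.eval, distE, h1, h']) (by decide)
  rw [a₁ 25 (by norm_num) (by norm_num), hz 25 (by norm_num)] at f₂
  have o₂ : ∀ b, b < 24 → b ≠ 6 → M₂ b = M b :=
    fun b hb hb6 => (a₂ b (by omega) hb6).trans (o₁ b hb hb6)
  obtain ⟨M₃, t₃, r₃, b₃, a₃, f₃, -⟩ := exec_fill (a := 26) (N := k + k) (M := M₂)
    (bound := slotsE) (cond := primE) (idx := roundE)
    (v := .add (quadE (.sub (.read 15 slotCompE) (.const 1))) (.const 1)) (v' := quadE roundE)
    (by norm_num) id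
    (fun i => if M 14 (M 13 i) = i then 4 * (M 15 (C (M 13 i)) - 1) + 1 else 4 * i)
    (fun _ _ _ _ h => h)
    (fun M' h => (hslots fun b hb hb6 => (h b (by omega) hb6).trans (o₂ b hb hb6)).2)
    (fun j hj M' h hj' => by
      have h' : ∀ b, b < 24 → b ≠ 6 → M' b = M b :=
        fun b hb hb6 => (h b (by omega) hb6).trans (o₂ b hb hb6)
      obtain ⟨h1, -⟩ := hroot h' hj'
      refine ⟨by simp [Expr.eval, roundE, hj'], ?_⟩
      have hp : primE.eval M' ≠ 0 ↔ M 14 (M 13 j) = j := by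
        simp only [primE, distE, vertE, Expr.eval, roundE, hj', h' 14 (by norm_num) (by norm_num),
          h' 13 (by norm_num) (by norm_num)]
        omega
      simp only [hp, quadE_eval, Expr.eval, roundE, hj', h1, h' 15 (by norm_num) (by norm_num)])
    (by decide)
  have o₃ : ∀ b, b < 24 → b ≠ 6 → M₃ b = M b :=
    fun b hb hb6 => (a₃ b (by omega) hb6).trans (o₂ b hb hb6)
  have hquad : ∀ (a s : ℕ) (M₀ : Memory), 26 < a → s < 6 → 0 < s →
      (∀ b, b < 24 → b ≠ 6 → M₀ b = M b) →
      Exec (scatter a kE (.const 1) roundE (quadE (.read 14 (.read s (.read 12 roundE)))) (.const 0))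
        M₀ ((k + 1) * 100) fun M' => AgreeOff a M₀ M' ∧
          ∀ j < k, M' a j = 4 * M 14 (I.input s (M 12 j)) := by
    intro a s M₀ ha hs hs0 hM₀
    refine (exec_fill (by omega) id (fun j => 4 * M 14 (I.input s (M 12 j))) (fun _ _ _ _ h => h)
      (fun M' h => (hslots fun b hb hb6 => (h b (by omega) hb6).trans (hM₀ b hb hb6)).1)
      (fun j hj M' h hj' => ?_) ?_).mono le_rfl fun M' h => ⟨h.1, h.2.1⟩
    · have h' : ∀ b, b < 24 → b ≠ 6 → M' b = M b :=
        fun b hb hb6 => (h b (by omega) hb6).trans (hM₀ b hb hb6)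
      refine ⟨by simp [Expr.eval, roundE, hj'], ?_⟩
      simp [quadE_eval, Expr.eval, roundE, hj', h' 14, h' 12, h' s (by omega) (by omega),
        hM.input s hs]
    · simp [quadE, Expr.cost, kE, mE, roundE]
  obtain ⟨M₄, t₄, r₄, b₄, a₄, f₄⟩ := hquad 27 1 M₃ (by norm_num) (by norm_num) (by norm_num) o₃
  have o₄ : ∀ b, b < 24 → b ≠ 6 → M₄ b = M b :=
    fun b hb hb6 => (a₄ b (by omega) hb6).trans (o₃ b hb hb6)
  obtain ⟨M₅, t₅, r₅, b₅, a₅, f₅⟩ := hquad 28 2 M₄ (by norm_num) (by norm_num) (by norm_num) o₄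
  have o₅ : ∀ b, b < 24 → b ≠ 6 → M₅ b = M b :=
    fun b hb hb6 => (a₅ b (by omega) hb6).trans (o₄ b hb hb6)
  obtain ⟨M₆, t₆, r₆, b₆, a₆, f₆⟩ := hquad 29 3 M₅ (by norm_num) (by norm_num) (by norm_num) o₅
  have o₆ : ∀ b, b < 24 → b ≠ 6 → M₆ b = M b :=
    fun b hb hb6 => (a₆ b (by omega) hb6).trans (o₅ b hb hb6)
  obtain ⟨M₇, t₇, r₇, b₇, a₇, f₇⟩ := hquad 30 4 M₆ (by norm_num) (by norm_num) (by norm_num) o₆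
  have o₇ : ∀ b, b < 24 → b ≠ 6 → M₇ b = M b :=
    fun b hb hb6 => (a₇ b (by omega) hb6).trans (o₆ b hb hb6)
  refine ⟨M₇, _, r₁.seq (r₂.seq (r₃.seq (r₄.seq (r₅.seq (r₆.seq r₇))))), ?_, ?_⟩
  · have h1 : (k + k + 1) * 100 ≤ (I.m + I.m + 2) * 100 := Nat.mul_le_mul_right _ (by omega)
    have h2 : (k + 1) * 100 ≤ (I.m + 1) * 100 := Nat.mul_le_mul_right _ (by omega)
    omega
  · refine ⟨o₇, fun i hi => ?_, fun i hi => ?_, fun i hi => ?_, fun i hi => ?_, fun i hi => ?_,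
      fun i hi => ?_, fun i hi => ?_⟩
    · rw [show M₇ 24 = M₁ 24 by simp [a₂, a₃, a₄, a₅, a₆, a₇], f₁.eq_of_id hi]
      by_cases h1 : M 15 (C (M 13 i)) = i + 1
      · simp only [h1, true_and, if_true]
        split_ifs <;> omega
      · simp [h1]
    · rw [show M₇ 25 = M₂ 25 by simp [a₃, a₄, a₅, a₆, a₇], f₂.eq_of_id hi]
      -- An entry of at most one, minus the distance of the two counts, is one exactly if the entry
      -- is one and the counts agree.
      have := hM.diff.le_one (C (M 13 i))
      by_cases h1 : M 15 (C (M 13 i)) = i + 1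
      · simp only [h1, true_and, if_true]
        split_ifs <;> omega
      · simp [h1]
    · rw [show M₇ 26 = M₃ 26 by simp [a₄, a₅, a₆, a₇]]
      exact f₃ i hi
    · rw [show M₇ 27 = M₄ 27 by simp [a₅, a₆, a₇]]
      exact f₄ i hi
    · rw [show M₇ 28 = M₅ 28 by simp [a₆, a₇]]
      exact f₅ i hi
    · rw [show M₇ 29 = M₆ 29 by simp [a₇]]
      exact f₆ i hi
    · exact f₇ i hi

/-- Write one output array: the entries of the four edges of every slot, and of the red edges. -/
def emit (a : ℕ) (cond v₀ v₀' v₁ v₂ v₃ vr : Expr) : Program :=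
  .seq (scatter a slotsE cond (quadE roundE) v₀ v₀') <|
  .seq (scatter a slotsE (.const 1) (.add (quadE roundE) (.const 1)) v₁ (.const 0)) <|
  .seq (scatter a slotsE (.const 1) (.add (quadE roundE) (.const 2)) v₂ (.const 0)) <|
  .seq (scatter a slotsE (.const 1) (.add (quadE roundE) (.const 3)) v₃ (.const 0))
    (scatter a kE (.const 1) (.add (quadE slotsE) roundE) vr (.const 0))

/-- The five sweeps write to disjoint sets of positions: the four residues modulo 4 below `4 * (k +
k)`, and the positions from there on. The values are required to be insensitive to changes of array
`a`, so overwriting it is harmless. -/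
lemma exec_emit {a k : ℕ} {cond v₀ v₀' v₁ v₂ v₃ vr : Expr} {M : Memory} (ha : 0 < a) (ha' : a < 6)
    (hk : kE.eval M = k) (V₀ V₁ V₂ V₃ Vr : ℕ → ℕ)
    (hV : ∀ j < k + k, ∀ M', AgreeOff a M M' → M' 6 0 = j →
      (if cond.eval M' ≠ 0 then v₀.eval M' else v₀'.eval M') = V₀ j ∧
      v₁.eval M' = V₁ j ∧ v₂.eval M' = V₂ j ∧ v₃.eval M' = V₃ j)
    (hr : ∀ j < k, ∀ M', AgreeOff a M M' → M' 6 0 = j → vr.eval M' = Vr j)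
    (hcost : cond.cost + v₀.cost + v₀'.cost ≤ 35 ∧ v₁.cost ≤ 35 ∧ v₂.cost ≤ 35 ∧ v₃.cost ≤ 35 ∧
      vr.cost ≤ 10) :
    Exec (emit a cond v₀ v₀' v₁ v₂ v₃ vr) M ((k + 1) * 1000) fun M' => AgreeOff a M M' ∧
      (∀ j < k + k, M' a (4 * j) = V₀ j ∧ M' a (4 * j + 1) = V₁ j ∧ M' a (4 * j + 2) = V₂ j ∧
        M' a (4 * j + 3) = V₃ j) ∧ ∀ j < k, M' a (4 * (k + k) + j) = Vr j := by
  have hs : ∀ {M'}, AgreeOff a M M' → kE.eval M' = k ∧ slotsE.eval M' = k + k := by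
    intro M' h
    have : kE.eval M' = k := by
      rw [← hk]
      simp [kE, mE, Expr.eval, h 11 (by omega) (by norm_num), h 0 (by omega) (by norm_num)]
    exact ⟨this, by simp [slotsE, Expr.eval, this]⟩
  have c1 : slotsE.cost = 7 := rfl
  have c2 : (quadE roundE).cost = 11 := rfl
  have c3 : roundE.cost = 2 := rfl
  have c4 : kE.cost = 3 := rfl
  have c5 : (quadE slotsE).cost = 31 := rfl
  have htr : ∀ {M₁ M₂ : Memory}, AgreeOff a M M₁ → AgreeOff a M₁ M₂ → AgreeOff a M M₂ :=
    fun h1 h2 b hb hb6 => (h2 b hb hb6).trans (h1 b hb hb6)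
  obtain ⟨M₁, t₁, r₁, b₁, a₁, f₁, -⟩ := exec_fill (a := a) (N := k + k) (M := M)
    (bound := slotsE) (cond := cond) (idx := quadE roundE) (v := v₀) (v' := v₀') (by omega)
    (fun j => 4 * j) V₀ (fun i _ j _ h => by simpa using h) (fun M' h => (hs h).2)
    (fun j hj M' h hj' => ⟨by simp [quadE_eval, roundE, Expr.eval, hj'], (hV j hj M' h hj').1⟩)
    (by omega)
  obtain ⟨M₂, t₂, r₂, b₂, a₂, f₂, g₂⟩ := exec_fill (a := a) (N := k + k) (M := M₁)
    (bound := slotsE) (cond := .const 1) (idx := .add (quadE roundE) (.const 1)) (v := v₁)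
    (v' := .const 0) (by omega)
    (fun j => 4 * j + 1) V₁ (fun i _ j _ h => by simpa using h) (fun M' h => (hs (htr a₁ h)).2)
    (fun j hj M' h hj' => ⟨by simp [quadE_eval, roundE, Expr.eval, hj'],
      by simpa [Expr.eval] using (hV j hj M' (htr a₁ h) hj').2.1⟩)
    (by simp only [Expr.cost]; omega)
  have a₂' := htr a₁ a₂
  obtain ⟨M₃, t₃, r₃, b₃, a₃, f₃, g₃⟩ := exec_fill (a := a) (N := k + k) (M := M₂)
    (bound := slotsE) (cond := .const 1) (idx := .add (quadE roundE) (.const 2)) (v := v₂)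
    (v' := .const 0) (by omega)
    (fun j => 4 * j + 2) V₂ (fun i _ j _ h => by simpa using h) (fun M' h => (hs (htr a₂' h)).2)
    (fun j hj M' h hj' => ⟨by simp [quadE_eval, roundE, Expr.eval, hj'],
      by simpa [Expr.eval] using (hV j hj M' (htr a₂' h) hj').2.2.1⟩)
    (by simp only [Expr.cost]; omega)
  have a₃' := htr a₂' a₃
  obtain ⟨M₄, t₄, r₄, b₄, a₄, f₄, g₄⟩ := exec_fill (a := a) (N := k + k) (M := M₃)
    (bound := slotsE) (cond := .const 1) (idx := .add (quadE roundE) (.const 3)) (v := v₃)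
    (v' := .const 0) (by omega)
    (fun j => 4 * j + 3) V₃ (fun i _ j _ h => by simpa using h) (fun M' h => (hs (htr a₃' h)).2)
    (fun j hj M' h hj' => ⟨by simp [quadE_eval, roundE, Expr.eval, hj'],
      by simpa [Expr.eval] using (hV j hj M' (htr a₃' h) hj').2.2.2⟩)
    (by simp only [Expr.cost]; omega)
  have a₄' := htr a₃' a₄
  obtain ⟨M₅, t₅, r₅, b₅, a₅, f₅, g₅⟩ := exec_fill (a := a) (N := k) (M := M₄)
    (bound := kE) (cond := .const 1) (idx := .add (quadE slotsE) roundE) (v := vr)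
    (v' := .const 0) (by omega)
    (fun j => 4 * (k + k) + j) Vr (fun i _ j _ h => by simpa using h)
    (fun M' h => (hs (htr a₄' h)).1)
    (fun j hj M' h hj' => ⟨by simp [quadE_eval, roundE, Expr.eval, hj', (hs (htr a₄' h)).2],
      by simpa [Expr.eval] using hr j hj M' (htr a₄' h) hj'⟩)
    (by simp only [Expr.cost]; omega)
  refine ⟨M₅, _, r₁.seq (r₂.seq (r₃.seq (r₄.seq r₅))), by omega, htr a₄' a₅, fun j hj =>
    ⟨?_, ?_, ?_, ?_⟩, f₅⟩
  · rw [g₅ _ (fun i _ => by omega), g₄ _ (fun i _ => by omega), g₃ _ (fun i _ => by omega),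
      g₂ _ (fun i _ => by omega)]
    exact f₁ j hj
  · rw [g₅ _ (fun i _ => by omega), g₄ _ (fun i _ => by omega), g₃ _ (fun i _ => by omega)]
    exact f₂ j hj
  · rw [g₅ _ (fun i _ => by omega), g₄ _ (fun i _ => by omega)]
    exact f₃ j hj
  · rw [g₅ _ (fun i _ => by omega)]
    exact f₄ j hj

/-- The number `4 i + q + M 24 i`. -/
def hubE : Expr := .add (.add (quadE roundE) (.const 1)) (.read 24 roundE)

/-- Write the kernel into the output arrays. -/
def kernelProgram : Program :=
  .seq (emit 1 (.sub (.read 16 vertE) (.const 1)) (quadE roundE) (.read 26 roundE)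
    hubE (.add (quadE roundE) (.const 2)) (.add (quadE roundE) (.const 3)) (.read 27 roundE)) <|
  .seq (emit 2 (.sub (.read 16 vertE) (.const 1)) (.read 26 roundE) (quadE roundE)
    (.add hubE (.read 25 roundE)) (.add (.add (quadE roundE) (.const 2)) (.read 25 roundE))
    (.sub (.add (quadE roundE) (.const 3)) (.add (.read 25 roundE) (.read 25 roundE)))
    (.read 28 roundE)) <|
  .seq (emit 3 (.sub (.read 17 vertE) (.const 1)) (quadE roundE) (.read 26 roundE)
    (.add hubE (.read 25 roundE)) (.add (.add (quadE roundE) (.const 2)) (.read 25 roundE))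
    (.sub (.add (quadE roundE) (.const 3)) (.add (.read 25 roundE) (.read 25 roundE)))
    (.read 29 roundE)) <|
  .seq (emit 4 (.sub (.read 17 vertE) (.const 1)) (.read 26 roundE) (quadE roundE)
    hubE (.add (quadE roundE) (.const 2)) (.add (quadE roundE) (.const 3)) (.read 30 roundE)) <|
  .seq (emit 5 (.const 1) (.const 2) (.const 2) (.const 2) (.const 2) (.const 2) (.const 1)) <|
  .seq (.write 0 (.const 0) (quadE slotsE)) (.write 0 (.const 1) (.add (quadE slotsE) kE))

/-- The memory `M'` holds the kernel described by the memory `M`. -/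
structure HasKernel (k : ℕ) (M M' : Memory) : Prop where
  vertices : M' 0 0 = 4 * (k + k)
  edges : M' 0 1 = 4 * (k + k) + k
  port : ∀ i < k + k,
    M' 1 (4 * i) = (if 2 ≤ M 16 (M 13 i) then 4 * i else M 26 i) ∧
    M' 2 (4 * i) = (if 2 ≤ M 16 (M 13 i) then M 26 i else 4 * i) ∧
    M' 3 (4 * i) = (if 2 ≤ M 17 (M 13 i) then 4 * i else M 26 i) ∧
    M' 4 (4 * i) = (if 2 ≤ M 17 (M 13 i) then M 26 i else 4 * i) ∧ M' 5 (4 * i) = 2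
  hub : ∀ i < k + k,
    M' 1 (4 * i + 1) = 4 * i + 1 + M 24 i ∧ M' 2 (4 * i + 1) = 4 * i + 1 + M 24 i + M 25 i ∧
    M' 3 (4 * i + 1) = 4 * i + 1 + M 24 i + M 25 i ∧ M' 4 (4 * i + 1) = 4 * i + 1 + M 24 i ∧
    M' 5 (4 * i + 1) = 2
  left : ∀ i < k + k,
    M' 1 (4 * i + 2) = 4 * i + 2 ∧ M' 2 (4 * i + 2) = 4 * i + 2 + M 25 i ∧
    M' 3 (4 * i + 2) = 4 * i + 2 + M 25 i ∧ M' 4 (4 * i + 2) = 4 * i + 2 ∧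
    M' 5 (4 * i + 2) = 2
  right : ∀ i < k + k,
    M' 1 (4 * i + 3) = 4 * i + 3 ∧ M' 2 (4 * i + 3) = 4 * i + 3 - (M 25 i + M 25 i) ∧
    M' 3 (4 * i + 3) = 4 * i + 3 - (M 25 i + M 25 i) ∧ M' 4 (4 * i + 3) = 4 * i + 3 ∧
    M' 5 (4 * i + 3) = 2
  red : ∀ j < k, M' 1 (4 * (k + k) + j) = M 27 j ∧ M' 2 (4 * (k + k) + j) = M 28 j ∧
    M' 3 (4 * (k + k) + j) = M 29 j ∧ M' 4 (4 * (k + k) + j) = M 30 j ∧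
    M' 5 (4 * (k + k) + j) = 1

/-- The input arrays 1 to 5 may be overwritten, because what is still read lies in array 0 and in
arrays from 11 on. -/
lemma exec_kernel {k : ℕ} {M : Memory} (hk : kE.eval M = k) :
    Exec kernelProgram M ((k + 1) * 6000) (HasKernel k M) := by
  have two : ∀ x, x - 1 ≠ 0 ↔ 2 ≤ x := by omega
  have hk' : ∀ {M' : Memory}, M' 0 = M 0 → M' 11 = M 11 → kE.eval M' = k := fun h0 h11 => by
    rw [← hk]; simp [kE, mE, Expr.eval, h0, h11]
  obtain ⟨M₁, t₁, r₁, b₁, a₁, f₁, g₁⟩ := exec_emit (a := 1) (k := k) (M := M)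
    (cond := .sub (.read 16 vertE) (.const 1)) (v₀ := quadE roundE) (v₀' := .read 26 roundE)
    (v₁ := hubE) (v₂ := .add (quadE roundE) (.const 2)) (v₃ := .add (quadE roundE) (.const 3))
    (vr := .read 27 roundE) (by norm_num) (by norm_num) hk
    (fun i => if 2 ≤ M 16 (M 13 i) then 4 * i else M 26 i) (fun i => 4 * i + 1 + M 24 i)
    (fun i => 4 * i + 2) (fun i => 4 * i + 3) (M 27)
    (fun j hj M' h hj' => by simp [Expr.eval, hubE, quadE_eval, vertE, roundE, hj', h, two])
    (fun j hj M' h hj' => by simp [Expr.eval, roundE, hj', h]) (by decide)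
  obtain ⟨M₂, t₂, r₂, b₂, a₂, f₂, g₂⟩ := exec_emit (a := 2) (k := k) (M := M₁)
    (cond := .sub (.read 16 vertE) (.const 1)) (v₀ := .read 26 roundE) (v₀' := quadE roundE)
    (v₁ := .add hubE (.read 25 roundE))
    (v₂ := .add (.add (quadE roundE) (.const 2)) (.read 25 roundE))
    (v₃ := .sub (.add (quadE roundE) (.const 3)) (.add (.read 25 roundE) (.read 25 roundE)))
    (vr := .read 28 roundE) (by norm_num) (by norm_num) (hk' (by simp [a₁]) (by simp [a₁]))
    (fun i => if 2 ≤ M 16 (M 13 i) then M 26 i else 4 * i)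
    (fun i => 4 * i + 1 + M 24 i + M 25 i)
    (fun i => 4 * i + 2 + M 25 i) (fun i => 4 * i + 3 - (M 25 i + M 25 i)) (M 28)
    (fun j hj M' h hj' => by simp [Expr.eval, hubE, quadE_eval, vertE, roundE, hj', h, a₁, two])
    (fun j hj M' h hj' => by simp [Expr.eval, roundE, hj', h, a₁]) (by decide)
  obtain ⟨M₃, t₃, r₃, b₃, a₃, f₃, g₃⟩ := exec_emit (a := 3) (k := k) (M := M₂)
    (cond := .sub (.read 17 vertE) (.const 1)) (v₀ := quadE roundE) (v₀' := .read 26 roundE)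
    (v₁ := .add hubE (.read 25 roundE))
    (v₂ := .add (.add (quadE roundE) (.const 2)) (.read 25 roundE))
    (v₃ := .sub (.add (quadE roundE) (.const 3)) (.add (.read 25 roundE) (.read 25 roundE)))
    (vr := .read 29 roundE) (by norm_num) (by norm_num)
    (hk' (by simp [a₁, a₂]) (by simp [a₁, a₂]))
    (fun i => if 2 ≤ M 17 (M 13 i) then 4 * i else M 26 i)
    (fun i => 4 * i + 1 + M 24 i + M 25 i)
    (fun i => 4 * i + 2 + M 25 i) (fun i => 4 * i + 3 - (M 25 i + M 25 i)) (M 29)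
    (fun j hj M' h hj' => by simp [Expr.eval, hubE, quadE_eval, vertE, roundE, hj', h, a₁, a₂, two])
    (fun j hj M' h hj' => by simp [Expr.eval, roundE, hj', h, a₁, a₂]) (by decide)
  obtain ⟨M₄, t₄, r₄, b₄, a₄, f₄, g₄⟩ := exec_emit (a := 4) (k := k) (M := M₃)
    (cond := .sub (.read 17 vertE) (.const 1)) (v₀ := .read 26 roundE) (v₀' := quadE roundE)
    (v₁ := hubE) (v₂ := .add (quadE roundE) (.const 2)) (v₃ := .add (quadE roundE) (.const 3))
    (vr := .read 30 roundE) (by norm_num) (by norm_num)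
    (hk' (by simp [a₁, a₂, a₃]) (by simp [a₁, a₂, a₃]))
    (fun i => if 2 ≤ M 17 (M 13 i) then M 26 i else 4 * i) (fun i => 4 * i + 1 + M 24 i)
    (fun i => 4 * i + 2) (fun i => 4 * i + 3) (M 30)
    (fun j hj M' h hj' => by
      simp [Expr.eval, hubE, quadE_eval, vertE, roundE, hj', h, a₁, a₂, a₃, two])
    (fun j hj M' h hj' => by simp [Expr.eval, roundE, hj', h, a₁, a₂, a₃]) (by decide)
  obtain ⟨M₅, t₅, r₅, b₅, a₅, f₅, g₅⟩ := exec_emit (a := 5) (k := k) (M := M₄)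
    (cond := .const 1) (v₀ := .const 2) (v₀' := .const 2)
    (v₁ := .const 2) (v₂ := .const 2) (v₃ := .const 2)
    (vr := .const 1) (by norm_num) (by norm_num)
    (hk' (by simp [a₁, a₂, a₃, a₄]) (by simp [a₁, a₂, a₃, a₄]))
    (fun _ => 2) (fun _ => 2) (fun _ => 2) (fun _ => 2) (fun _ => 1)
    (fun j hj M' h hj' => by simp [Expr.eval])
    (fun j hj M' h hj' => by simp [Expr.eval]) (by decide)
  have hk₅ : kE.eval M₅ = k :=
    hk' (by simp [a₁, a₂, a₃, a₄, a₅]) (by simp [a₁, a₂, a₃, a₄, a₅])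
  have r₆ := Program.Run.write M₅ 0 (.const 0) (quadE slotsE)
  have r₇ := Program.Run.write (M₅.update 0 0 ((quadE slotsE).eval M₅)) 0 (.const 1)
    (.add (quadE slotsE) kE)
  have hs₅ : slotsE.eval M₅ = k + k := by simp [slotsE, Expr.eval, hk₅]
  have hk₆ : kE.eval (M₅.update 0 0 ((quadE slotsE).eval M₅)) = k := by
    -- The expression `kE` reads the original number of edges in cell 1 of array 0, so this cell has
    -- to be written last.
    rw [← hk₅]
    simp [kE, mE, Expr.eval, Memory.update]
  have hs₆ : slotsE.eval (M₅.update 0 0 ((quadE slotsE).eval M₅)) = k + k := by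
    change kE.eval _ + kE.eval _ = k + k
    rw [hk₆]
  have h1 : ∀ {b}, b ≠ 0 → ∀ x y z w, ((M₅.update 0 x y).update 0 z w) b = M₅ b := by
    intro b hb x y z w
    simp [Memory.update_eq, hb]
  refine ⟨_, _, r₁.seq (r₂.seq (r₃.seq (r₄.seq (r₅.seq (r₆.seq r₇))))), ?_, ?_⟩
  · have c1 : (Expr.const 0).cost = 1 := rfl
    have c2 : (Expr.const 1).cost = 1 := rfl
    have c3 : (quadE slotsE).cost = 31 := rfl
    have c4 : (Expr.add (quadE slotsE) kE).cost = 35 := rfl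
    omega
  · have m₁ : M₅ 1 = M₁ 1 := by simp [a₂, a₃, a₄, a₅]
    have m₂ : M₅ 2 = M₂ 2 := by simp [a₃, a₄, a₅]
    have m₃ : M₅ 3 = M₃ 3 := by simp [a₄, a₅]
    have m₄ : M₅ 4 = M₄ 4 := by simp [a₅]
    refine ⟨?_, ?_, fun i hi => ?_, fun i hi => ?_, fun i hi => ?_, fun i hi => ?_, fun i hi => ?_⟩
    · simp [Memory.update, Expr.eval, quadE_eval, hs₅]
    · have e1 : (Expr.add (quadE slotsE) kE).eval
          (M₅.update 0 0 ((quadE slotsE).eval M₅)) = 4 * (k + k) + k := by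
        rw [Expr.eval, quadE_eval, hs₆, hk₆]
      simp only [Expr.eval] at e1 ⊢
      simp [Memory.update, e1]
    · simp only [h1 (b := 1) one_ne_zero, h1 (b := 2) two_ne_zero, h1 (b := 3) three_ne_zero,
        h1 (b := 4) four_ne_zero, h1 (b := 5) (by norm_num), m₁, m₂, m₃, m₄]
      exact ⟨(f₁ i hi).1, (f₂ i hi).1, (f₃ i hi).1, (f₄ i hi).1, (f₅ i hi).1⟩
    · simp only [h1 (b := 1) one_ne_zero, h1 (b := 2) two_ne_zero, h1 (b := 3) three_ne_zero,
        h1 (b := 4) four_ne_zero, h1 (b := 5) (by norm_num), m₁, m₂, m₃, m₄]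
      exact ⟨(f₁ i hi).2.1, (f₂ i hi).2.1, (f₃ i hi).2.1, (f₄ i hi).2.1, (f₅ i hi).2.1⟩
    · simp only [h1 (b := 1) one_ne_zero, h1 (b := 2) two_ne_zero, h1 (b := 3) three_ne_zero,
        h1 (b := 4) four_ne_zero, h1 (b := 5) (by norm_num), m₁, m₂, m₃, m₄]
      exact ⟨(f₁ i hi).2.2.1, (f₂ i hi).2.2.1, (f₃ i hi).2.2.1, (f₄ i hi).2.2.1, (f₅ i hi).2.2.1⟩
    · simp only [h1 (b := 1) one_ne_zero, h1 (b := 2) two_ne_zero, h1 (b := 3) three_ne_zero,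
        h1 (b := 4) four_ne_zero, h1 (b := 5) (by norm_num), m₁, m₂, m₃, m₄]
      exact ⟨(f₁ i hi).2.2.2, (f₂ i hi).2.2.2, (f₃ i hi).2.2.2, (f₄ i hi).2.2.2, (f₅ i hi).2.2.2⟩
    · simp only [h1 (b := 1) one_ne_zero, h1 (b := 2) two_ne_zero, h1 (b := 3) three_ne_zero,
        h1 (b := 4) four_ne_zero, h1 (b := 5) (by norm_num), m₁, m₂, m₃, m₄]
      exact ⟨g₁ i hi, g₂ i hi, g₃ i hi, g₄ i hi, g₅ i hi⟩

open ConstraintGraph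

/-! ### The meaning of the data -/

lemma input_weight_lt_two (I : C2CInstance) (e : Fin I.m) :
    I.input 5 e < 2 ↔ I.G.color e = Color.red := by
  rw [input_weight]
  cases I.G.color e <;> simp [Color.weight]

lemma one_lt_input_weight (I : C2CInstance) (e : Fin I.m) :
    1 < I.input 5 e ↔ I.G.color e = Color.blue := by
  rw [input_weight]
  cases I.G.color e <;> simp [Color.weight]

lemma redCount_numRed (I : C2CInstance) : redCount (I.input 5) I.m = I.G.numRed := by
  have h : ∀ W : ℕ → ℕ, ∀ N, redCount W N = ∑ j ∈ range N, (2 - W j) := by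
    intro W N
    induction N with
    | zero => rfl
    | succ N ih => rw [redCount, sum_range_succ, ih]
  rw [h, sum_range, numRed, card_filter]
  refine sum_congr rfl fun e _ => ?_
  rw [input_weight]
  cases I.G.color e <;> simp [Color.weight]

lemma numRed_le (I : C2CInstance) : I.G.numRed ≤ I.m :=
  (card_filter_le _ _).trans (by simp)

/-- As all weights are at least one, the count grows by at most one per edge, and only at red edges;
so it misses no value. -/
lemma redCount_surj {W : ℕ → ℕ} {N x : ℕ} (hW : ∀ j < N, 1 ≤ W j) (hx : x < redCount W N) :
    ∃ j < N, W j < 2 ∧ redCount W j = x := by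
  induction N with
  | zero => exact absurd hx (Nat.not_lt_zero _)
  | succ N ih =>
    by_cases h : x < redCount W N
    · obtain ⟨j, hj, h⟩ := ih (fun j hj => hW j (by omega)) h
      exact ⟨j, by omega, h⟩
    · have := hW N (by omega)
      rw [redCount] at hx
      exact ⟨N, by omega, by omega, by omega⟩

lemma redCount_lt {W : ℕ → ℕ} {i j : ℕ} (hi : W i < 2) (hij : i < j) :
    redCount W i < redCount W j := by
  induction j, hij using Nat.le_induction with
  | base => rw [redCount]; omega
  | succ j _ ih => rw [redCount]; omega

lemma IsCount.eq_card {N : ℕ} {P : ℕ → Prop} {X A : ℕ → ℕ} (h : IsCount N P X A) (x : ℕ)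
    (Q : Fin N → Prop) [DecidablePred Q] (hQ : ∀ j, Q j ↔ P j ∧ X j = x) :
    A x = (univ.filter Q).card := by
  obtain ⟨s, hs, hA⟩ := h x
  rw [hA, ← card_map Fin.valEmbedding]
  congr 1
  ext j
  simp only [hs, mem_map, mem_filter, mem_univ, true_and, Fin.valEmbedding_apply]
  constructor
  · rintro ⟨h1, h2⟩
    exact ⟨⟨j, h1⟩, (hQ _).2 h2, rfl⟩
  · rintro ⟨j, h1, rfl⟩
    exact ⟨j.2, (hQ _).1 h1⟩

lemma IsAssign.eq_one_iff {N : ℕ} {P : ℕ → Prop} {X A : ℕ → ℕ}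
    (h : IsAssign N P X (fun _ => 1) (fun _ => 0) A) (x : ℕ) :
    A x = 1 ↔ ∃ j < N, P j ∧ X j = x := by
  rcases h x with ⟨j, h1, h2, h3, h4⟩ | ⟨h1, h2⟩
  · exact iff_of_true h4 ⟨j, h1, h2, h3⟩
  · refine iff_of_false (h2 ▸ zero_ne_one) ?_
    rintro ⟨j, h3, h4, h5⟩
    exact h1 j h3 h4 h5

section Data

variable {I : C2CInstance} {C : ℕ → ℕ} {M : Memory}

/-- The labels of the blue components of the vertices. -/
def vertexLabel (I : C2CInstance) (C : ℕ → ℕ) (v : Fin I.n) : ℕ := C v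

/-- The labels of the blue components of the edges. -/
def edgeLabel (I : C2CInstance) (C : ℕ → ℕ) (e : Fin I.m) : ℕ := C (I.ini e).2

lemma C2CInstance.feasible_ini (I : C2CInstance) : I.G.Feasible I.ini :=
  (isFeasible_arcs_iff I.ini_ends).1 I.ini_feasible

lemma C2CInstance.feasible_tar (I : C2CInstance) : I.G.Feasible I.tar :=
  (isFeasible_arcs_iff I.tar_ends).1 I.tar_feasible

lemma isBlueComp_label (hC : ∀ u v : Fin I.n, C u = C v ↔
    ReflTransGen (I.G.AdjIn {e | I.G.color e = Color.blue}) u v) :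
    I.G.IsBlueComp (vertexLabel I C) (edgeLabel I C) := by
  refine ⟨fun e he v hv => ?_, fun u v h => (hC u v).1 h⟩
  rw [← I.ini_ends, Sym2.mem_iff] at hv
  rcases hv with rfl | rfl
  · exact (hC _ _).2 (.single ⟨e, he, (I.ini_ends e).symm⟩)
  · rfl

/-- The rank is strictly increasing along the red edges and attains every value below their number;
the list in array 12 inverts it. -/
lemma HasData.exists_isRedEnum (hM : HasData I C M) :
    ∃ ι : Fin I.G.numRed → Fin I.m, (∀ x, (ι x : ℕ) = M 12 x) ∧ I.G.IsRedEnum ι := by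
  have hW : ∀ j < I.m, 1 ≤ I.input 5 j := fun j hj => by
    have := input_weight I ⟨j, hj⟩
    simp only at this
    rw [this]
    cases I.G.color ⟨j, hj⟩ <;> simp [Color.weight]
  have key : ∀ x < I.G.numRed, M 12 x < I.m ∧ I.input 5 (M 12 x) < 2 ∧
      redCount (I.input 5) (M 12 x) = x := by
    intro x hx
    rcases hM.list x with ⟨j, h1, h2, h3, h4⟩ | ⟨h1, -⟩
    · rw [h4]
      exact ⟨h1, h2, h3⟩
    · rw [← redCount_numRed] at hx
      obtain ⟨j, h2, h3, h4⟩ := redCount_surj hW hx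
      exact (h1 j h2 h3 h4).elim
  refine ⟨fun x => ⟨M 12 x, (key x x.2).1⟩, fun _ => rfl, fun x y h => ?_, fun e => ?_⟩
  · have h' : M 12 x = M 12 y := congrArg Fin.val h
    rw [Fin.ext_iff, ← (key x x.2).2.2, h', (key y y.2).2.2]
  · rw [← input_weight_lt_two]
    constructor
    · intro he
      have hlt : redCount (I.input 5) e < I.G.numRed := by
        rw [← redCount_numRed]
        exact redCount_lt he e.2
      refine ⟨⟨_, hlt⟩, Fin.ext ?_⟩
      obtain ⟨-, h2, h3⟩ := key _ hlt
      rcases lt_trichotomy (M 12 (redCount (I.input 5) e)) e with h | h | h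
      · exact absurd h3 (redCount_lt h2 h).ne
      · exact h
      · exact absurd h3 (redCount_lt he h).ne'
    · rintro ⟨x, rfl⟩
      exact (key x x.2).2.1

lemma HasData.iniDeg_eq (hM : HasData I C M) (v : Fin I.n) :
    M 16 v = I.G.headDeg I.ini Color.red v := by
  refine hM.iniDeg.eq_card _ _ fun e => ?_
  rw [input_weight_lt_two, input_ini_snd, ← Fin.ext_iff, and_comm]

lemma HasData.tarDeg_eq (hM : HasData I C M) (v : Fin I.n) :
    M 17 v = I.G.headDeg I.tar Color.red v := by
  refine hM.tarDeg.eq_card _ _ fun e => ?_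
  rw [input_weight_lt_two, input_tar_snd, ← Fin.ext_iff, and_comm]

lemma HasData.vCount_eq (hM : HasData I C M) (c : ℕ) :
    M 18 c = ConstraintGraph.vCount (vertexLabel I C) c := by
  refine hM.vCount.eq_card _ _ fun v => ?_
  rw [true_and]
  rfl

lemma HasData.eCount_eq (hM : HasData I C M) (c : ℕ) :
    M 19 c = I.G.eCount (edgeLabel I C) c := by
  refine hM.eCount.eq_card _ _ fun e => ?_
  rw [one_lt_input_weight, input_ini_snd]
  rfl

/-- Only the edge `e` writes to this position, which removes the ambiguity of `IsAssign`. -/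
lemma IsAssign.eq_tail {f : Fin I.m → Fin I.n × Fin I.n} {H T A : ℕ → ℕ}
    (h : IsAssign I.m (fun j => 1 < I.input 5 j) H T (fun _ => 0) A)
    (hH : ∀ e : Fin I.m, H e = (f e).2) (hT : ∀ e : Fin I.m, T e = (f e).1) {e : Fin I.m}
    (he : I.G.color e = Color.blue)
    (hu : ∃ e', ∀ e'', I.G.color e'' = Color.blue → (f e'').2 = (f e).2 → e'' = e') :
    A (f e).2 = (f e).1 := by
  rcases h (f e).2 with ⟨j, h1, h2, h3, h4⟩ | ⟨h1, -⟩
  · obtain ⟨e', he'⟩ := hu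
    have hj : (⟨j, h1⟩ : Fin I.m) = e := by
      rw [he' e he rfl]
      exact he' _ ((one_lt_input_weight I ⟨j, h1⟩).1 h2) (Fin.ext ((hH ⟨j, h1⟩).symm.trans h3))
    rw [h4, ← hj]
    exact hT ⟨j, h1⟩
  · exact (h1 e e.2 ((one_lt_input_weight I e).2 he) (hH e)).elim

/-- The stored predecessors determine the blue arcs only where one blue arc enters each vertex,
hence the two hypotheses on hits; `reconfigurable_iff_walk` asks for no more. -/
lemma HasData.diff_iff (hM : HasData I C M)
    (hB : I.G.IsBlueComp (vertexLabel I C) (edgeLabel I C)) {ι : Fin I.G.numRed → Fin I.m}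
    (hι : I.G.IsRedEnum ι) {c : ℕ}
    (hc : I.G.eCount (edgeLabel I C) c = ConstraintGraph.vCount (vertexLabel I C) c)
    (hini : ¬Hit (vertexLabel I C) (I.ini ∘ ι) c) (htar : ¬Hit (vertexLabel I C) (I.tar ∘ ι) c) :
    M 22 c = 1 ↔ ¬I.G.SamePred (vertexLabel I C) I.ini I.tar c := by
  have key : ∀ e e', I.G.color e = Color.blue → I.G.color e' = Color.blue →
      vertexLabel I C (I.ini e).2 = c → (I.ini e).2 = (I.tar e').2 →
      M 20 (I.ini e).2 = (I.ini e).1 ∧ M 21 (I.ini e).2 = (I.tar e').1 := by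
    intro e e' he he' hv hee'
    obtain ⟨e₁, -, h1⟩ := hB.existsUnique_head hι I.feasible_ini hc hini hv
    obtain ⟨e₂, -, h2⟩ := hB.existsUnique_head hι I.feasible_tar hc htar hv
    refine ⟨hM.iniPred.eq_tail (input_ini_snd I) (input_ini_fst I) he ⟨e₁, h1⟩, ?_⟩
    rw [hee'] at h2 ⊢
    exact hM.tarPred.eq_tail (input_tar_snd I) (input_tar_fst I) he' ⟨e₂, h2⟩
  rw [hM.diff.eq_one_iff]
  constructor
  · rintro ⟨v, hv, hne, hvc⟩ hsame
    have hvc' : vertexLabel I C ⟨v, hv⟩ = c := hvc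
    obtain ⟨e, ⟨h1, h2⟩, -⟩ := hB.existsUnique_head hι I.feasible_ini hc hini hvc'
    obtain ⟨e', ⟨h1', h2'⟩, -⟩ := hB.existsUnique_head hι I.feasible_tar hc htar hvc'
    obtain ⟨h3, h4⟩ := key e e' h1 h1' (h2 ▸ hvc') (h2.trans h2'.symm)
    rw [h2] at h3 h4
    exact hne (h3.trans ((congrArg Fin.val (hsame e e' h1 h1' (h2 ▸ hvc')
      (h2.trans h2'.symm))).trans h4.symm))
  · intro hsame
    simp only [SamePred, not_forall] at hsame
    obtain ⟨e, e', h1, h1', hvc, h2, hne⟩ := hsame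
    obtain ⟨h3, h4⟩ := key e e' h1 h1' hvc h2
    refine ⟨_, (I.ini e).2.2, fun h => hne (Fin.ext ?_), hvc⟩
    rw [← h3, ← h4, h]

/-- The slots of the kernel given by the memory `M`. -/
structure IsSlots (I : C2CInstance) (C : ℕ → ℕ) (M : Memory)
    (D : Slots (Fin I.n) ℕ (Fin (I.G.numRed + I.G.numRed))) : Prop where
  comp : D.comp = vertexLabel I C
  vert : ∀ i, (D.vert i : ℕ) = M 13 i
  slot : ∀ v : Fin I.n, (D.slot v : ℕ) = M 14 v
  root : ∀ c, (D.root c : ℕ) = M 15 c - 1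
  tree : ∀ c, D.tree c ↔ M 19 c < M 18 c
  need : ∀ c, D.need c ↔ M 19 c = M 18 c ∧ M 22 c = 1

lemma HasData.slot_lt (hM : HasData I C M) {ι : Fin I.G.numRed → Fin I.m}
    (hι : ∀ x, (ι x : ℕ) = M 12 x) (i : Fin (I.G.numRed + I.G.numRed)) : M 13 i < I.n := by
  have hk := redCount_numRed I
  by_cases h : i.val < I.G.numRed
  · rw [hM.tails i (h.trans_eq hk.symm), ← hι ⟨i, h⟩, input_ini_fst]
    exact Fin.is_lt _
  · have h' : i.val - I.G.numRed < I.G.numRed := by omega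
    have := hM.heads (i - I.G.numRed) (h'.trans_eq hk.symm)
    rw [hk, Nat.add_sub_cancel' (not_lt.1 h)] at this
    rw [this, ← hι ⟨_, h'⟩, input_ini_snd]
    exact Fin.is_lt _

lemma HasData.exists_isSlots (hM : HasData I C M) (hk : 0 < I.G.numRed)
    {ι : Fin I.G.numRed → Fin I.m} (hι : ∀ x, (ι x : ℕ) = M 12 x) : ∃ D, IsSlots I C M D := by
  have hslot := hM.slot
  have hroot := hM.root
  rw [redCount_numRed] at hslot hroot
  have h1 : ∀ v, M 14 v < I.G.numRed + I.G.numRed := fun v => by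
    rcases hslot v with ⟨j, h1, -, -, h2⟩ | ⟨-, h2⟩ <;> rw [h2]
    · exact h1
    -- Vertices without slot have the default entry zero, which names a slot because there is a red
    -- edge.
    · exact Nat.add_pos_left hk _
  have h2 : ∀ c, M 15 c - 1 < I.G.numRed + I.G.numRed := fun c => by
    rcases hroot c with ⟨j, h1, -, -, h2⟩ | ⟨-, h2⟩ <;> rw [h2]
    · exact h1
    -- Array 15 stores a slot plus one, and zero if there is none; in the latter case truncated
    -- subtraction yields slot zero.
    · exact Nat.add_pos_left hk _
  refine ⟨{ comp := vertexLabel I C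
            vert := fun i => ⟨M 13 i, hM.slot_lt hι i⟩
            slot := fun v => ⟨M 14 v, h1 v⟩
            root := fun c => ⟨M 15 c - 1, h2 c⟩
            tree := fun c => M 19 c < M 18 c
            need := fun c => M 19 c = M 18 c ∧ M 22 c = 1
            vert_slot := fun i => Fin.ext ?_
            comp_root := fun i => ?_
            not_need := fun c h h' => h.ne h'.1 },
    rfl, fun _ => rfl, fun _ => rfl, fun _ => rfl, fun _ => Iff.rfl, fun _ => Iff.rfl⟩
  · rcases hslot (M 13 i) with ⟨j, -, -, h1, h2⟩ | ⟨h1, -⟩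
    · simp only [h2]
      exact h1
    · exact (h1 i i.2 trivial rfl).elim
  · simp only [vertexLabel]
    rcases hroot (C (M 13 i)) with ⟨j, -, -, h1, h2⟩ | ⟨h1, -⟩
    · rw [h2]
      exact h1
    · exact (h1 i i.2 trivial rfl).elim

lemma HasData.root_ne_zero_iff (hM : HasData I C M) (c : ℕ) :
    M 15 c ≠ 0 ↔ ∃ i < I.G.numRed + I.G.numRed, C (M 13 i) = c := by
  have hroot := hM.root
  rw [redCount_numRed] at hroot
  rcases hroot c with ⟨j, h1, -, h2, h3⟩ | ⟨h1, h2⟩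
  · exact iff_of_true (h3 ▸ Nat.succ_ne_zero j) ⟨j, h1, h2⟩
  · refine iff_of_false (not_not.2 h2) ?_
    rintro ⟨j, h3, h4⟩
    exact h1 j h3 trivial h4

lemma HasData.ends_vert (hM : HasData I C M) {ι : Fin I.G.numRed → Fin I.m}
    (hι : ∀ x, (ι x : ℕ) = M 12 x) (x : Fin I.G.numRed) :
    (∃ i < I.G.numRed + I.G.numRed, M 13 i = (I.ini (ι x)).1) ∧
      ∃ i < I.G.numRed + I.G.numRed, M 13 i = (I.ini (ι x)).2 := by
  have hk := redCount_numRed I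
  refine ⟨⟨x, by omega, ?_⟩, ⟨I.G.numRed + x, by omega, ?_⟩⟩
  · rw [hM.tails x (x.2.trans_eq hk.symm), ← hι, input_ini_fst]
  · have := hM.heads x (x.2.trans_eq hk.symm)
    rw [hk] at this
    rw [this, ← hι, input_ini_snd]

lemma HasData.bad_iff (hM : HasData I C M) :
    M 23 0 ≠ 0 ↔ ∃ c, M 19 c = M 18 c ∧ M 22 c = 1 ∧ M 15 c = 0 := by
  have h01 := hM.bad.le_one 0
  have h1 := hM.bad.eq_one_iff 0
  rw [show M 23 0 ≠ 0 ↔ M 23 0 = 1 by omega, h1]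
  constructor
  · rintro ⟨v, -, ⟨h1, h2, h3⟩, -⟩
    exact ⟨_, h2, h1, h3⟩
  · rintro ⟨c, h1, h2, h3⟩
    obtain ⟨v, hv, -, rfl⟩ := (hM.diff.eq_one_iff c).1 h2
    exact ⟨v, hv, ⟨h2, h1, h3⟩, rfl⟩

/-- Reversals do not move the ends of a red edge, so only components that contain such an end can
ever be hit. -/
lemma ConstraintGraph.Walk.exists_end {V X κ : Type} [Fintype X] [DecidableEq V]
    [DecidableEq X] {comp : V → κ} {tree : κ → Prop} {S₀ S : X → V × V} {H : κ → Prop}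
    (hw : Walk comp tree S₀ S H) :
    (∀ x, S x = S₀ x ∨ S x = (S₀ x).swap) ∧
      ∀ c, H c → ∃ x, comp (S₀ x).1 = c ∨ comp (S₀ x).2 = c := by
  have hhit : ∀ S : X → V × V, (∀ x, S x = S₀ x ∨ S x = (S₀ x).swap) → ∀ c, Hit comp S c →
      ∃ x, comp (S₀ x).1 = c ∨ comp (S₀ x).2 = c := by
    rintro S hS c ⟨v, hv, hr⟩
    obtain ⟨x, hx⟩ := card_pos.1 (lt_of_lt_of_le two_pos hr)
    rw [mem_filter] at hx
    refine ⟨x, ?_⟩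
    rcases hS x with h | h <;> rw [h] at hx
    · exact Or.inr (hx.2 ▸ hv)
    · exact Or.inl (by rw [← hv, ← hx.2]; rfl)
  induction hw with
  | start => exact ⟨fun _ => Or.inl rfl, hhit _ fun _ => Or.inl rfl⟩
  | @step S S' H _ hs _ ih =>
    have hS' : ∀ x, S' x = S₀ x ∨ S' x = (S₀ x).swap := by
      intro x
      rcases hs with rfl | ⟨y, rfl⟩
      · exact ih.1 x
      · by_cases hx : x = y
        · subst hx
          rw [Function.update_self]
          rcases ih.1 x with h | h <;> rw [h]
          · exact Or.inr rfl
          · exact Or.inl (Prod.swap_swap _)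
        · rw [Function.update_of_ne hx]
          exact ih.1 x
    refine ⟨hS', fun c hc => hc.elim (ih.2 c) (hhit _ hS' c)⟩

/-- A component that has to be hit but has no slot contains no end of a red edge, so no walk hits
it. -/
lemma HasData.not_isYes (hM : HasData I C M)
    (hC : ∀ u v : Fin I.n, C u = C v ↔
      ReflTransGen (I.G.AdjIn {e | I.G.color e = Color.blue}) u v) (hbad : M 23 0 ≠ 0) :
    ¬I.IsYes := by
  obtain ⟨c, h1, h2, h3⟩ := hM.bad_iff.1 hbad
  obtain ⟨ι, hι, hι'⟩ := hM.exists_isRedEnum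
  have hB := isBlueComp_label hC
  rw [C2CInstance.IsYes, C2CInstance.iniArcs, C2CInstance.tarArcs,
    reconfigurable_iff_walk hB hι' I.feasible_ini I.feasible_tar (fun c => M 22 c = 1)
      fun c h4 h5 h6 => hM.diff_iff hB hι' h4 h5 h6]
  rintro ⟨S, H, hw, -, hH⟩
  obtain ⟨x, hx⟩ := hw.exists_end.2 c (hH c (by rw [← hM.eCount_eq, ← hM.vCount_eq, h1]) h2)
  refine (hM.root_ne_zero_iff c).2 ?_ h3
  obtain ⟨⟨i, hi, h4⟩, ⟨j, hj, h5⟩⟩ := hM.ends_vert hι x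
  rcases hx with hx | hx
  · exact ⟨i, hi, h4 ▸ hx⟩
  · exact ⟨j, hj, h5 ▸ hx⟩

/-- Without red edges there are no slots, so any component that has to be hit would have set the
flag; the trivial walk suffices. -/
lemma HasData.isYes_of_numRed_eq_zero (hM : HasData I C M)
    (hC : ∀ u v : Fin I.n, C u = C v ↔
      ReflTransGen (I.G.AdjIn {e | I.G.color e = Color.blue}) u v) (hbad : M 23 0 = 0)
    (hk : I.G.numRed = 0) : I.IsYes := by
  obtain ⟨ι, hι, hι'⟩ := hM.exists_isRedEnum
  have hB := isBlueComp_label hC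
  rw [C2CInstance.IsYes, C2CInstance.iniArcs, C2CInstance.tarArcs,
    reconfigurable_iff_walk hB hι' I.feasible_ini I.feasible_tar (fun c => M 22 c = 1)
      fun c h4 h5 h6 => hM.diff_iff hB hι' h4 h5 h6]
  have : IsEmpty (Fin I.G.numRed) := by rw [hk]; infer_instance
  refine ⟨_, _, .start, ?_, fun c h1 h2 => ?_⟩
  · rw [Subsingleton.elim (I.ini ∘ ι) (I.tar ∘ ι)]
  · by_contra
    have h3 : M 15 c ≠ 0 := fun h3 =>
      hM.bad_iff.2 ⟨c, by rw [hM.eCount_eq, hM.vCount_eq, h1], h2, h3⟩ hbad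
    obtain ⟨i, hi, -⟩ := (hM.root_ne_zero_iff c).1 h3
    omega

end Data

/-! ### The output -/

/-- The memory `M` holds an equivalent instance of the desired size. -/
def IsKernelOf (I : C2CInstance) (M : Memory) : Prop :=
  ∃ J : C2CInstance, J.IsStoredIn M ∧ (J.IsYes ↔ I.IsYes) ∧ J.n ≤ 8 * max 1 I.G.numRed ∧
    J.m ≤ 11 * max 1 I.G.numRed

/-- The instance without vertices. -/
def emptyInstance : C2CInstance where
  n := 0
  m := 0
  G := ⟨Fin.elim0, Fin.elim0⟩
  ini := Fin.elim0
  tar := Fin.elim0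
  ini_ends e := e.elim0
  tar_ends e := e.elim0
  ini_feasible := ⟨⟨Fin.elim0, fun e => e.elim0, rfl⟩, fun v => v.elim0⟩
  tar_feasible := ⟨⟨Fin.elim0, fun e => e.elim0, rfl⟩, fun v => v.elim0⟩

lemma isYes_emptyInstance : emptyInstance.IsYes :=
  ⟨0, fun _ => emptyInstance.iniArcs, rfl, rfl, fun _ _ => emptyInstance.ini_feasible,
    fun _ h => (Nat.not_lt_zero _ h).elim⟩

/-- Write the entry `e` of an instance. -/
def writeEdge (e x y z w : ℕ) : Program :=
  .seq (.write 1 (.const e) (.const x)) <| .seq (.write 2 (.const e) (.const y)) <|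
    .seq (.write 3 (.const e) (.const z)) <| .seq (.write 4 (.const e) (.const w))
      (.write 5 (.const e) (.const 2))

/-- Write the fixed no-instance. -/
def noProgram : Program :=
  .seq (.write 0 (.const 0) (.const 3)) <| .seq (.write 0 (.const 1) (.const 3)) <|
    .seq (writeEdge 0 0 1 1 0) <| .seq (writeEdge 1 1 2 2 1) (writeEdge 2 2 0 0 2)

lemma exec_noProgram (M : Memory) : Exec noProgram M 60 noInstance.IsStoredIn := by
  refine ⟨_, _, .seq (.write ..) (.seq (.write ..) (.seq
    (.seq (.write ..) (.seq (.write ..) (.seq (.write ..) (.seq (.write ..) (.write ..))))) (.seq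
    (.seq (.write ..) (.seq (.write ..) (.seq (.write ..) (.seq (.write ..) (.write ..)))))
    (.seq (.write ..) (.seq (.write ..) (.seq (.write ..) (.seq (.write ..) (.write ..)))))))),
    by decide, ?_⟩
  refine ⟨by simp [Memory.update, Expr.eval, noInstance],
    by simp [Memory.update, Expr.eval, noInstance], fun e => ?_⟩
  change Fin 3 at e
  fin_cases e <;> simp [Memory.update, Expr.eval, noInstance, Color.weight]

section Kernel

variable {I : C2CInstance} {C : ℕ → ℕ} {M M' M'' : Memory}

lemma HasTypes.other_eq (hT : HasTypes I C M M')
    {D : Slots (Fin I.n) ℕ (Fin (I.G.numRed + I.G.numRed))} (hD : IsSlots I C M D)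
    (i : Fin (I.G.numRed + I.G.numRed)) : M' 26 i = kVertexEquiv _ (D.other i) := by
  have hk := redCount_numRed I
  have hprim : D.Prim i ↔ M 14 (M 13 i) = i := by
    rw [Slots.Prim, Fin.ext_iff, hD.slot, hD.vert]
  rw [hT.other i (by rw [hk]; exact i.2), Slots.other]
  by_cases h : D.Prim i
  · rw [if_pos (hprim.1 h), if_pos h, kVertexEquiv_val, hD.root, hD.comp, vertexLabel, hD.vert,
      Part.index, Fin.val_one]
    omega
  · rw [if_neg (mt hprim.2 h), if_neg h, kVertexEquiv_val, Part.index, Fin.val_zero]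
    omega

lemma HasKernel.isKernelOf (hM : HasData I C M) (hT : HasTypes I C M M')
    (hK : HasKernel I.G.numRed M' M'') (hC : ∀ u v : Fin I.n, C u = C v ↔
      ReflTransGen (I.G.AdjIn {e | I.G.color e = Color.blue}) u v) (hbad : M 23 0 = 0) :
    IsKernelOf I M'' := by
  have hk := redCount_numRed I
  rcases Nat.eq_zero_or_pos I.G.numRed with h0 | hpos
  · refine ⟨emptyInstance, ⟨?_, ?_, fun e => e.elim0⟩,
      iff_of_true isYes_emptyInstance (hM.isYes_of_numRed_eq_zero hC hbad h0), Nat.zero_le _,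
      Nat.zero_le _⟩
    · rw [hK.vertices, h0]; rfl
    · rw [hK.edges, h0]; rfl
  obtain ⟨ι, hι, hι'⟩ := hM.exists_isRedEnum
  obtain ⟨D, hD⟩ := hM.exists_isSlots hpos hι
  have hB : I.G.IsBlueComp D.comp (edgeLabel I C) := hD.comp ▸ isBlueComp_label hC
  have hvert : ∀ {j}, j < I.G.numRed + I.G.numRed → ∀ v : Fin I.n, M 13 j = v →
      ∃ i, D.vert i = v := fun h v hv => ⟨⟨_, h⟩, Fin.ext ((hD.vert _).trans hv)⟩
  obtain ⟨hf, hg, hiff⟩ := Slots.reconfigurable_graph_iff (D := D) hB hι' I.feasible_ini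
    I.feasible_tar (fun c => M 22 c = 1)
    (fun c h1 h2 h3 => by
      rw [hD.comp] at hB h1 h2 h3 ⊢
      exact hM.diff_iff hB hι' h1 h2 h3)
    (fun c => by rw [hD.tree, hM.eCount_eq, hM.vCount_eq, hD.comp])
    (fun c => by rw [hD.need, hM.eCount_eq, hM.vCount_eq, hD.comp])
    (fun x => by
      obtain ⟨⟨i, hi, h1⟩, ⟨j, hj, h2⟩⟩ := hM.ends_vert hι x
      exact ⟨hvert hi _ h1, hvert hj _ h2⟩)
    (fun c hc => by
      have h1 : M 15 c ≠ 0 := fun h =>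
        hM.bad_iff.2 ⟨c, ((hD.need c).1 hc).1, ((hD.need c).1 hc).2, h⟩ hbad
      obtain ⟨i, hi, h2⟩ := (hM.root_ne_zero_iff c).1 h1
      refine ⟨⟨i, hi⟩, ?_⟩
      rw [hD.comp, vertexLabel, hD.vert]
      exact h2)
  refine ⟨C2CInstance.ofEquiv _ _ _ hf hg (kVertexEquiv _) (kEdgeEquiv _ _),
    C2CInstance.isStoredIn_ofEquiv ?_ ?_ ?_, C2CInstance.isYes_ofEquiv.trans hiff, ?_, ?_⟩
  · rw [hK.vertices]; omega
  · rw [hK.edges]; omega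
  · classical
    have hrel : ∀ (f : Fin I.m → Fin I.n × Fin I.n) (i : Fin (I.G.numRed + I.G.numRed)),
        Rel (f ∘ ι) (D.vert i) ↔ 2 ≤ I.G.headDeg f Color.red (D.vert i) :=
      fun f i => hι'.rel_iff f _
    have hroot : ∀ i, D.Root i ↔ M 15 (C (M 13 i)) = i + 1 := fun i => by
      rw [Slots.Root, Fin.ext_iff, hD.root, hD.comp, vertexLabel, hD.vert]
      -- The component of a slot has a nonzero entry in array 15, so subtracting one loses no
      -- information.
      have := (hM.root_ne_zero_iff (C (M 13 i))).2 ⟨i, i.2, rfl⟩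
      omega
    have htree : ∀ i : Fin (I.G.numRed + I.G.numRed),
        M' 24 i = if D.TreeRoot i then 1 else 0 := fun i => by
      rw [hT.tree i (by rw [hk]; exact i.2)]
      refine if_congr ?_ rfl rfl
      rw [Slots.TreeRoot, hroot, hD.tree, hD.comp, vertexLabel, hD.vert]
    have hneed : ∀ i : Fin (I.G.numRed + I.G.numRed),
        M' 25 i = if D.NeedRoot i then 1 else 0 := fun i => by
      rw [hT.need i (by rw [hk]; exact i.2)]
      refine if_congr ?_ rfl rfl
      rw [Slots.NeedRoot, hroot, hD.need, hD.comp, vertexLabel, hD.vert, and_comm (a := _ = 1)]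
    have hrel₁ : ∀ i : Fin (I.G.numRed + I.G.numRed), 2 ≤ M' 16 (M' 13 i) ↔ Rel (I.ini ∘ ι) (D.vert i) := fun i => by
      rw [hrel, hT.old 16 (by norm_num) (by norm_num), hT.old 13 (by norm_num) (by norm_num),
        ← hD.vert, hM.iniDeg_eq]
    have hrel₂ : ∀ i : Fin (I.G.numRed + I.G.numRed), 2 ≤ M' 17 (M' 13 i) ↔ Rel (I.tar ∘ ι) (D.vert i) := fun i => by
      rw [hrel, hT.old 17 (by norm_num) (by norm_num), hT.old 13 (by norm_num) (by norm_num),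
        ← hD.vert, hM.tarDeg_eq]
    have hpos : ∀ (i : Fin (I.G.numRed + I.G.numRed)) (q : Part),
        (kVertexEquiv _ (i, q) : ℕ) = 4 * i + q.index := fun i q => by
      rw [kVertexEquiv_val]; omega
    have hother := hT.other_eq hD
    have hmap : ∀ (f : Fin I.m → Fin I.n × Fin I.n) (x : Fin I.G.numRed),
        (kVertexEquiv _ (D.mapRed (f ∘ ι) x).1 : ℕ) = 4 * M 14 (f (ι x)).1 ∧
        (kVertexEquiv _ (D.mapRed (f ∘ ι) x).2 : ℕ) = 4 * M 14 (f (ι x)).2 := fun f x => by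
      simp only [Slots.mapRed, hpos, hD.slot, Part.index, Fin.val_zero, Function.comp_apply,
        add_zero, and_self]
    rintro (⟨i, q⟩ | x)
    · rw [kEdgeEquiv_inl_val, hpos]
      cases q
      · obtain ⟨h1, h2, h3, h4, h5⟩ := hK.port i i.2
        rw [hother] at h1 h2 h3 h4
        refine ⟨h1.trans ?_, h2.trans ?_, h3.trans ?_, h4.trans ?_, h5⟩ <;>
        · simp only [hrel₁, hrel₂, Slots.orient]
          split_ifs <;> simp [hpos, Part.index]
      -- Positions 1 and 2 of a slot are `hub` and `left`: the tree flag shifts both ends of this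
      -- edge to `left`, the need flag only one of them, and never are both flags set.
      · obtain ⟨h1, h2, h3, h4, h5⟩ := hK.hub i i.2
        rw [htree] at h1 h2 h3 h4
        rw [hneed] at h2 h3
        refine ⟨h1.trans ?_, h2.trans ?_, h3.trans ?_, h4.trans ?_, h5⟩ <;>
        · simp only [Slots.orient, Slots.dirArc]
          by_cases ht : D.TreeRoot i
          · simp [ht, ht.not_needRoot, hpos, Part.index]
          · by_cases hn : D.NeedRoot i <;> simp [ht, hn, hpos, Part.index]
      · obtain ⟨h1, h2, h3, h4, h5⟩ := hK.left i i.2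
        rw [hneed] at h2 h3
        refine ⟨h1.trans ?_, h2.trans ?_, h3.trans ?_, h4.trans ?_, h5⟩ <;>
        · simp only [Slots.orient, Slots.dirArc]
          by_cases hn : D.NeedRoot i <;> simp [hn, hpos, Part.index]
      · obtain ⟨h1, h2, h3, h4, h5⟩ := hK.right i i.2
        rw [hneed] at h2 h3
        refine ⟨h1.trans ?_, h2.trans ?_, h3.trans ?_, h4.trans ?_, h5⟩ <;>
        · simp only [Slots.orient, Slots.dirArc]
          by_cases hn : D.NeedRoot i <;> simp [hn, hpos, Part.index]
    · obtain ⟨h1, h2, h3, h4, h5⟩ := hK.red x x.2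
      have hx := x.2.trans_eq hk.symm
      rw [mul_comm 4] at h1 h2 h3 h4 h5
      rw [kEdgeEquiv_inr_val]
      refine ⟨h1.trans ?_, h2.trans ?_, h3.trans ?_, h4.trans ?_, h5⟩
      · rw [hT.iniTail x hx, ← hι, input_ini_fst]
        exact (hmap I.ini x).1.symm
      · rw [hT.iniHead x hx, ← hι, input_ini_snd]
        exact (hmap I.ini x).2.symm
      · rw [hT.tarTail x hx, ← hι, input_tar_fst]
        exact (hmap I.tar x).1.symm
      · rw [hT.tarHead x hx, ← hι, input_tar_snd]
        exact (hmap I.tar x).2.symm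
  · change (I.G.numRed + I.G.numRed) * 4 ≤ _
    omega
  · change (I.G.numRed + I.G.numRed) * 4 + I.G.numRed ≤ _
    omega

end Kernel

/-! ### The complete algorithm -/

/-- Compute an equivalent instance. -/
def mainProgram : Program :=
  .seq componentsProgram <| .seq slotsProgram <| .seq dataProgram <|
    .ite (.read 23 (.const 0)) noProgram (.seq typesProgram kernelProgram)

/-- Merging labels takes a sweep over the vertices for each blue edge, which accounts for the
quadratic bound; the other parts take linear time. -/
lemma exec_mainProgram (I : C2CInstance) :
    Exec mainProgram I.input (20000 * (I.n + I.m + 1) ^ 2) (IsKernelOf I) := by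
  have hk := redCount_numRed I
  have hk' : redCount (I.input 5) I.m ≤ I.m := hk.trans_le (numRed_le I)
  refine ((exec_components I).seq fun M ⟨h1, h2⟩ => (exec_slots h1 hk').seq fun M₁ h3 =>
    (exec_data h3 hk').seq (T' := 3 + 8000 * (I.m + 1)) fun M₂ h4 =>
    (exec_ite (e := .read 23 (.const 0)) (T := 8000 * (I.m + 1)) (fun h => ?_) fun h => ?_).mono
      ?_ fun _ h => h).mono ?_ fun _ h => h
  · refine (exec_noProgram M₂).mono (by omega) fun M₃ h5 => ⟨noInstance, h5,
      iff_of_false not_isYes_noInstance (h4.not_isYes h2 h), ?_, ?_⟩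
    · change 3 ≤ _
      omega
    · change 3 ≤ _
      omega
  · refine ((exec_types h4 hk').seq (T' := (I.m + 1) * 6000) fun M₃ h5 =>
      (exec_kernel (k := I.G.numRed) ?_).mono ?_ fun M₄ h6 => h6.isKernelOf h4 h5 h2 h).mono
        (by omega) fun _ h => h
    · simp only [kE, mE, Expr.eval]
      rw [h5.old 0 (by norm_num) (by norm_num), h5.old 11 (by norm_num) (by norm_num),
        h4.input 0 (by norm_num), input_m, h4.rank, hk]
    · exact Nat.mul_le_mul_right _ (Nat.succ_le_succ (numRed_le I))
  · simp only [Expr.cost]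
    omega
  · nlinarith [Nat.zero_le (I.n * I.m), Nat.zero_le (I.n * I.n), Nat.zero_le (I.m * I.m)]

end NCL

/-- There is a polynomial-time algorithm that turns every instance of C2C on a constraint graph
with `k` red edges into an equivalent instance with at most `8k` vertices and `11k` edges (for
`k = 0`, at most `8` vertices and `11` edges: no-instances are never empty). -/
theorem theorem2 :
    ∃ (P : NCL.Program) (F : NCL.C2CInstance → NCL.C2CInstance),
      P.ComputesInPolyTime F ∧
      ∀ I : NCL.C2CInstance,
        ((F I).IsYes ↔ I.IsYes) ∧
        (F I).n ≤ 8 * max 1 I.G.numRed ∧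
        (F I).m ≤ 11 * max 1 I.G.numRed := by
  choose M t hrun ht F hF using NCL.exec_mainProgram
  refine ⟨NCL.mainProgram, F, ⟨20000 * (Polynomial.X + 1) ^ 2, fun I => ⟨M I, t I, hrun I, ?_,
    (hF I).1⟩⟩, fun I => (hF I).2⟩
  refine (ht I).trans (le_of_eq ?_)
  simp
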